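/- **Setting.** Let $G(\lambda)\in\mathbb C(\lambda)^{n\times n}$ be $T$-even, i.e. $G(-\lambda)^T=G(\lambda)$, and let $G(\lambda)=P(\lambda)+B^T(\lambda E-A)^{-1}B$ be a minimal $T$-even realization: $P(\lambda)=\sum_{j=0}^m\lambda^jA_j$ with $A_m\ne0$; $A,E\in\mathbb C^{r\times r}$ with $E$ nonsingular; $B\in\mathbb C^{r\times n}$; $P(\lambda)$ and $\lambda E-A$ are $T$-even; and $r$ is the smallest size among all realizations $P'+C'(\lambda E'-A')^{-1}B'$ ($P'$ a matrix polynomial, $E'$ nonsingular) of $G$. Let $$\mathcal S(\lambda)=\begin{bmatrix}P(\lambda)&B^T\\ B&A-\lambda E\end{bmatrix}.$$ **Fiedler matrices.** Matrices of size $mn$ are viewed as $m\times m$ block matrices with $n\times n$ blocks. For $X\in\mathbb C^{n\times n}$ put $M_0(X)=\mathrm{diag}(I_{(m-1)n},X)$ and $M_{-m}(X)=\mathrm{diag}(X,I_{(m-1)n})$, and for $1\le i\le m-1$ $$M_i(X)=\mathrm{diag}\left(I_{(m-i-1)n},\begin{bmatrix}X&I_n\\I_n&0\end{bmatrix},I_{(i-1)n}\right),\qquad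 M_{-i}(X)=\mathrm{diag}\left(I_{(m-i-1)n},\begin{bmatrix}0&I_n\\I_n&X\end{bmatrix},I_{(i-1)n}\right).$$ For $-m\le i\le m-1$ let $M^P_i=M_i(-A_i)$ if $i\ge0$ and $M^P_i=M_i(A_{-i})$ if $i<0$, and let $\mathbb M^P_i=\mathrm{diag}(M^P_i,I_r)$. Let $\mathbb M^{\mathcal S}_i=\mathbb M^P_i$ for $i\ne0,-m$, let $\mathbb M^{\mathcal S}_{-m}=\mathrm{diag}(M^P_{-m},-E)$, and $$\mathbb M^{\mathcal S}_0=\begin{bmatrix}M_0^P&-e_m\otimes B^T\\-e_m^T\otimes B&-A\end{bmatrix},$$ where $e_1,\dots,e_m$ are the columns of $I_m$. For an index tuple $\mathbf t=(t_1,\dots,t_k)$ put $M^P_{\mathbf t}=M^P_{t_1}\cdots M^P_{t_k}$, and similarly $\mathbb M^P_{\mathbf t}$ and $\mathbb M^{\mathcal S}_{\mathbf t}$. **Index tuples.** For $a\le b$, $(a:b)$ denotes the tuple $(a,a+1,\dots,b)$. For $0\le p\le h$ with $h-p$ even, the admissible tuple of $\{0,\dots,h\}$ of index $p$ is $(h-1:h,\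 h-3:h-2,\dots,p+1:p+2,\ 0:p)$; its symmetric complement is $(h-1,h-3,\dots,p+1,\ 0:p-1,\ 0:p-2,\dots,0:1,\ 0)$, where the strings $0:p-1,\dots,0$ are absent if $p=0$. An admissible tuple is simple if its index is $0$ or $1$. For a tuple $\mathbf w$ containing $0$, $i_0(\mathbf w)$ is the largest $s$ such that $(s,s-1,\dots,1,0)$ is a subtuple (subsequence) of $\mathbf w$. Let $0\le h\le m-1$ be even, let $\mathbf w$ be the simple admissible tuple of $\{0,\dots,h\}$ and $\mathbf c_w$ its symmetric complement. Let $\mathbf z$ be such that $\mathbf z+m$ (entrywise shift) is an admissible tuple of $\{0,\dots,m-h-1\}$, denote its index by $\mathrm{Ind}(\mathbf z+m)$, and let $\mathbf c_z+m$ be the symmetric complement of $\mathbf z+m$. Put $$L(\lambda)=(\lambda M^P_{\mathbf z}-M^P_{\mathbf w})M^P_{\mathbf c_w}M^P_{\mathbf c_z},\qquad \mathbb L(\lambda)=(\lambda\mathbb M^{\mathcal S}_{\mathbf z}-\mathbb M^{\mathcal S}_{\mathbf w})\,\mathbb M^P_{\mathbf c_w}\,\mathbb M^P_{\mathbf c_z}.$$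 A quasi-identity matrix is $Q=\epsilon_1I_n\oplus\cdots\oplus\epsilon_mI_n$ with parameters $\epsilon_i\in\{1,-1\}$. **Rosenbrock strong linearization.** A pencil $$\mathbb T(\lambda)=\begin{bmatrix}\mathcal X-\lambda\mathcal Y&\mathcal C\\ \mathcal B&H-\lambda K\end{bmatrix}$$ with constant blocks, where $\mathcal X,\mathcal Y\in\mathbb C^{mn\times mn}$ and $H,K\in\mathbb C^{r\times r}$ with $K$ nonsingular, is a Rosenbrock strong linearization of $G$ if the realization $\mathbb G_{\mathbb T}(\lambda)=\mathcal X-\lambda\mathcal Y+\mathcal C(\lambda K-H)^{-1}\mathcal B$ is minimal and * there are unimodular matrix polynomials $U,V$ and nonsingular $U_0,V_0\in\mathbb C^{r\times r}$ with $\mathrm{diag}(U,U_0)\,\mathbb T\,\mathrm{diag}(V,V_0)=\mathrm{diag}(I_{(m-1)n},\mathcal S)$; * there are biproper rational matrices $\mathcal O_\ell,\mathcal O_r$ (that is, having a nonsingular limit as $\lambda\to\infty$) with $\mathcal O_\ell\,\lambda^{-1}\mathbb G_{\mathbb T}\,\mathcal O_r=\mathrm{diag}(I_{(m-1)n},\lambda^{-m}G)$.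 **Theorem.** Let $\alpha=i_0(\mathbf w)$; then $1\le m-\alpha\le m$. 1. There is a quasi-identity matrix $Q$, unique up to multiplication by $-1$, such that $QL(\lambda)$ is $T$-even. Let $\mathbf s$ be the $(m-\alpha)$-th parameter of $Q$ and $\mathbb Q=\mathrm{diag}(\mathbf sQ,I_r)$. Then $$\mathbb Q\mathbb L(\lambda)=\begin{bmatrix}\mathbf sQL(\lambda)&e_{m-\alpha}\otimes B^T\\ e_{m-\alpha}^T\otimes B&A-\lambda E\end{bmatrix},$$ and $\mathbb Q\mathbb L(\lambda)$ is $T$-even. Moreover, $\mathbb Q$ is the only matrix of the form $\mathrm{diag}(\mathbf s'Q',I_r)$, with $Q'$ a quasi-identity matrix and $\mathbf s'$ its $(m-\alpha)$-th parameter, whose product with $\mathbb L(\lambda)$ is $T$-even. If $r>0$, it is even the only matrix of the form $\mathrm{diag}(Q',I_r)$, with $Q'$ a quasi-identity matrix, with this property. 2. If $A_m$ is nonsingular or $\mathrm{Ind}(\mathbf z+m)=0$, then $\mathbb Q\mathbb L(\lambda)$ is a Rosenbrock strong linearization of $G(\lambda)$. 3. The transfer function $\mathbf sQL(\lambda)+(e_{m-\alpha}\otimes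 B^T)(\lambda E-A)^{-1}(e_{m-\alpha}^T\otimes B)$ of $\mathbb Q\mathbb L(\lambda)$ is $T$-even. -/

import Mathlib

open Matrix
open scoped Polynomial

noncomputable section

/- ## Rational matrices, polynomial matrices, T-evenness -/

/-- A polynomial matrix `M(x)` is T-even: `M(-x)ᵀ = M(x)`. -/
def IsTEven {ι : Type*} (M : Matrix ι ι ℂ[X]) : Prop :=
  (M.map fun f => f.comp (-Polynomial.X))ᵀ = M

/-- A rational matrix `G(x)` is T-even (Hamiltonian): `G(-x)ᵀ = G(x)`.
The substitution `x ↦ -x` is evaluation of a rational function at the element `-x` of `ℂ(x)`. -/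
def IsTEvenRat {ι : Type*} (G : Matrix ι ι (RatFunc ℂ)) : Prop :=
  (G.map fun f => f.eval RatFunc.C (-RatFunc.X))ᵀ = G

/-- `F(x) → D` as `x → ∞` for some nonsingular constant matrix `D`. -/
def IsBiproper {ι : Type*} [Fintype ι] [DecidableEq ι] (F : Matrix ι ι (RatFunc ℂ)) : Prop :=
  ∃ D : Matrix ι ι ℂ, IsUnit D.det ∧
    ∀ i j, Filter.Tendsto (fun z : ℂ => (F i j).eval (RingHom.id ℂ) z)
      (Bornology.cobounded ℂ) (nhds (D i j))

/-- A polynomial matrix whose determinant is a nonzero constant. -/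
def IsUnimodular {ι : Type*} [Fintype ι] [DecidableEq ι] (U : Matrix ι ι ℂ[X]) : Prop :=
  ∃ c : ℂ, c ≠ 0 ∧ U.det = Polynomial.C c

/-- The pencil `x E - A`. -/
def pencil {ι κ : Type*} (E A : Matrix ι κ ℂ) : Matrix ι κ ℂ[X] :=
  (Polynomial.X : ℂ[X]) • E.map Polynomial.C - A.map Polynomial.C

/-- The coefficient of `x ^ j` in a polynomial matrix. -/
def coeffMat {ι : Type*} (P : Matrix ι ι ℂ[X]) (j : ℕ) : Matrix ι ι ℂ :=
  P.map fun f => f.coeff j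

/-- `P(x) = A₀ + A₁ x + ⋯ + A_m x ^ m` with `A_m ≠ 0`. -/
def HasDegree {ι : Type*} (P : Matrix ι ι ℂ[X]) (m : ℕ) : Prop :=
  (∀ i j, (P i j).natDegree ≤ m) ∧ coeffMat P m ≠ 0

/- ## Realizations -/

/-- Data of a realization `P(x) + C (x E - A)⁻¹ B` with `r × r` pencil `x E - A`,
`E` nonsingular. -/
structure Realization (ι : Type*) (r : ℕ) where
  P : Matrix ι ι ℂ[X]
  C : Matrix ι (Fin r) ℂ
  E : Matrix (Fin r) (Fin r) ℂ
  A : Matrix (Fin r) (Fin r) ℂ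
  B : Matrix (Fin r) ι ℂ
  isUnit_det_E : IsUnit E.det

namespace Realization

variable {ι : Type*} {r : ℕ}

/-- The rational matrix `P(x) + C (x E - A)⁻¹ B`. -/
def transfer (R : Realization ι r) : Matrix ι ι (RatFunc ℂ) :=
  R.P.map (algebraMap ℂ[X] (RatFunc ℂ)) +
    R.C.map RatFunc.C *
      ((RatFunc.X : RatFunc ℂ) • R.E.map RatFunc.C - R.A.map RatFunc.C)⁻¹ *
      R.B.map RatFunc.C

/-- The Rosenbrock system matrix `[P(x), C; B, A - x E]`. -/
def systemMatrix (R : Realization ι r) : Matrix (ι ⊕ Fin r) (ι ⊕ Fin r) ℂ[X] :=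
  fromBlocks R.P (R.C.map Polynomial.C) (R.B.map Polynomial.C) (-pencil R.E R.A)

/-- The size `r` is the smallest among all realizations of the same rational matrix. The system
matrix is then said to be irreducible. -/
def IsMinimal (R : Realization ι r) : Prop :=
  ∀ (r' : ℕ) (R' : Realization ι r'), R'.transfer = R.transfer → r ≤ r'

/-- A T-even realization: `C = Bᵀ`, and `P(x)`, `x E - A` are T-even. -/
def IsTEvenRealization (R : Realization ι r) : Prop :=
  R.C = R.Bᵀ ∧ IsTEven R.P ∧ IsTEven (pencil R.E R.A)

end Realization

/- ## Block matrices

Block rows and columns of `mn × mn` matrices are numbered `1, …, m`: the block number of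
`p : Fin m × Fin n` is `p.1 + 1`. -/

/-- `e_k ⊗ C`, where `e_k` is the `k`-th column of the identity matrix of size `m`. -/
def blockCol {α : Type*} [Zero α] (m : ℕ) {n r : ℕ} (k : ℤ) (C : Matrix (Fin n) (Fin r) α) :
    Matrix (Fin m × Fin n) (Fin r) α :=
  Matrix.of fun p j => if ((p.1 : ℕ) : ℤ) + 1 = k then C p.2 j else 0

/-- `e_kᵀ ⊗ B`, where `e_k` is the `k`-th column of the identity matrix of size `m`. -/
def blockRow {α : Type*} [Zero α] (m : ℕ) {n r : ℕ} (k : ℤ) (B : Matrix (Fin r) (Fin n) α) :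
    Matrix (Fin r) (Fin m × Fin n) α :=
  Matrix.of fun i q => if ((q.1 : ℕ) : ℤ) + 1 = k then B i q.2 else 0

/-- `diag(I_{(m-1)n}, M)` for an `n × n` matrix `M`. -/
def padIdentity {α : Type*} [Zero α] [One α] (m : ℕ) {n : ℕ} (M : Matrix (Fin n) (Fin n) α) :
    Matrix (Fin m × Fin n) (Fin m × Fin n) α :=
  Matrix.of fun p q =>
    if (p.1 : ℕ) + 1 = m ∧ (q.1 : ℕ) + 1 = m then M p.2 q.2 else if p = q then 1 else 0

/-- `diag(I_{(m-1)n}, S(x))` for the system matrix `S(x)` of a realization. -/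
def padSystem (m : ℕ) {n r : ℕ} (R : Realization (Fin n) r) :
    Matrix ((Fin m × Fin n) ⊕ Fin r) ((Fin m × Fin n) ⊕ Fin r) ℂ[X] :=
  fromBlocks (padIdentity m R.P) (blockCol m (m : ℤ) (R.C.map Polynomial.C))
    (blockRow m (m : ℤ) (R.B.map Polynomial.C)) (-pencil R.E R.A)

/-- Rosenbrock strong linearization of the rational matrix `R.transfer = P + C (x E - A)⁻¹ B`
with `P` of degree `m`: `LL` is an irreducible system matrix of a realization `R'` of size `r`
with polynomial part a pencil `X - x Y`, satisfying the conditions (a) (finite structure) and (b)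
(structure at infinity). -/
def IsRosenbrockStrongLinearization (m : ℕ) {n r : ℕ} (R : Realization (Fin n) r)
    (LL : Matrix ((Fin m × Fin n) ⊕ Fin r) ((Fin m × Fin n) ⊕ Fin r) ℂ[X]) : Prop :=
  ∃ R' : Realization (Fin m × Fin n) r,
    LL = R'.systemMatrix ∧
    (∃ X Y : Matrix (Fin m × Fin n) (Fin m × Fin n) ℂ, R'.P = -pencil Y X) ∧
    R'.IsMinimal ∧
    (∃ (U V : Matrix (Fin m × Fin n) (Fin m × Fin n) ℂ[X]) (U₀ V₀ : Matrix (Fin r) (Fin r) ℂ),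
      IsUnimodular U ∧ IsUnimodular V ∧ IsUnit U₀.det ∧ IsUnit V₀.det ∧
      fromBlocks U 0 0 (U₀.map Polynomial.C) * LL * fromBlocks V 0 0 (V₀.map Polynomial.C) =
        padSystem m R) ∧
    (∃ Ol Or : Matrix (Fin m × Fin n) (Fin m × Fin n) (RatFunc ℂ),
      IsBiproper Ol ∧ IsBiproper Or ∧
      Ol * ((RatFunc.X : RatFunc ℂ)⁻¹ • R'.transfer) * Or =
        padIdentity m (((RatFunc.X : RatFunc ℂ) ^ m)⁻¹ • R.transfer))

/- ## Fiedler matrices -/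

/-- The `(i, j)` block (`1 ≤ i, j ≤ m`) of the elementary matrix `M_k(X)`, `-m ≤ k ≤ m - 1`:
`M_0(X) = diag(I, X)`, `M_{-m}(X) = diag(X, I)`, and for `1 ≤ l ≤ m - 1` the matrices `M_l(X)`
and `M_{-l}(X)` are the identity except for the rows and columns `m - l`, `m - l + 1`, where they
are `[X, I; I, 0]` and `[0, I; I, X]` respectively. -/
def elemBlock (m : ℤ) {n : ℕ} (k : ℤ) (X : Matrix (Fin n) (Fin n) ℂ) (i j : ℤ) :
    Matrix (Fin n) (Fin n) ℂ :=
  if k = 0 then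
    if i = m ∧ j = m then X else if i = j then 1 else 0
  else if k = -m then
    if i = 1 ∧ j = 1 then X else if i = j then 1 else 0
  else if i = m - |k| ∧ j = m - |k| then
    if 0 < k then X else 0
  else if i = m - |k| + 1 ∧ j = m - |k| + 1 then
    if 0 < k then 0 else X
  else if (i = m - |k| ∧ j = m - |k| + 1) ∨ (i = m - |k| + 1 ∧ j = m - |k|) then 1
  else if i = j then 1 else 0

/-- The elementary matrix `M_k(X)`, `-m ≤ k ≤ m - 1`. -/
def elemMat (m : ℕ) {n : ℕ} (k : ℤ) (X : Matrix (Fin n) (Fin n) ℂ) :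
    Matrix (Fin m × Fin n) (Fin m × Fin n) ℂ :=
  Matrix.of fun p q =>
    elemBlock (m : ℤ) k X (((p.1 : ℕ) : ℤ) + 1) (((q.1 : ℕ) : ℤ) + 1) p.2 q.2

/-- The Fiedler matrix `M_k^P` of `P(x)`: `M_k(-A_k)` if `k ≥ 0`, `M_k(A_{-k})` if `k < 0`. -/
def fiedlerP (m : ℕ) {n : ℕ} (P : Matrix (Fin n) (Fin n) ℂ[X]) (k : ℤ) :
    Matrix (Fin m × Fin n) (Fin m × Fin n) ℂ :=
  if 0 ≤ k then elemMat m k (-coeffMat P k.natAbs) else elemMat m k (coeffMat P k.natAbs)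

/-- `diag(M_k^P, I_r)`. -/
def fiedlerPExt (m : ℕ) {n : ℕ} (r : ℕ) (P : Matrix (Fin n) (Fin n) ℂ[X]) (k : ℤ) :
    Matrix ((Fin m × Fin n) ⊕ Fin r) ((Fin m × Fin n) ⊕ Fin r) ℂ :=
  fromBlocks (fiedlerP m P k) 0 0 1

/-- The Fiedler matrices of the system matrix. Since `M_k(X)⁻¹ = M_{-k}(-X)` for
`1 ≤ k ≤ m - 1`, the last case also covers the negative indices, for which the Fiedler matrix is
the inverse of the one of index `-k`. -/
def fiedlerS (m : ℕ) {n r : ℕ} (R : Realization (Fin n) r) (k : ℤ) :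
    Matrix ((Fin m × Fin n) ⊕ Fin r) ((Fin m × Fin n) ⊕ Fin r) ℂ :=
  if k = 0 then
    fromBlocks (fiedlerP m R.P 0) (-blockCol m (m : ℤ) R.C) (-blockRow m (m : ℤ) R.B) (-R.A)
  else if k = -(m : ℤ) then
    fromBlocks (fiedlerP m R.P (-(m : ℤ))) 0 0 (-R.E)
  else fiedlerPExt m r R.P k

/- ## Index tuples -/

/-- The string `(0 : b) = (0, 1, …, b)`. -/
def stringZero (b : ℕ) : List ℤ := (List.range (b + 1)).map fun i => (i : ℤ)

/-- `w = (h-1 : h, h-3 : h-2, …, p+1 : p+2, 0 : p)`, the admissible tuple of `{0, …, h}` with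
index `p`; here `0 ≤ p ≤ h` and `h - p` is even. -/
def IsAdmissible (h p : ℕ) (w : List ℤ) : Prop :=
  p ≤ h ∧ Even (h - p) ∧
    w = ((List.range ((h - p) / 2)).reverse.flatMap fun i =>
        [(p : ℤ) + 2 * i + 1, (p : ℤ) + 2 * i + 2]) ++ stringZero p

/-- The symmetric complement `(h-1, h-3, …, p+1, 0 : p-1, 0 : p-2, …, 0 : 1, 0)` of the admissible
tuple of `{0, …, h}` with index `p`. -/
def symmetricComplement (h p : ℕ) : List ℤ :=
  ((List.range ((h - p) / 2)).reverse.map fun i => (p : ℤ) + 2 * i + 1) ++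
    (List.range p).reverse.flatMap stringZero

/-- The number of consecutive inversions of `α` at `t`: the largest `s` such that
`(t + s, …, t + 1, t)` is a subtuple of `α`; it is `-1` if `t` does not occur in `α`. -/
def inversionsAt (t : ℤ) (α : List ℤ) : ℤ :=
  if t ∈ α then
    (Nat.findGreatest
      (fun s => ((List.range (s + 1)).reverse.map fun i => t + (i : ℤ)).Sublist α) α.length : ℤ)
  else -1

/- ## The pencils -/

/-- `(x M^P_z - M^P_w) M^P_{c_w} M^P_{c_z}`. -/
def pencilP (m : ℕ) {n : ℕ} (P : Matrix (Fin n) (Fin n) ℂ[X]) (z w cw cz : List ℤ) :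
    Matrix (Fin m × Fin n) (Fin m × Fin n) ℂ[X] :=
  pencil (z.map (fiedlerP m P)).prod (w.map (fiedlerP m P)).prod *
    ((cw.map (fiedlerP m P)).prod.map Polynomial.C) *
    ((cz.map (fiedlerP m P)).prod.map Polynomial.C)

/-- `(x 𝕄^S_z - 𝕄^S_w) 𝕄^P_{c_w} 𝕄^P_{c_z}`. -/
def pencilS (m : ℕ) {n r : ℕ} (R : Realization (Fin n) r) (z w cw cz : List ℤ) :
    Matrix ((Fin m × Fin n) ⊕ Fin r) ((Fin m × Fin n) ⊕ Fin r) ℂ[X] :=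
  pencil (z.map (fiedlerS m R)).prod (w.map (fiedlerS m R)).prod *
    ((cw.map (fiedlerPExt m r R.P)).prod.map Polynomial.C) *
    ((cz.map (fiedlerPExt m r R.P)).prod.map Polynomial.C)

/-- The quasi-identity matrix `ε₁ I_n ⊕ ⋯ ⊕ ε_m I_n`, `ε_i = ±1`. -/
def quasiIdentity {m : ℕ} (n : ℕ) (ε : Fin m → ℤˣ) :
    Matrix (Fin m × Fin n) (Fin m × Fin n) ℂ[X] :=
  Matrix.diagonal fun p => ((ε p.1 : ℤ) : ℂ[X])

/-- `diag(Q, I_r)`. -/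
def quasiIdentityExt {m n : ℕ} (r : ℕ) (Q : Matrix (Fin m × Fin n) (Fin m × Fin n) ℂ[X]) :
    Matrix ((Fin m × Fin n) ⊕ Fin r) ((Fin m × Fin n) ⊕ Fin r) ℂ[X] :=
  fromBlocks Q 0 0 1

/-- The realization with polynomial part `L`, state pencil `x E - A`, `C`-part `e_k ⊗ Bᵀ` and
`B`-part `e_kᵀ ⊗ B`. -/
def liftRealization (m : ℕ) {n r : ℕ} (R : Realization (Fin n) r) (k : ℤ)
    (L : Matrix (Fin m × Fin n) (Fin m × Fin n) ℂ[X]) : Realization (Fin m × Fin n) r where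
  P := L
  C := blockCol m k R.Bᵀ
  E := R.E
  A := R.A
  B := blockRow m k R.B
  isUnit_det_E := R.isUnit_det_E

end

/-!
Write `L = x X - Y`. Fiedler matrices whose nontrivial blocks do not overlap commute, so `X` and `Y`
can be rearranged into products in which each factor satisfies `Fᵀ D = D' F` for diagonal sign
matrices `D`, `D'`; these relations compose to `Xᵀ D = -D X` and `Yᵀ D = D Y` for a single `D`, that
is, `D L` is T-even. The ratio of two such `D` commutes with `X` and `Y`. Being block diagonal, it
commutes with the single factors, each of which links neighbouring blocks, so it is `1` or `-1`.

For the linearization property, the factors common to `X` and `Y` are invertible when `A_m` is or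
the index of `z + m` is `0`, and `B` and `Bᵀ` pass through them to the last block. What remains is
eliminated along the chain of blocks by Horner's scheme, over any commutative ring: over `ℂ[x]` this
gives the unimodular equivalence, and over the ring of proper rational functions, with `1 / x` for
`x`, the equivalence at infinity.
-/

noncomputable section

/-! ### Block matrices -/

/-- `m × m` block matrices with `n × n` blocks. Block rows and columns are addressed by natural
numbers `0, …, m - 1`, so that index `i` is the paper's block number `i + 1`. -/
abbrev BlockMatrix (m n : ℕ) (S : Type*) := Matrix (Fin m × Fin n) (Fin m × Fin n) S

/-- The block matrix with blocks `F i j`, `i, j < m`. -/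
def ofBlocks (m : ℕ) {n : ℕ} {S : Type*} (F : ℕ → ℕ → Matrix (Fin n) (Fin n) S) :
    BlockMatrix m n S :=
  of fun p q => F p.1 q.1 p.2 q.2

section BlockCalculus

variable {m n : ℕ} {S : Type*}

lemma ofBlocks_congr {F F' : ℕ → ℕ → Matrix (Fin n) (Fin n) S}
    (h : ∀ i < m, ∀ j < m, F i j = F' i j) : ofBlocks m F = ofBlocks m F' := by
  ext p q
  simp only [ofBlocks, of_apply, h _ p.1.2 _ q.1.2]

lemma ofBlocks_inj {F F' : ℕ → ℕ → Matrix (Fin n) (Fin n) S} (h : ofBlocks m F = ofBlocks m F')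
    {i j : ℕ} (hi : i < m) (hj : j < m) : F i j = F' i j := by
  ext k l
  exact congrFun (congrFun h (⟨i, hi⟩, k)) (⟨j, hj⟩, l)

lemma ofBlocks_transpose (F : ℕ → ℕ → Matrix (Fin n) (Fin n) S) :
    (ofBlocks m F)ᵀ = ofBlocks m fun i j => (F j i)ᵀ := rfl

variable [CommRing S]

/-- The block matrix whose only nonzero block is `X`, in position `(a, b)`; it vanishes when the
position lies outside the matrix. -/
def singleBlock (m : ℕ) (a b : ℕ) (X : Matrix (Fin n) (Fin n) S) : BlockMatrix m n S :=
  ofBlocks m fun i j => if i = a ∧ j = b then X else 0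

/-- The block diagonal matrix `f 0 ⊕ ⋯ ⊕ f (m - 1)`. -/
def diagBlocks (m : ℕ) (f : ℕ → Matrix (Fin n) (Fin n) S) : BlockMatrix m n S :=
  ofBlocks m fun i j => if i = j then f i else 0

/-- The block diagonal matrix `d 0 • I_n ⊕ ⋯ ⊕ d (m - 1) • I_n`. -/
def scalarBlocks (m n : ℕ) (d : ℕ → S) : BlockMatrix m n S :=
  diagBlocks m fun i => d i • 1

/-- The identity matrix with `[X, 1; 1, 0]` in block rows and columns `a, b`, in this order. -/
def swapFactor (m : ℕ) (a b : ℕ) (X : Matrix (Fin n) (Fin n) S) : BlockMatrix m n S :=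
  1 - singleBlock m a a 1 - singleBlock m b b 1 +
    (singleBlock m a a X + singleBlock m a b 1 + singleBlock m b a 1)

/-- The identity matrix with `X` in the diagonal block `a`. -/
def diagFactor (m : ℕ) (a : ℕ) (X : Matrix (Fin n) (Fin n) S) : BlockMatrix m n S :=
  1 - singleBlock m a a 1 + singleBlock m a a X

lemma ofBlocks_add (F F' : ℕ → ℕ → Matrix (Fin n) (Fin n) S) :
    ofBlocks m F + ofBlocks m F' = ofBlocks m fun i j => F i j + F' i j := rfl

lemma ofBlocks_sub (F F' : ℕ → ℕ → Matrix (Fin n) (Fin n) S) :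
    ofBlocks m F - ofBlocks m F' = ofBlocks m fun i j => F i j - F' i j := rfl

lemma diagBlocks_one : diagBlocks m (fun _ => (1 : Matrix (Fin n) (Fin n) S)) = 1 := by
  ext ⟨i, k⟩ ⟨j, l⟩
  by_cases hij : i = j
  · subst hij
    simp [diagBlocks, ofBlocks, one_apply]
  · simp [diagBlocks, ofBlocks, hij, Fin.val_inj]

lemma singleBlock_mul_ofBlocks (a : ℕ) {b : ℕ} (hb : b < m) (X : Matrix (Fin n) (Fin n) S)
    (F : ℕ → ℕ → Matrix (Fin n) (Fin n) S) :
    singleBlock m a b X * ofBlocks m F =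
      ofBlocks m fun i j => if i = a then X * F b j else 0 := by
  ext ⟨i, k⟩ ⟨j, l⟩
  rw [mul_apply, Fintype.sum_prod_type, Finset.sum_eq_single ⟨b, hb⟩]
  · by_cases hi : (i : ℕ) = a <;> simp [singleBlock, ofBlocks, hi, mul_apply]
  · intro c _ hc
    have : (c : ℕ) ≠ b := fun h => hc (Fin.ext h)
    simp [singleBlock, ofBlocks, this]
  · simp

lemma diagBlocks_mul_ofBlocks (f : ℕ → Matrix (Fin n) (Fin n) S)
    (F : ℕ → ℕ → Matrix (Fin n) (Fin n) S) :
    diagBlocks m f * ofBlocks m F = ofBlocks m fun i j => f i * F i j := by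
  ext ⟨i, k⟩ ⟨j, l⟩
  rw [mul_apply, Fintype.sum_prod_type, Finset.sum_eq_single i]
  · simp [diagBlocks, ofBlocks, mul_apply]
  · intro c _ hc
    have : (i : ℕ) ≠ c := fun h => hc (Fin.ext h.symm)
    simp [diagBlocks, ofBlocks, this]
  · simp

lemma ofBlocks_mul_diagBlocks (f : ℕ → Matrix (Fin n) (Fin n) S)
    (F : ℕ → ℕ → Matrix (Fin n) (Fin n) S) :
    ofBlocks m F * diagBlocks m f = ofBlocks m fun i j => F i j * f j := by
  ext ⟨i, k⟩ ⟨j, l⟩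
  rw [mul_apply, Fintype.sum_prod_type, Finset.sum_eq_single j]
  · simp [diagBlocks, ofBlocks, mul_apply]
  · intro c _ hc
    have : (c : ℕ) ≠ j := fun h => hc (Fin.ext h)
    simp [diagBlocks, ofBlocks, this]
  · simp

lemma diagBlocks_mul_diagBlocks (f g : ℕ → Matrix (Fin n) (Fin n) S) :
    diagBlocks m f * diagBlocks m g = diagBlocks m fun i => f i * g i := by
  rw [diagBlocks, ofBlocks_mul_diagBlocks]
  refine ofBlocks_congr fun i _ j _ => ?_
  split_ifs with h
  · rw [h]
  · rw [Matrix.zero_mul]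

lemma diagBlocks_mul_singleBlock (f : ℕ → Matrix (Fin n) (Fin n) S) (a b : ℕ)
    (X : Matrix (Fin n) (Fin n) S) :
    diagBlocks m f * singleBlock m a b X = singleBlock m a b (f a * X) := by
  rw [singleBlock, diagBlocks_mul_ofBlocks]
  refine ofBlocks_congr fun i _ j _ => ?_
  split_ifs with h
  · rw [h.1]
  · rw [Matrix.mul_zero]

lemma singleBlock_mul_diagBlocks (f : ℕ → Matrix (Fin n) (Fin n) S) (a b : ℕ)
    (X : Matrix (Fin n) (Fin n) S) :
    singleBlock m a b X * diagBlocks m f = singleBlock m a b (X * f b) := by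
  rw [singleBlock, ofBlocks_mul_diagBlocks]
  refine ofBlocks_congr fun i _ j _ => ?_
  split_ifs with h
  · rw [h.2]
  · rw [Matrix.zero_mul]

lemma singleBlock_mul_singleBlock (a : ℕ) {b : ℕ} (d : ℕ) (hb : b < m)
    (X Y : Matrix (Fin n) (Fin n) S) :
    singleBlock m a b X * singleBlock m b d Y = singleBlock m a d (X * Y) := by
  rw [singleBlock, singleBlock, ← singleBlock, singleBlock_mul_ofBlocks _ hb]
  refine ofBlocks_congr fun i _ j _ => ?_
  by_cases hi : i = a <;> by_cases hj : j = d <;> simp [hi, hj]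

lemma singleBlock_mul_singleBlock_of_ne {a b c d : ℕ} (hbc : b ≠ c)
    (X Y : Matrix (Fin n) (Fin n) S) : singleBlock m a b X * singleBlock m c d Y = 0 := by
  ext p q
  rw [mul_apply, Matrix.zero_apply]
  refine Finset.sum_eq_zero fun t _ => ?_
  by_cases ht : (t.1 : ℕ) = b
  · simp [singleBlock, ofBlocks, ht, hbc]
  · simp [singleBlock, ofBlocks, ht]

lemma singleBlock_zero (a b : ℕ) : singleBlock m a b (0 : Matrix (Fin n) (Fin n) S) = 0 := by
  ext p q
  simp [singleBlock, ofBlocks]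

lemma singleBlock_add (a b : ℕ) (X Y : Matrix (Fin n) (Fin n) S) :
    singleBlock m a b (X + Y) = singleBlock m a b X + singleBlock m a b Y := by
  simp only [singleBlock, ofBlocks_add]
  refine ofBlocks_congr fun i _ j _ => ?_
  split_ifs <;> simp

lemma singleBlock_neg (a b : ℕ) (X : Matrix (Fin n) (Fin n) S) :
    singleBlock m a b (-X) = -singleBlock m a b X := by
  rw [eq_neg_iff_add_eq_zero, ← singleBlock_add, neg_add_cancel, singleBlock_zero]

lemma singleBlock_sub (a b : ℕ) (X Y : Matrix (Fin n) (Fin n) S) :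
    singleBlock m a b (X - Y) = singleBlock m a b X - singleBlock m a b Y := by
  rw [sub_eq_add_neg, singleBlock_add, singleBlock_neg, sub_eq_add_neg]

lemma singleBlock_smul (x : S) (a b : ℕ) (X : Matrix (Fin n) (Fin n) S) :
    singleBlock m a b (x • X) = x • singleBlock m a b X := by
  ext p q
  simp only [singleBlock, ofBlocks, of_apply, Matrix.smul_apply]
  split_ifs <;> simp

lemma singleBlock_transpose (a b : ℕ) (X : Matrix (Fin n) (Fin n) S) :
    (singleBlock m a b X)ᵀ = singleBlock m b a Xᵀ := by
  rw [singleBlock, ofBlocks_transpose]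
  refine ofBlocks_congr fun i _ j _ => ?_
  simp only [and_comm (a := j = a)]
  split_ifs <;> simp

lemma singleBlock_of_le {a : ℕ} (ha : m ≤ a) (b : ℕ) (X : Matrix (Fin n) (Fin n) S) :
    singleBlock m a b X = 0 := by
  ext p q
  have : (p.1 : ℕ) ≠ a := by omega
  simp [singleBlock, ofBlocks, this]

lemma singleBlock_map {S' : Type*} [CommRing S'] (g : S →+* S') (a b : ℕ)
    (X : Matrix (Fin n) (Fin n) S) :
    (singleBlock m a b X).map g = singleBlock m a b (X.map g) := by
  ext p q
  simp only [singleBlock, ofBlocks, map_apply, of_apply]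
  split_ifs <;> simp

lemma diagBlocks_transpose (f : ℕ → Matrix (Fin n) (Fin n) S) :
    (diagBlocks m f)ᵀ = diagBlocks m fun i => (f i)ᵀ := by
  rw [diagBlocks, ofBlocks_transpose]
  refine ofBlocks_congr fun i _ j _ => ?_
  simp only [eq_comm (a := j)]
  split_ifs with h
  · rw [h]
  · rw [transpose_zero]

lemma diagBlocks_eq_sum (f : ℕ → Matrix (Fin n) (Fin n) S) :
    diagBlocks m f = ∑ i ∈ Finset.range m, singleBlock m i i (f i) := by
  ext p q
  rw [Matrix.sum_apply, Finset.sum_eq_single_of_mem _ (Finset.mem_range.2 p.1.2)]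
  · simp [diagBlocks, singleBlock, ofBlocks, eq_comm]
  · intro c _ hc
    simp [singleBlock, ofBlocks, hc.symm]

lemma sum_singleBlock_one :
    ∑ i ∈ Finset.range m, singleBlock m i i (1 : Matrix (Fin n) (Fin n) S) = 1 := by
  rw [← diagBlocks_eq_sum, diagBlocks_one]

lemma ext_singleBlock_mul {M N : BlockMatrix m n S}
    (h : ∀ c, singleBlock m c c 1 * M = singleBlock m c c 1 * N) : M = N := by
  rw [← Matrix.one_mul M, ← Matrix.one_mul N, ← sum_singleBlock_one, Finset.sum_mul,
    Finset.sum_mul]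
  exact Finset.sum_congr rfl fun c _ => h c

lemma diagBlocks_update (f : ℕ → Matrix (Fin n) (Fin n) S) (a : ℕ)
    (X : Matrix (Fin n) (Fin n) S) :
    diagBlocks m (Function.update f a X) = diagBlocks m f + singleBlock m a a (X - f a) := by
  simp only [diagBlocks, singleBlock, ofBlocks_add]
  refine ofBlocks_congr fun i _ j _ => ?_
  rcases eq_or_ne i a with rfl | hi
  · rcases eq_or_ne i j with rfl | hj
    · simp
    · simp [hj, hj.symm]
  · simp [hi]

lemma diagFactor_eq_diagBlocks (a : ℕ) (X : Matrix (Fin n) (Fin n) S) :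
    diagFactor m a X = diagBlocks m (Function.update (fun _ => 1) a X) := by
  rw [diagBlocks_update, diagBlocks_one, singleBlock_sub, diagFactor]
  abel

lemma scalarBlocks_mul_singleBlock (d : ℕ → S) (a b : ℕ) (X : Matrix (Fin n) (Fin n) S) :
    scalarBlocks m n d * singleBlock m a b X = singleBlock m a b (d a • X) := by
  rw [scalarBlocks, diagBlocks_mul_singleBlock, Matrix.smul_mul, Matrix.one_mul]

lemma singleBlock_mul_scalarBlocks (d : ℕ → S) (a b : ℕ) (X : Matrix (Fin n) (Fin n) S) :
    singleBlock m a b X * scalarBlocks m n d = singleBlock m a b (d b • X) := by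
  rw [scalarBlocks, singleBlock_mul_diagBlocks, Matrix.mul_smul, Matrix.mul_one]

lemma scalarBlocks_mul_scalarBlocks (d e : ℕ → S) :
    scalarBlocks m n d * scalarBlocks m n e = scalarBlocks m n (d * e) := by
  rw [scalarBlocks, scalarBlocks, diagBlocks_mul_diagBlocks]
  simp only [Matrix.smul_mul, Matrix.one_mul, smul_smul]
  rfl

lemma scalarBlocks_transpose (d : ℕ → S) : (scalarBlocks m n d)ᵀ = scalarBlocks m n d := by
  simp only [scalarBlocks, diagBlocks_transpose, transpose_smul, transpose_one]

lemma swapFactor_mul_swapFactor {a b : ℕ} (ha : a < m) (hb : b < m) (hab : a ≠ b)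
    (X : Matrix (Fin n) (Fin n) S) : swapFactor m a b X * swapFactor m b a (-X) = 1 := by
  simp only [swapFactor, singleBlock_neg, Matrix.add_mul, Matrix.sub_mul, Matrix.mul_add,
    Matrix.mul_sub, Matrix.mul_neg, Matrix.one_mul, Matrix.mul_one,
    singleBlock_mul_singleBlock _ _ ha, singleBlock_mul_singleBlock _ _ hb,
    singleBlock_mul_singleBlock_of_ne hab, singleBlock_mul_singleBlock_of_ne hab.symm]
  abel

lemma swapFactor_map {S' : Type*} [CommRing S'] (g : S →+* S') (a b : ℕ)
    (X : Matrix (Fin n) (Fin n) S) :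
    (swapFactor m a b X).map g = swapFactor m a b (X.map g) := by
  simp only [swapFactor, Matrix.map_add g (map_add g), Matrix.map_sub g (map_sub g),
    singleBlock_map, Matrix.map_one g (map_zero g) (map_one g)]

lemma diagFactor_map {S' : Type*} [CommRing S'] (g : S →+* S') (a : ℕ)
    (X : Matrix (Fin n) (Fin n) S) :
    (diagFactor m a X).map g = diagFactor m a (X.map g) := by
  simp only [diagFactor, Matrix.map_add g (map_add g), Matrix.map_sub g (map_sub g),
    singleBlock_map, Matrix.map_one g (map_zero g) (map_one g)]

lemma diagFactor_mul_diagFactor {a : ℕ} (ha : a < m) (X Y : Matrix (Fin n) (Fin n) S) :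
    diagFactor m a X * diagFactor m a Y = diagFactor m a (X * Y) := by
  simp only [diagFactor, Matrix.add_mul, Matrix.sub_mul, Matrix.mul_add, Matrix.mul_sub,
    Matrix.one_mul, Matrix.mul_one, singleBlock_mul_singleBlock _ _ ha]
  abel

lemma isUnit_diagFactor {a : ℕ} (ha : a < m) {X : Matrix (Fin n) (Fin n) S} (hX : IsUnit X) :
    IsUnit (diagFactor m a X) := by
  obtain ⟨u, rfl⟩ := hX
  refine .of_mul_eq_one (diagFactor m a (↑u⁻¹ : Matrix (Fin n) (Fin n) S)) ?_
  rw [diagFactor_mul_diagFactor ha, u.mul_inv, diagFactor]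
  abel

lemma swapFactor_mul_ofBlocks {a b : ℕ} (ha : a < m) (hb : b < m) (hab : a ≠ b)
    (X : Matrix (Fin n) (Fin n) S) (F : ℕ → ℕ → Matrix (Fin n) (Fin n) S) :
    swapFactor m a b X * ofBlocks m F = ofBlocks m
      (Function.update (Function.update F a fun j => X * F a j + F b j) b (F a)) := by
  simp only [swapFactor, Matrix.add_mul, Matrix.sub_mul, singleBlock_mul_ofBlocks _ ha,
    singleBlock_mul_ofBlocks _ hb, Matrix.one_mul, ofBlocks_add, ofBlocks_sub]
  refine ofBlocks_congr fun i _ j _ => ?_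
  rcases eq_or_ne i a with rfl | hi
  · simp [hab]
  · rcases eq_or_ne i b with rfl | hi'
    · simp [hi]
    · simp [hi, hi']

lemma diagFactor_mul_ofBlocks (a : ℕ) (X : Matrix (Fin n) (Fin n) S)
    (F : ℕ → ℕ → Matrix (Fin n) (Fin n) S) :
    diagFactor m a X * ofBlocks m F =
      ofBlocks m (Function.update F a fun j => X * F a j) := by
  rw [diagFactor_eq_diagBlocks, diagBlocks_mul_ofBlocks]
  refine ofBlocks_congr fun i _ j _ => ?_
  rcases eq_or_ne i a with rfl | hi
  · simp
  · simp [hi]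

end BlockCalculus

/-! ### Ordered products -/

section OrderedProducts

variable {M : Type*} [Monoid M]

/-- The ordered product `f 0 * f 1 * ⋯ * f (k - 1)`. -/
def ascProd (f : ℕ → M) (k : ℕ) : M := ((List.range k).map f).prod

/-- The ordered product `f (k - 1) * ⋯ * f 1 * f 0`. -/
def descProd (f : ℕ → M) (k : ℕ) : M := ((List.range k).reverse.map f).prod

lemma ascProd_zero (f : ℕ → M) : ascProd f 0 = 1 := rfl

lemma descProd_zero (f : ℕ → M) : descProd f 0 = 1 := rfl

lemma ascProd_succ (f : ℕ → M) (k : ℕ) : ascProd f (k + 1) = ascProd f k * f k := by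
  simp [ascProd, List.range_succ]

lemma descProd_succ (f : ℕ → M) (k : ℕ) : descProd f (k + 1) = f k * descProd f k := by
  simp [descProd, List.range_succ]

lemma ascProd_succ' (f : ℕ → M) (k : ℕ) :
    ascProd f (k + 1) = f 0 * ascProd (fun i => f (i + 1)) k := by
  simp [ascProd, List.range_succ_eq_map, Function.comp_def]

lemma descProd_succ' (f : ℕ → M) (k : ℕ) :
    descProd f (k + 1) = descProd (fun i => f (i + 1)) k * f 0 := by
  simp [descProd, List.range_succ_eq_map, Function.comp_def, ← List.map_reverse]

lemma ascProd_mem (N : Submonoid M) {f : ℕ → M} {k : ℕ} (h : ∀ i < k, f i ∈ N) :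
    ascProd f k ∈ N :=
  N.list_prod_mem (by simpa using h)

lemma descProd_mem (N : Submonoid M) {f : ℕ → M} {k : ℕ} (h : ∀ i < k, f i ∈ N) :
    descProd f k ∈ N :=
  N.list_prod_mem (by simpa using h)

lemma commute_descProd {a : M} {f : ℕ → M} {k : ℕ} (h : ∀ i < k, Commute a (f i)) :
    Commute a (descProd f k) :=
  Commute.list_prod_right _ _ (by simpa using h)

lemma descProd_congr {f g : ℕ → M} {k : ℕ} (h : ∀ i < k, f i = g i) :
    descProd f k = descProd g k := by
  rw [descProd, descProd, List.map_congr_left fun i hi => h i (by simpa using hi)]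

lemma ascProd_congr {f g : ℕ → M} {k : ℕ} (h : ∀ i < k, f i = g i) :
    ascProd f k = ascProd g k := by
  rw [ascProd, ascProd, List.map_congr_left fun i hi => h i (by simpa using hi)]

lemma map_ascProd {N F : Type*} [Monoid N] [FunLike F M N] [MonoidHomClass F M N] (φ : F)
    (f : ℕ → M) (k : ℕ) : φ (ascProd f k) = ascProd (fun i => φ (f i)) k := by
  simp [ascProd, map_list_prod, Function.comp_def]

lemma map_descProd {N F : Type*} [Monoid N] [FunLike F M N] [MonoidHomClass F M N] (φ : F)
    (f : ℕ → M) (k : ℕ) : φ (descProd f k) = descProd (fun i => φ (f i)) k := by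
  simp [descProd, map_list_prod, Function.comp_def]

lemma descProd_mul {f g : ℕ → M} {k : ℕ} (h : ∀ j < k, ∀ i < j, Commute (f i) (g j)) :
    descProd (fun i => f i * g i) k = descProd f k * descProd g k := by
  induction k with
  | zero => simp [descProd_zero]
  | succ k ih =>
    have hcomm := commute_descProd fun i hi => (h k k.lt_succ_self i hi).symm
    rw [descProd_succ, descProd_succ, descProd_succ, ih fun j hj => h j (by omega)]
    simp only [mul_assoc]
    rw [← mul_assoc (g k), hcomm.eq, mul_assoc]

lemma descProd_mul_descProd_eq {f g : ℕ → M} {k l : ℕ}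
    (h : ∀ i < k, f i * g (l + k - 1 - i) = 1) :
    descProd f k * descProd g (l + k) = descProd g l := by
  induction k generalizing l with
  | zero => rw [descProd_zero, one_mul, add_zero]
  | succ k ih =>
    rw [descProd_succ, show l + (k + 1) = (l + 1) + k by omega, mul_assoc,
      ih fun i hi => by rw [← h i (by omega)]; congr 2; omega, descProd_succ, ← mul_assoc,
      show l = l + (k + 1) - 1 - k by omega, h k k.lt_succ_self, one_mul]

lemma ascProd_mul_ascProd_eq {f g : ℕ → M} {k l : ℕ}
    (h : ∀ i < k, g (l + k - 1 - i) * f i = 1) :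
    ascProd g (l + k) * ascProd f k = ascProd g l := by
  induction k generalizing l with
  | zero => rw [ascProd_zero, mul_one, add_zero]
  | succ k ih =>
    rw [ascProd_succ, show l + (k + 1) = (l + 1) + k by omega, ← mul_assoc,
      ih fun i hi => by rw [← h i (by omega)]; congr 2; omega, ascProd_succ, mul_assoc,
      show l = l + (k + 1) - 1 - k by omega, h k k.lt_succ_self, mul_one]

lemma descProd_mul_descProd_eq_one {f g : ℕ → M} {k : ℕ} (h : ∀ i < k, f i * g (k - 1 - i) = 1) :
    descProd f k * descProd g k = 1 := by
  simpa [descProd_zero] using descProd_mul_descProd_eq (l := 0) (by simpa using h)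

lemma ascProd_mul_ascProd_eq_one {f g : ℕ → M} {k : ℕ} (h : ∀ i < k, g (k - 1 - i) * f i = 1) :
    ascProd g k * ascProd f k = 1 := by
  simpa [ascProd_zero] using ascProd_mul_ascProd_eq (l := 0) (by simpa using h)

end OrderedProducts

/-! ### Block supports -/

section Support

variable {m n : ℕ} {S : Type*} [CommRing S]

/-- The block matrices that agree with the identity matrix in the block rows and columns whose
index is not in `T`. -/
def identityOutside (m n : ℕ) (S : Type*) [CommRing S] (T : Set ℕ) :
    Submonoid (BlockMatrix m n S) where
  carrier := {N | ∀ c ∉ T, N * singleBlock m c c 1 = singleBlock m c c 1 ∧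
    singleBlock m c c 1 * N = singleBlock m c c 1}
  one_mem' c _ := ⟨one_mul _, mul_one _⟩
  mul_mem' {N N'} hN hN' c hc :=
    ⟨by rw [mul_assoc, (hN' c hc).1, (hN c hc).1], by rw [← mul_assoc, (hN c hc).2, (hN' c hc).2]⟩

variable {T T' : Set ℕ} {N N' : BlockMatrix m n S}

lemma identityOutside_mono (h : T ⊆ T') (hN : N ∈ identityOutside m n S T) :
    N ∈ identityOutside m n S T' :=
  fun c hc => hN c fun hcT => hc (h hcT)

lemma mul_singleBlock_of_mem (hN : N ∈ identityOutside m n S T) {c : ℕ} (hc : c ∉ T) (d : ℕ)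
    (X : Matrix (Fin n) (Fin n) S) : N * singleBlock m c d X = singleBlock m c d X := by
  rcases lt_or_ge c m with hcm | hcm
  · rw [← Matrix.one_mul X, ← singleBlock_mul_singleBlock _ _ hcm, ← Matrix.mul_assoc,
      (hN c hc).1]
  · rw [singleBlock_of_le hcm, Matrix.mul_zero]

lemma transpose_mem_identityOutside (hN : N ∈ identityOutside m n S T) :
    Nᵀ ∈ identityOutside m n S T := fun c hc => by
  have h := hN c hc
  have hE : (singleBlock m c c (1 : Matrix (Fin n) (Fin n) S))ᵀ = singleBlock m c c 1 := by
    rw [singleBlock_transpose, transpose_one]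
  constructor
  · rw [← hE, ← transpose_mul, h.2]
  · rw [← hE, ← transpose_mul, h.1]

lemma singleBlock_mul_of_mem (hN : N ∈ identityOutside m n S T) {c : ℕ} (hc : c ∉ T) (d : ℕ)
    (X : Matrix (Fin n) (Fin n) S) : singleBlock m d c X * N = singleBlock m d c X := by
  rw [← transpose_inj, transpose_mul, singleBlock_transpose,
    mul_singleBlock_of_mem (transpose_mem_identityOutside hN) hc]

lemma mul_eq_add_sub_one_of_disjoint (hN : N ∈ identityOutside m n S T)
    (hN' : N' ∈ identityOutside m n S T') (hT : Disjoint T T') : N * N' = N + N' - 1 := by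
  suffices h : ∑ c ∈ Finset.range m, (N - 1) * (singleBlock m c c 1 * (N' - 1)) = 0 by
    rw [← Finset.mul_sum, ← Finset.sum_mul, sum_singleBlock_one, Matrix.one_mul] at h
    rw [← sub_eq_zero, ← h]
    noncomm_ring
  refine Finset.sum_eq_zero fun c _ => ?_
  by_cases hc : c ∈ T
  · rw [Matrix.mul_sub, (hN' c (Set.disjoint_left.1 hT hc)).2, Matrix.mul_one, sub_self,
      Matrix.mul_zero]
  · rw [← Matrix.mul_assoc, Matrix.sub_mul, (hN c hc).1, Matrix.one_mul, sub_self,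
      Matrix.zero_mul]

lemma commute_of_disjoint (hN : N ∈ identityOutside m n S T)
    (hN' : N' ∈ identityOutside m n S T') (hT : Disjoint T T') : Commute N N' := by
  rw [Commute, SemiconjBy, mul_eq_add_sub_one_of_disjoint hN hN' hT,
    mul_eq_add_sub_one_of_disjoint hN' hN hT.symm, add_comm]

lemma singleBlock_one_mul_scalarBlocks (d : ℕ → S) (c : ℕ) :
    singleBlock m c c (1 : Matrix (Fin n) (Fin n) S) * scalarBlocks m n d =
      d c • singleBlock m c c 1 := by
  rw [singleBlock_mul_scalarBlocks, singleBlock_smul]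

lemma commute_scalarBlocks_left {d : ℕ → S} (hN : N ∈ identityOutside m n S T)
    (hN' : N' ∈ identityOutside m n S T') (hT : Disjoint T T')
    (h : Commute (scalarBlocks m n d) (N * N')) : Commute (scalarBlocks m n d) N := by
  refine ext_singleBlock_mul fun c => ?_
  have hrow : ∀ Z, singleBlock m c c (1 : Matrix (Fin n) (Fin n) S) * (scalarBlocks m n d * Z) =
      d c • (singleBlock m c c 1 * Z) := fun Z => by
    rw [← Matrix.mul_assoc, singleBlock_one_mul_scalarBlocks, Matrix.smul_mul]
  by_cases hc : c ∈ T
  · have hNN' : singleBlock m c c 1 * (N * N') = singleBlock m c c 1 * N := by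
      rw [mul_eq_add_sub_one_of_disjoint hN hN' hT, Matrix.mul_sub, Matrix.mul_add,
        (hN' c (Set.disjoint_left.1 hT hc)).2, Matrix.mul_one, add_sub_cancel_right]
    rw [hrow, ← hNN', ← hrow, h.eq, ← Matrix.mul_assoc, hNN', Matrix.mul_assoc]
  · rw [hrow, (hN c hc).2, ← Matrix.mul_assoc, (hN c hc).2, singleBlock_one_mul_scalarBlocks]

lemma commute_scalarBlocks_right {d : ℕ → S} (hN : N ∈ identityOutside m n S T)
    (hN' : N' ∈ identityOutside m n S T') (hT : Disjoint T T')
    (h : Commute (scalarBlocks m n d) (N * N')) : Commute (scalarBlocks m n d) N' := by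
  rw [(commute_of_disjoint hN hN' hT).eq] at h
  exact commute_scalarBlocks_left hN' hN hT.symm h

lemma swapFactor_mem (a b : ℕ) (X : Matrix (Fin n) (Fin n) S) :
    swapFactor m a b X ∈ identityOutside m n S {a, b} := fun c hc => by
  obtain ⟨hca, hcb⟩ : c ≠ a ∧ c ≠ b := by simpa using hc
  simp [swapFactor, Matrix.add_mul, Matrix.sub_mul, Matrix.mul_add, Matrix.mul_sub,
    singleBlock_mul_singleBlock_of_ne hca, singleBlock_mul_singleBlock_of_ne hcb,
    singleBlock_mul_singleBlock_of_ne hca.symm, singleBlock_mul_singleBlock_of_ne hcb.symm]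

lemma diagFactor_mem (a : ℕ) (X : Matrix (Fin n) (Fin n) S) :
    diagFactor m a X ∈ identityOutside m n S {a} := fun c hc => by
  have hca : c ≠ a := by simpa using hc
  simp [diagFactor, Matrix.add_mul, Matrix.sub_mul, Matrix.mul_add, Matrix.mul_sub,
    singleBlock_mul_singleBlock_of_ne hca, singleBlock_mul_singleBlock_of_ne hca.symm]

end Support

/-! ### Index tuples -/

section IndexTuples

variable {M : Type*} [Monoid M]

lemma prod_map_flatMap (F : ℤ → M) (a : ℕ → List ℤ) (l : List ℕ) :
    ((l.flatMap a).map F).prod = (l.map fun i => ((a i).map F).prod).prod := by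
  induction l with
  | nil => simp
  | cons i l ih => simp [List.flatMap_cons, ih]

lemma prod_map_shift (F : ℤ → M) (l : List ℤ) (c : ℤ) :
    (l.map F).prod = ((l.map fun t => t + c).map fun t => F (t - c)).prod := by
  simp [Function.comp_def]

/- A list of naturals used as a list of integers is elaborated to this monadic form. -/
lemma bind_pure_natCast (l : List ℕ) :
    (do let a ← l; pure (a : ℤ)) = l.map (fun i : ℕ => (i : ℤ)) :=
  bind_pure_comp _ _

lemma prod_map_stringZero (F : ℤ → M) (b : ℕ) :
    ((stringZero b).map F).prod = ascProd (fun i : ℕ => F i) (b + 1) := by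
  rw [stringZero, bind_pure_natCast, List.map_map, List.map_map]
  rfl

lemma prod_map_symmetricComplement (F : ℤ → M) (p s : ℕ) :
    ((symmetricComplement (p + 2 * s) p).map F).prod =
      descProd (fun i : ℕ => F ((p : ℤ) + 2 * i + 1)) s *
        descProd (fun b => ascProd (fun i : ℕ => F i) (b + 1)) p := by
  rw [symmetricComplement, bind_pure_natCast, List.map_append, List.prod_append, List.map_map,
    List.map_map, prod_map_flatMap, Nat.add_sub_cancel_left, Nat.mul_div_cancel_left _ two_pos]
  simp only [prod_map_stringZero]
  rfl

lemma IsAdmissible.prod_map {p s : ℕ} {w : List ℤ} (hw : IsAdmissible (p + 2 * s) p w)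
    (F : ℤ → M) :
    (w.map F).prod =
      descProd (fun i : ℕ => F ((p : ℤ) + 2 * i + 1) * F ((p : ℤ) + 2 * i + 2)) s *
        ascProd (fun i : ℕ => F i) (p + 1) := by
  rw [hw.2.2, List.map_append, List.prod_append, prod_map_stringZero, bind_pure_natCast,
    List.flatMap_map, Nat.add_sub_cancel_left, Nat.mul_div_cancel_left _ two_pos, prod_map_flatMap]
  simp only [List.map_cons, List.map_nil, List.prod_cons, List.prod_nil, mul_one]
  rfl

end IndexTuples

/-! ### Products of Fiedler matrices -/

section Factors

variable {n : ℕ} {S : Type*} [CommRing S]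

/-- The Fiedler matrix of index `m - 1 - j ≥ 1` of `∑ A_i x^i`: the index is chosen so that the
nontrivial block rows and columns are `j` and `j + 1`. -/
def posFactor (m : ℕ) (A : ℕ → Matrix (Fin n) (Fin n) S) (j : ℕ) : BlockMatrix m n S :=
  swapFactor m j (j + 1) (-A (m - 1 - j))

/-- The Fiedler matrix of index `-(m - 1 - j) ≤ -1` of `∑ A_i x^i`, with nontrivial block rows and
columns `j` and `j + 1`. -/
def negFactor (m : ℕ) (A : ℕ → Matrix (Fin n) (Fin n) S) (j : ℕ) : BlockMatrix m n S :=
  swapFactor m (j + 1) j (A (m - 1 - j))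

/-- The product of the Fiedler matrices of the odd indices `2 s - 1, …, 3, 1`. -/
def oddPos (m : ℕ) (A : ℕ → Matrix (Fin n) (Fin n) S) (s : ℕ) : BlockMatrix m n S :=
  descProd (fun i => posFactor m A (m - 2 - 2 * i)) s

/-- The product of the Fiedler matrices of the even indices `2 s, …, 4, 2`. -/
def evenPos (m : ℕ) (A : ℕ → Matrix (Fin n) (Fin n) S) (s : ℕ) : BlockMatrix m n S :=
  descProd (fun i => posFactor m A (m - 3 - 2 * i)) s

/-- The product of the Fiedler matrices of indices `p + 2 s - 1 - m, …, p + 3 - m, p + 1 - m`. -/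
def oddNeg (m : ℕ) (A : ℕ → Matrix (Fin n) (Fin n) S) (p s : ℕ) : BlockMatrix m n S :=
  descProd (fun i => negFactor m A (p + 2 * i)) s

/-- The product of the Fiedler matrices of indices `p + 2 s - m, …, p + 4 - m, p + 2 - m`. -/
def evenNeg (m : ℕ) (A : ℕ → Matrix (Fin n) (Fin n) S) (p s : ℕ) : BlockMatrix m n S :=
  descProd (fun i => negFactor m A (p + 1 + 2 * i)) s

/-- The product of the Fiedler matrices of indices `-m, 1 - m, …, a - m`. -/
def negString (m : ℕ) (A : ℕ → Matrix (Fin n) (Fin n) S) (a : ℕ) : BlockMatrix m n S :=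
  diagFactor m 0 (A m) * ascProd (negFactor m A) a

/-- The product of the strings of Fiedler matrices with indices
`(-m, …, a - 1 - m), …, (-m, 1 - m), (-m)`. -/
def hankelFactor (m : ℕ) (A : ℕ → Matrix (Fin n) (Fin n) S) (a : ℕ) : BlockMatrix m n S :=
  descProd (negString m A) a

/-- The coefficient `M_z M_{c_w} M_{c_z}` of `x` in the pencil built from `∑ A_i x^i`, where
`m = p + 2 s' + 2 s + 1`. -/
def leadCoeff (m : ℕ) (A : ℕ → Matrix (Fin n) (Fin n) S) (p s' s : ℕ) : BlockMatrix m n S :=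
  oddNeg m A p s' * evenNeg m A p s' * negString m A p * oddPos m A s *
    (oddNeg m A p s' * hankelFactor m A p)

/-- The matrix `M_w M_{c_w} M_{c_z}`, i.e. minus the constant coefficient of the pencil built from
`∑ A_i x^i`. -/
def constCoeff (m : ℕ) (A : ℕ → Matrix (Fin n) (Fin n) S) (p s' s : ℕ) : BlockMatrix m n S :=
  oddPos m A s * evenPos m A s * diagFactor m (m - 1) (-A 0) * oddPos m A s *
    (oddNeg m A p s' * hankelFactor m A p)

variable {m p s s' : ℕ} {A : ℕ → Matrix (Fin n) (Fin n) S}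

lemma posFactor_mul_negFactor {j : ℕ} (hj : j + 1 < m) :
    posFactor m A j * negFactor m A j = 1 := by
  rw [posFactor, negFactor, ← neg_neg (A (m - 1 - j)), neg_neg (-A (m - 1 - j))]
  exact swapFactor_mul_swapFactor (by omega) hj (by omega) _

lemma negFactor_mul_posFactor {j : ℕ} (hj : j + 1 < m) :
    negFactor m A j * posFactor m A j = 1 :=
  swapFactor_mul_swapFactor hj (by omega) (by omega) _

lemma posFactor_mem (j : ℕ) {T : Set ℕ} (hj : j ∈ T) (hj' : j + 1 ∈ T) :
    posFactor m A j ∈ identityOutside m n S T :=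
  identityOutside_mono (Set.pair_subset hj hj') (swapFactor_mem _ _ _)

lemma negFactor_mem (j : ℕ) {T : Set ℕ} (hj : j ∈ T) (hj' : j + 1 ∈ T) :
    negFactor m A j ∈ identityOutside m n S T :=
  identityOutside_mono (Set.pair_subset hj' hj) (swapFactor_mem _ _ _)

lemma oddPos_mem (hs : 2 * s + 1 ≤ m) :
    oddPos m A s ∈ identityOutside m n S (Set.Ici (m - 2 * s)) :=
  descProd_mem _ fun i hi => posFactor_mem _ (Set.mem_Ici.2 (by omega)) (Set.mem_Ici.2 (by omega))

lemma evenPos_mem (hs : 2 * s + 1 ≤ m) :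
    evenPos m A s ∈ identityOutside m n S (Set.Ico (m - 2 * s - 1) (m - 1)) :=
  descProd_mem _ fun i hi => posFactor_mem _ (Set.mem_Ico.2 (by omega)) (Set.mem_Ico.2 (by omega))

lemma oddNeg_mem : oddNeg m A p s ∈ identityOutside m n S (Set.Ico p (p + 2 * s)) :=
  descProd_mem _ fun i hi => negFactor_mem _ (Set.mem_Ico.2 (by omega)) (Set.mem_Ico.2 (by omega))

lemma evenNeg_mem :
    evenNeg m A p s ∈ identityOutside m n S (Set.Ico (p + 1) (p + 1 + 2 * s)) :=
  oddNeg_mem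

lemma negString_mem (a : ℕ) : negString m A a ∈ identityOutside m n S (Set.Iio (a + 1)) :=
  mul_mem (identityOutside_mono (by simp) (diagFactor_mem 0 _))
    (ascProd_mem _ fun i hi =>
      negFactor_mem _ (Set.mem_Iio.2 (by omega)) (Set.mem_Iio.2 (by omega)))

lemma hankelFactor_mem (a : ℕ) : hankelFactor m A a ∈ identityOutside m n S (Set.Iio a) :=
  descProd_mem _ fun i hi => identityOutside_mono (Set.Iio_subset_Iio (by omega)) (negString_mem i)

lemma oddNeg_mul_hankelFactor_mem :
    oddNeg m A p s * hankelFactor m A p ∈ identityOutside m n S (Set.Iio (p + 2 * s)) :=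
  mul_mem (identityOutside_mono Set.Ico_subset_Iio_self oddNeg_mem)
    (identityOutside_mono (Set.Iio_subset_Iio (by omega)) (hankelFactor_mem p))

lemma evenPos_mul_diagFactor_mem (hm : p + 2 * s' + 2 * s + 1 = m)
    (X : Matrix (Fin n) (Fin n) S) : evenPos m A s * diagFactor m (m - 1) X ∈
      identityOutside m n S (Set.Ici (p + 2 * s')) :=
  mul_mem (identityOutside_mono (fun i hi => Set.mem_Ici.2 (by have := hi.1; omega))
      (evenPos_mem (by omega)))
    (identityOutside_mono (Set.singleton_subset_iff.2 (Set.mem_Ici.2 (by omega)))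
      (diagFactor_mem _ _))

lemma evenNeg_mul_hankelFactor_mem : evenNeg m A p s * hankelFactor m A (p + 1) ∈
    identityOutside m n S (Set.Iio (p + 2 * s + 1)) :=
  identityOutside_mono (Set.Iio_subset_Iio (by omega)) (oddNeg_mul_hankelFactor_mem (p := p + 1))

lemma descProd_posFactor_mul (hs : 2 * s + 1 ≤ m) :
    descProd (fun i => posFactor m A (m - 2 - 2 * i) * posFactor m A (m - 3 - 2 * i)) s =
      oddPos m A s * evenPos m A s :=
  descProd_mul fun j _ i hi =>
    commute_of_disjoint (swapFactor_mem _ _ _) (swapFactor_mem _ _ _) (by simp; omega)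

lemma descProd_negFactor_mul :
    descProd (fun i => negFactor m A (p + 2 * i) * negFactor m A (p + 1 + 2 * i)) s =
      oddNeg m A p s * evenNeg m A p s :=
  descProd_mul fun j _ i hi =>
    commute_of_disjoint (swapFactor_mem _ _ _) (swapFactor_mem _ _ _) (by simp; omega)

lemma leadCoeff_map {S' : Type*} [CommRing S'] (g : S →+* S') :
    (leadCoeff m A p s' s).map g = leadCoeff m (fun i => (A i).map g) p s' s := by
  simp only [leadCoeff, hankelFactor, negString, oddPos, oddNeg, evenNeg, posFactor, negFactor,
    ← RingHom.mapMatrix_apply, map_mul, map_descProd, map_ascProd]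
  simp only [RingHom.mapMatrix_apply, swapFactor_map, diagFactor_map, Matrix.map_neg g (map_neg g)]
  rfl

lemma constCoeff_map {S' : Type*} [CommRing S'] (g : S →+* S') :
    (constCoeff m A p s' s).map g = constCoeff m (fun i => (A i).map g) p s' s := by
  simp only [constCoeff, hankelFactor, negString, oddPos, evenPos, oddNeg, posFactor, negFactor,
    ← RingHom.mapMatrix_apply, map_mul, map_descProd, map_ascProd]
  simp only [RingHom.mapMatrix_apply, swapFactor_map, diagFactor_map, Matrix.map_neg g (map_neg g)]
  rfl

lemma commute_oddNeg_hankelFactor : Commute (oddNeg m A p s) (hankelFactor m A p) :=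
  commute_of_disjoint oddNeg_mem (hankelFactor_mem p)
    ((Set.Iio_disjoint_Ici le_rfl).symm.mono_left Set.Ico_subset_Ici_self)

lemma commute_evenPos_diagFactor (hs : 2 * s + 1 ≤ m) (X : Matrix (Fin n) (Fin n) S) :
    Commute (evenPos m A s) (diagFactor m (m - 1) X) :=
  commute_of_disjoint (evenPos_mem hs) (diagFactor_mem _ _) (by simp)

lemma isUnit_posFactor {j : ℕ} (hj : j + 1 < m) : IsUnit (posFactor m A j) :=
  .of_mul_eq_one _ (posFactor_mul_negFactor hj)

lemma isUnit_negFactor {j : ℕ} (hj : j + 1 < m) : IsUnit (negFactor m A j) :=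
  .of_mul_eq_one _ (negFactor_mul_posFactor hj)

lemma isUnit_oddPos (hs : 2 * s + 1 ≤ m) : IsUnit (oddPos m A s) :=
  descProd_mem (IsUnit.submonoid _) fun i hi => isUnit_posFactor (by omega)

lemma isUnit_evenPos (hs : 2 * s + 1 ≤ m) : IsUnit (evenPos m A s) :=
  descProd_mem (IsUnit.submonoid _) fun i hi => isUnit_posFactor (by omega)

lemma isUnit_oddNeg (hp : p + 2 * s ≤ m) : IsUnit (oddNeg m A p s) :=
  descProd_mem (IsUnit.submonoid _) fun i hi => isUnit_negFactor (by omega)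

lemma isUnit_hankelFactor (hA : IsUnit (A m)) {a : ℕ} (ha : a ≤ m) :
    IsUnit (hankelFactor m A a) :=
  descProd_mem (IsUnit.submonoid _) fun _ hi =>
    (isUnit_diagFactor (by omega) hA).mul
      (ascProd_mem (IsUnit.submonoid _) fun _ hj => isUnit_negFactor (by omega))

lemma hankelFactor_succ (a : ℕ) :
    hankelFactor m A (a + 1) = negString m A a * hankelFactor m A a :=
  descProd_succ _ _

lemma leadCoeff_eq (hm : p + 2 * s' + 2 * s + 1 = m) :
    leadCoeff m A p s' s = oddNeg m A p s' *
      (evenNeg m A p s' * hankelFactor m A (p + 1) * oddPos m A s) * oddNeg m A p s' := by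
  have hString : Commute (oddPos m A s * oddNeg m A p s') (hankelFactor m A p) := by
    refine commute_of_disjoint (mul_mem (identityOutside_mono ?_ (oddPos_mem (by omega)))
      (identityOutside_mono Set.Ico_subset_Ici_self oddNeg_mem)) (hankelFactor_mem p)
      (Set.Iio_disjoint_Ici le_rfl).symm
    exact Set.Ici_subset_Ici.2 (by omega)
  rw [leadCoeff, hankelFactor_succ]
  simp only [mul_assoc]
  rw [← mul_assoc (oddPos m A s), hString.eq]

lemma constCoeff_eq (hm : p + 2 * s' + 2 * s + 1 = m) :
    constCoeff m A p s' s = oddPos m A s *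
      (oddNeg m A p s' * hankelFactor m A p * (evenPos m A s * diagFactor m (m - 1) (-A 0))) *
      oddPos m A s := by
  have hHigh : evenPos m A s * diagFactor m (m - 1) (-A 0) * oddPos m A s ∈
      identityOutside m n S (Set.Ici (p + 2 * s')) :=
    mul_mem (evenPos_mul_diagFactor_mem hm _)
      (identityOutside_mono (Set.Ici_subset_Ici.2 (by omega)) (oddPos_mem (by omega)))
  have hComm := commute_of_disjoint hHigh (oddNeg_mul_hankelFactor_mem (A := A))
    (Set.Iio_disjoint_Ici le_rfl).symm
  calc constCoeff m A p s' s
    _ = oddPos m A s * (evenPos m A s * diagFactor m (m - 1) (-A 0) * oddPos m A s *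
          (oddNeg m A p s' * hankelFactor m A p)) := by
        simp only [constCoeff, mul_assoc]
    _ = _ := by
        rw [hComm.eq]
        simp only [mul_assoc]

end Factors

section FiedlerMatrices

variable {m n p s s' : ℕ} (P : Matrix (Fin n) (Fin n) ℂ[X])

lemma swapFactor_eq_ofBlocks {S : Type*} [CommRing S] {a b : ℕ} (hab : a ≠ b)
    (X : Matrix (Fin n) (Fin n) S) :
    swapFactor m a b X = ofBlocks m fun i j =>
      if i = a ∧ j = a then X else if i = b ∧ j = b then 0
      else if (i = a ∧ j = b) ∨ (i = b ∧ j = a) then 1 else if i = j then 1 else 0 := by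
  rw [swapFactor, ← diagBlocks_one]
  simp only [singleBlock, diagBlocks, ofBlocks_add, ofBlocks_sub]
  refine ofBlocks_congr fun i _ j _ => ?_
  by_cases h1 : i = a <;> by_cases h2 : i = b <;> by_cases h3 : j = a <;> by_cases h4 : j = b <;>
    simp_all

lemma diagFactor_eq_ofBlocks {S : Type*} [CommRing S] (a : ℕ) (X : Matrix (Fin n) (Fin n) S) :
    diagFactor m a X = ofBlocks m fun i j =>
      if i = a ∧ j = a then X else if i = j then 1 else 0 := by
  rw [diagFactor_eq_diagBlocks]
  refine ofBlocks_congr fun i _ j _ => ?_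
  rcases eq_or_ne i a with rfl | h
  · rcases eq_or_ne i j with rfl | h
    · simp
    · simp [h, h.symm]
  · simp [h]

lemma elemMat_eq_ofBlocks (k : ℤ) (X : Matrix (Fin n) (Fin n) ℂ) :
    elemMat m k X = ofBlocks m fun i j => elemBlock m k X (i + 1) (j + 1) := rfl

lemma fiedlerP_natCast {k : ℕ} (hk : 0 < k) (hkm : k < m) :
    fiedlerP m P k = posFactor m (coeffMat P) (m - 1 - k) := by
  rw [fiedlerP, if_pos (Int.natCast_nonneg k), Int.natAbs_natCast, elemMat_eq_ofBlocks, posFactor,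
    swapFactor_eq_ofBlocks (by omega)]
  refine ofBlocks_congr fun i _ j _ => ?_
  rw [elemBlock, if_neg (by omega), if_neg (by omega), Nat.abs_cast,
    show m - 1 - (m - 1 - k) = k by omega]
  split_ifs <;> first | rfl | (exfalso; omega)

lemma fiedlerP_zero (hm : 0 < m) :
    fiedlerP m P 0 = diagFactor m (m - 1) (-coeffMat P 0) := by
  rw [fiedlerP, if_pos le_rfl, Int.natAbs_zero, elemMat_eq_ofBlocks, diagFactor_eq_ofBlocks]
  refine ofBlocks_congr fun i _ j _ => ?_
  rw [elemBlock, if_pos rfl]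
  split_ifs <;> first | rfl | (exfalso; omega)

lemma fiedlerP_neg (hm : 0 < m) : fiedlerP m P (-m) = diagFactor m 0 (coeffMat P m) := by
  rw [fiedlerP, if_neg (by omega), Int.natAbs_neg, Int.natAbs_natCast, elemMat_eq_ofBlocks,
    diagFactor_eq_ofBlocks]
  refine ofBlocks_congr fun i _ j _ => ?_
  rw [elemBlock, if_neg (by omega), if_pos rfl]
  split_ifs <;> first | rfl | (exfalso; omega)

lemma fiedlerP_sub {t : ℕ} (ht : t + 1 < m) :
    fiedlerP m P ((t : ℤ) + 1 - m) = negFactor m (coeffMat P) t := by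
  have hnat : ((t : ℤ) + 1 - m).natAbs = m - 1 - t := by omega
  have habs : |((t : ℤ) + 1 - m)| = m - 1 - t := by rw [abs_of_nonpos (by omega)]; ring
  rw [fiedlerP, if_neg (by omega), hnat, elemMat_eq_ofBlocks, negFactor,
    swapFactor_eq_ofBlocks (by omega)]
  refine ofBlocks_congr fun i _ j _ => ?_
  rw [elemBlock, if_neg (by omega), if_neg (by omega), habs]
  split_ifs <;> first | rfl | (exfalso; omega)

lemma prod_map_fiedlerP_symmetricComplement_zero (hs : 2 * s < m) :
    ((symmetricComplement (2 * s) 0).map (fiedlerP m P)).prod = oddPos m (coeffMat P) s := by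
  have := prod_map_symmetricComplement (fiedlerP m P) 0 s
  rw [zero_add, descProd_zero, mul_one] at this
  rw [this, oddPos]
  refine descProd_congr fun i hi => ?_
  rw [show ((0 : ℕ) : ℤ) + 2 * i + 1 = ((2 * i + 1 : ℕ) : ℤ) by push_cast; ring,
    fiedlerP_natCast P (by omega) (by omega)]
  congr 1; omega

lemma descProd_fiedlerP_pair (hs : 2 * s < m) :
    descProd (fun i : ℕ => fiedlerP m P (2 * i + 1) * fiedlerP m P (2 * i + 2)) s =
      oddPos m (coeffMat P) s * evenPos m (coeffMat P) s := by
  rw [← descProd_posFactor_mul (by omega)]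
  refine descProd_congr fun i hi => ?_
  rw [show (2 : ℤ) * i + 1 = ((2 * i + 1 : ℕ) : ℤ) by push_cast; ring,
    show (2 : ℤ) * i + 2 = ((2 * i + 2 : ℕ) : ℤ) by push_cast; ring,
    fiedlerP_natCast P (by omega) (by omega), fiedlerP_natCast P (by omega) (by omega)]
  congr 2 <;> omega

lemma prod_map_fiedlerP_admissible_zero (hs : 2 * s < m) {w : List ℤ}
    (hw : IsAdmissible (2 * s) 0 w) :
    (w.map (fiedlerP m P)).prod = oddPos m (coeffMat P) s * evenPos m (coeffMat P) s *
      diagFactor m (m - 1) (-coeffMat P 0) := by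
  rw [← zero_add (2 * s)] at hw
  simp only [hw.prod_map, Nat.cast_zero, zero_add, ascProd_succ, ascProd_zero, one_mul,
    fiedlerP_zero P (show 0 < m by omega), descProd_fiedlerP_pair P hs]

lemma prod_map_fiedlerP_admissible (h : p + 2 * s < m) {z : List ℤ}
    (hz : IsAdmissible (p + 2 * s) p (z.map fun t => t + (m : ℤ))) :
    (z.map (fiedlerP m P)).prod = oddNeg m (coeffMat P) p s * evenNeg m (coeffMat P) p s *
      negString m (coeffMat P) p := by
  rw [prod_map_shift _ z m, hz.prod_map, ascProd_succ', Nat.cast_zero, zero_sub,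
    fiedlerP_neg P (by omega), negString, ← descProd_negFactor_mul]
  congr 1
  · refine descProd_congr fun i hi => ?_
    rw [← fiedlerP_sub P (by omega), ← fiedlerP_sub P (by omega)]
    push_cast
    ring_nf
  · congr 1
    refine ascProd_congr fun i hi => ?_
    rw [← fiedlerP_sub P (by omega), Nat.cast_succ]

lemma prod_map_fiedlerP_symmetricComplement (h : p + 2 * s < m) {cz : List ℤ}
    (hcz : (cz.map fun t => t + (m : ℤ)) = symmetricComplement (p + 2 * s) p) :
    (cz.map (fiedlerP m P)).prod =
      oddNeg m (coeffMat P) p s * hankelFactor m (coeffMat P) p := by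
  rw [prod_map_shift _ cz m, hcz, prod_map_symmetricComplement, oddNeg, hankelFactor]
  congr 1
  · refine descProd_congr fun i hi => ?_
    rw [← fiedlerP_sub P (by omega)]
    push_cast
    rfl
  · refine descProd_congr fun a ha => ?_
    rw [ascProd_succ', Nat.cast_zero, zero_sub, fiedlerP_neg P (by omega), negString]
    congr 1
    refine ascProd_congr fun i hi => ?_
    rw [← fiedlerP_sub P (by omega), Nat.cast_succ]

end FiedlerMatrices

section Hankel

variable {m n : ℕ} {S : Type*} [CommRing S] {A : ℕ → Matrix (Fin n) (Fin n) S}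

lemma ascProd_negFactor_mul_ofBlocks {a : ℕ} (ha : a < m)
    (F : ℕ → ℕ → Matrix (Fin n) (Fin n) S) :
    ascProd (negFactor m A) a * ofBlocks m F = ofBlocks m fun i j =>
      if i = 0 then F a j else if i ≤ a then A (m - i) * F a j + F (i - 1) j else F i j := by
  induction a generalizing F with
  | zero =>
    rw [ascProd_zero, Matrix.one_mul]
    refine ofBlocks_congr fun i _ j _ => ?_
    split_ifs with h0 h1
    · rw [h0]
    · omega
    · rfl
  | succ a ih =>
    rw [ascProd_succ, Matrix.mul_assoc, negFactor, swapFactor_mul_ofBlocks ha (by omega) (by omega),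
      ih (by omega)]
    refine ofBlocks_congr fun i _ j _ => ?_
    rw [Function.update_self]
    split_ifs with h0 h1 h2 h2
    · rfl
    · rw [Function.update_of_ne (by omega), Function.update_of_ne (by omega)]
    · omega
    · obtain rfl : i = a + 1 := by omega
      rw [Function.update_of_ne (by omega), Function.update_self, Nat.add_sub_cancel,
        show m - 1 - a = m - (a + 1) by omega]
    · rw [Function.update_of_ne (by omega), Function.update_of_ne (by omega)]

lemma negString_mul_ofBlocks {a : ℕ} (ha : a < m) (F : ℕ → ℕ → Matrix (Fin n) (Fin n) S) :
    negString m A a * ofBlocks m F = ofBlocks m fun i j =>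
      if i = 0 then A m * F a j else if i ≤ a then A (m - i) * F a j + F (i - 1) j else F i j := by
  rw [negString, Matrix.mul_assoc, ascProd_negFactor_mul_ofBlocks ha, diagFactor_mul_ofBlocks]
  refine ofBlocks_congr fun i _ j _ => ?_
  rcases eq_or_ne i 0 with rfl | h
  · simp
  · rw [Function.update_of_ne h, if_neg h, if_neg h]

lemma hankelFactor_eq_ofBlocks {a : ℕ} (ha : a ≤ m) :
    hankelFactor m A a = ofBlocks m fun i j =>
      if i < a ∧ j < a then if a ≤ i + j + 1 then A (m - (i + j + 1 - a)) else 0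
      else if i = j then 1 else 0 := by
  induction a with
  | zero => simp only [not_lt_zero, false_and, if_false]; exact diagBlocks_one.symm
  | succ a ih =>
    rw [hankelFactor_succ, ih (by omega), negString_mul_ofBlocks ha]
    refine ofBlocks_congr fun i _ j _ => ?_
    simp only [lt_self_iff_false, false_and, if_false]
    rcases Nat.eq_zero_or_pos i with rfl | hi
    · rcases lt_trichotomy j a with hj | rfl | hj
      · simp [show j < a + 1 by omega, show ¬ a ≤ j by omega, hj.ne']
      · simp
      · simp [show ¬ j < a + 1 by omega, hj.ne, show 0 ≠ j by omega]
    · rcases lt_or_ge a i with hia | hia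
      · simp [show ¬ i ≤ a by omega, show ¬ i < a by omega, show ¬ i < a + 1 by omega, hi.ne']
      · rcases lt_trichotomy j a with hj | rfl | hj
        · simp [hi.ne', hia, hj, hj.ne', show i - 1 < a by omega, show i < a + 1 by omega,
            show j < a + 1 by omega, show i - 1 + j + 1 = i + j by omega]
        · simp [hi.ne', hia, show i < j + 1 by omega, show i - 1 ≠ j by omega]
        · simp [hi.ne', hia, hj.ne, hj.not_gt, show ¬ j < a + 1 by omega,
            show i - 1 ≠ j by omega, show i ≠ j by omega]

end Hankel

/-! ### Sign-symmetric matrices -/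

section SignSymmetric

variable {m n : ℕ} {S : Type*} [CommRing S]

/-- `Xᵀ D = D' X`, where `D` and `D'` are the diagonal matrices with parameters `d` and `d'`. For
`d' = d` and `d' = -d` this says that `D X` is symmetric, respectively skew-symmetric. -/
def IsSignSymmetric (d d' : ℕ → S) (X : BlockMatrix m n S) : Prop :=
  IsAdjointPair (scalarBlocks m n d') (scalarBlocks m n d) X X

/-- The sequence obtained from `d` by changing the signs of `d a, …, d (b - 1)`. -/
def flipSigns (a b : ℕ) (d : ℕ → S) (i : ℕ) : S :=
  if a ≤ i ∧ i < b then -d i else d i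

variable {d d' d'' d''' : ℕ → S} {X Y : BlockMatrix m n S}

lemma IsSignSymmetric.sandwich (hX : IsSignSymmetric d d' X) (hY : IsSignSymmetric d' d'' Y)
    (hX' : IsSignSymmetric d'' d''' X) : IsSignSymmetric d d''' (X * Y * X) := by
  simp only [IsSignSymmetric, IsAdjointPair] at *
  rw [transpose_mul, transpose_mul, Matrix.mul_assoc, Matrix.mul_assoc, hX, ← Matrix.mul_assoc Yᵀ,
    hY, ← Matrix.mul_assoc, ← Matrix.mul_assoc, hX']
  simp only [Matrix.mul_assoc]

lemma IsSignSymmetric.mul_of_commute (hX : IsSignSymmetric d' d'' X)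
    (hY : IsSignSymmetric d d' Y) (h : Commute X Y) : IsSignSymmetric d d'' (X * Y) := by
  simp only [IsSignSymmetric, IsAdjointPair] at *
  rw [h.eq, transpose_mul, Matrix.mul_assoc, hY, ← Matrix.mul_assoc, hX, Matrix.mul_assoc, h.eq]

lemma isSignSymmetric_one (d : ℕ → S) : IsSignSymmetric d d (1 : BlockMatrix m n S) := by
  simp [IsSignSymmetric, IsAdjointPair]

lemma isSignSymmetric_descProd {f : ℕ → BlockMatrix m n S} {e : ℕ → ℕ → S} {k : ℕ}
    (hf : ∀ i < k, IsSignSymmetric (e i) (e (i + 1)) (f i))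
    (hcomm : ∀ j < k, ∀ i < j, Commute (f j) (f i)) :
    IsSignSymmetric (e 0) (e k) (descProd f k) := by
  induction k with
  | zero => exact isSignSymmetric_one _
  | succ k ih =>
    rw [descProd_succ]
    exact (hf k k.lt_succ_self).mul_of_commute
      (ih (fun i hi => hf i (by omega)) fun j hj => hcomm j (by omega))
      (commute_descProd (hcomm k k.lt_succ_self))

lemma isSignSymmetric_ofBlocks {F : ℕ → ℕ → Matrix (Fin n) (Fin n) S}
    (h : ∀ i < m, ∀ j < m, d j • (F j i)ᵀ = d' i • F i j) :
    IsSignSymmetric d d' (ofBlocks m F) := by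
  rw [IsSignSymmetric, IsAdjointPair, ofBlocks_transpose, scalarBlocks, scalarBlocks,
    ofBlocks_mul_diagBlocks, diagBlocks_mul_ofBlocks]
  refine ofBlocks_congr fun i hi j hj => ?_
  rw [Matrix.mul_smul, Matrix.mul_one, Matrix.smul_mul, Matrix.one_mul, h i hi j hj]

lemma isSignSymmetric_swapFactor {a b : ℕ} (hab : a ≠ b) {Z : Matrix (Fin n) (Fin n) S}
    (hZ : d a • Zᵀ = d b • Z) (ha : d' a = d b) (hb : d' b = d a)
    (h : ∀ i, i ≠ a → i ≠ b → d' i = d i) : IsSignSymmetric d d' (swapFactor m a b Z) := by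
  rw [swapFactor_eq_ofBlocks hab]
  refine isSignSymmetric_ofBlocks fun i _ j _ => ?_
  rcases eq_or_ne i a with rfl | hia
  · rcases eq_or_ne j i with rfl | hja
    · simp [hZ, ha]
    · rcases eq_or_ne j b with rfl | hjb
      · simp [hab, hab.symm, ha]
      · simp [hab, hja, hja.symm, hjb]
  · rcases eq_or_ne i b with rfl | hib
    · rcases eq_or_ne j a with rfl | hja
      · simp [hab, hab.symm, hb]
      · rcases eq_or_ne j i with rfl | hji
        · simp [hia]
        · simp [hia, hja, hji, hji.symm]
    · rcases eq_or_ne j i with rfl | hji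
      · simp [hia, hib, h]
      · simp [hia, hib, hji, hji.symm]

lemma isSignSymmetric_diagFactor {a : ℕ} {Z : Matrix (Fin n) (Fin n) S} (hZ : Zᵀ = Z) :
    IsSignSymmetric d d (diagFactor m a Z) := by
  rw [diagFactor_eq_ofBlocks]
  refine isSignSymmetric_ofBlocks fun i _ j _ => ?_
  rcases eq_or_ne j i with rfl | hji
  · rcases eq_or_ne j a with rfl | hja
    · simp [hZ]
    · simp [hja]
  · rcases eq_or_ne i a with rfl | hia
    · simp [hji, hji.symm]
    · simp [hia, hji, hji.symm]

end SignSymmetric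

section EvenSigns

variable {m n p s s' H : ℕ} {S : Type*} [CommRing S] {A : ℕ → Matrix (Fin n) (Fin n) S}
  {d d' : ℕ → S}

lemma isSignSymmetric_negFactor {j : ℕ} (hA : (A (m - 1 - j))ᵀ = A (m - 1 - j))
    (hd : d (j + 1) = d j) : IsSignSymmetric d d (negFactor m A j) :=
  isSignSymmetric_swapFactor (by omega) (by rw [hA, hd]) hd hd.symm fun _ _ _ => rfl

lemma isSignSymmetric_posFactor {j : ℕ} (hA : (A (m - 1 - j))ᵀ = A (m - 1 - j))
    (hd : d (j + 1) = d j) : IsSignSymmetric d d (posFactor m A j) :=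
  isSignSymmetric_swapFactor (by omega) (by rw [transpose_neg, hA, hd]) hd.symm hd fun _ _ _ => rfl

/-- The signs `ε_0 = 1, ε_1, …` for which `diag(ε_i I_n)` makes the pencil with parameters
`p` and `H = m - h - 1` T-even. -/
def evenSign (p H : ℕ) : ℕ → ℤˣ
  | 0 => 1
  | i + 1 => if p ≤ i ∧ Even (i - p) ∧ i ≠ H then evenSign p H i else -evenSign p H i

/-- The signs `evenSign` as elements of a ring. -/
def evenSignCast (S : Type*) [CommRing S] (p H i : ℕ) : S := ((evenSign p H i : ℤ) : S)

lemma evenSignCast_succ_of {i : ℕ} (h : p ≤ i ∧ Even (i - p) ∧ i ≠ H) :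
    evenSignCast S p H (i + 1) = evenSignCast S p H i := by
  rw [evenSignCast, evenSign, if_pos h, evenSignCast]

lemma evenSignCast_succ_of_not {i : ℕ} (h : ¬ (p ≤ i ∧ Even (i - p) ∧ i ≠ H)) :
    evenSignCast S p H (i + 1) = -evenSignCast S p H i := by
  rw [evenSignCast, evenSign, if_neg h, evenSignCast, Units.val_neg, Int.cast_neg]

lemma evenSignCast_of_le {i : ℕ} (h : i ≤ p) : evenSignCast S p H i = (-1) ^ i := by
  induction i with
  | zero => simp [evenSignCast, evenSign]
  | succ i ih => rw [evenSignCast_succ_of_not (by omega), ih (by omega), pow_succ, mul_neg_one]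

lemma isSignSymmetric_negFactor_of_odd {j : ℕ} (hA : (A (m - 1 - j))ᵀ = -A (m - 1 - j))
    (hd : d (j + 1) = -d j) (hj : d' j = -d j) (hj' : d' (j + 1) = d j)
    (h : ∀ i, i ≠ j → i ≠ j + 1 → d' i = d i) : IsSignSymmetric d d' (negFactor m A j) :=
  isSignSymmetric_swapFactor (by omega) (by rw [hA, hd, smul_neg, neg_smul, neg_neg])
    hj' (by rw [hj, hd]) fun i h1 h2 => h i h2 h1

lemma isSignSymmetric_posFactor_of_odd {j : ℕ} (hA : (A (m - 1 - j))ᵀ = -A (m - 1 - j))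
    (hd : d (j + 1) = -d j) (hj : d' j = -d j) (hj' : d' (j + 1) = d j)
    (h : ∀ i, i ≠ j → i ≠ j + 1 → d' i = d i) : IsSignSymmetric d d' (posFactor m A j) :=
  isSignSymmetric_swapFactor (by omega)
    (by rw [transpose_neg, hA, hd, neg_smul, smul_neg]) (by rw [hj, hd]) hj' h

lemma isSignSymmetric_hankelFactor {a : ℕ} (ha : a ≤ m)
    (hA : ∀ j, (A j)ᵀ = (-1 : S) ^ j • A j) (hd : ∀ i < a, d i = (-1) ^ i)
    (hd' : ∀ i < a, d' i = (-1) ^ (m + 1 + a) * d i) (h : ∀ i, a ≤ i → d' i = d i) :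
    IsSignSymmetric d d' (hankelFactor m A a) := by
  rw [hankelFactor_eq_ofBlocks ha]
  refine isSignSymmetric_ofBlocks fun i _ j _ => ?_
  by_cases hij : i < a ∧ j < a
  · rw [if_pos hij.symm, if_pos hij, hd j hij.2, hd' i hij.1, hd i hij.1, add_comm j i]
    split_ifs
    · rw [hA, smul_smul, ← pow_add, ← pow_add, show m + 1 + a + i =
        j + (m - (i + j + 1 - a)) + 2 * (i + 1) by omega, pow_add _ _ (2 * (i + 1)), pow_mul,
        neg_one_sq, one_pow, mul_one]
    · simp only [transpose_zero, smul_zero]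
  · rw [if_neg (hij ∘ And.symm), if_neg hij]
    rcases eq_or_ne i j with rfl | hne
    · simp [h i (by omega)]
    · simp [hne, hne.symm]

lemma transpose_of_even (hA : ∀ j, (A j)ᵀ = (-1 : S) ^ j • A j) {j : ℕ} (hj : Even j) :
    (A j)ᵀ = A j := by rw [hA, hj.neg_one_pow, one_smul]

lemma transpose_of_odd (hA : ∀ j, (A j)ᵀ = (-1 : S) ^ j • A j) {j : ℕ} (hj : Odd j) :
    (A j)ᵀ = -A j := by rw [hA, hj.neg_one_pow, neg_one_smul]

lemma commute_negFactor {i j : ℕ} (hij : i + 1 < j) :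
    Commute (negFactor m A j) (negFactor m A i) :=
  commute_of_disjoint (negFactor_mem j (T := Set.Ici j) (by simp) (by simp))
    (negFactor_mem i (T := Set.Iio j) (by simp; omega) (by simp; omega))
    (Set.Iio_disjoint_Ici le_rfl).symm

lemma commute_posFactor {i j : ℕ} (hij : i + 1 < j) :
    Commute (posFactor m A i) (posFactor m A j) :=
  commute_of_disjoint (posFactor_mem i (T := Set.Iio j) (by simp; omega) (by simp; omega))
    (posFactor_mem j (T := Set.Ici j) (by simp) (by simp)) (Set.Iio_disjoint_Ici le_rfl)

lemma isSignSymmetric_oddNeg (hm : p + 2 * s' + 2 * s + 1 = m)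
    (hA : ∀ j, (A j)ᵀ = (-1 : S) ^ j • A j) (hd : ∀ i < s', d (p + 2 * i + 1) = d (p + 2 * i)) :
    IsSignSymmetric d d (oddNeg m A p s') :=
  isSignSymmetric_descProd (e := fun _ => d)
    (fun i hi => isSignSymmetric_negFactor
      (transpose_of_even hA ⟨s' + s - i, by omega⟩) (hd i hi))
    fun j _ i _ => commute_negFactor (by omega)

lemma isSignSymmetric_evenPos (hm : p + 2 * s' + 2 * s + 1 = m)
    (hA : ∀ j, (A j)ᵀ = (-1 : S) ^ j • A j)
    (hd : ∀ i < s, d (m - 3 - 2 * i + 1) = d (m - 3 - 2 * i)) :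
    IsSignSymmetric d d (evenPos m A s) :=
  isSignSymmetric_descProd (e := fun _ => d)
    (fun i hi => isSignSymmetric_posFactor (transpose_of_even hA ⟨i + 1, by omega⟩) (hd i hi))
    fun j _ i _ => commute_posFactor (by omega)

lemma isSignSymmetric_evenNeg (hm : p + 2 * s' + 2 * s + 1 = m)
    (hA : ∀ j, (A j)ᵀ = (-1 : S) ^ j • A j)
    (hd : ∀ i < s', d (p + 1 + 2 * i + 1) = -d (p + 1 + 2 * i)) :
    IsSignSymmetric d (flipSigns (p + 1) (p + 1 + 2 * s') d) (evenNeg m A p s') := by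
  have h := isSignSymmetric_descProd (m := m) (n := n) (k := s')
    (e := fun i => flipSigns (p + 1) (p + 1 + 2 * i) d)
    (f := fun i => negFactor m A (p + 1 + 2 * i))
    (fun i hi => isSignSymmetric_negFactor_of_odd
      (transpose_of_odd hA ⟨s' + s - 1 - i, by omega⟩) ?_ ?_ ?_ fun l _ _ => ?_)
    fun j _ i _ => commute_negFactor (by omega)
  · rwa [show flipSigns (p + 1) (p + 1 + 2 * 0) d = d from
      funext fun l => if_neg (by omega)] at h
  all_goals
    have := hd i hi
    simp only [flipSigns]
    split_ifs <;> first | omega | simp_all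

lemma isSignSymmetric_oddPos (hm : p + 2 * s' + 2 * s + 1 = m)
    (hA : ∀ j, (A j)ᵀ = (-1 : S) ^ j • A j)
    (hd : ∀ i < s, d (m - 2 - 2 * i + 1) = -d (m - 2 - 2 * i)) :
    IsSignSymmetric d (flipSigns (m - 2 * s) m d) (oddPos m A s) := by
  have h := isSignSymmetric_descProd (m := m) (n := n) (k := s)
    (e := fun i => flipSigns (m - 2 * i) m d) (f := fun i => posFactor m A (m - 2 - 2 * i))
    (fun i hi => isSignSymmetric_posFactor_of_odd
      (transpose_of_odd hA ⟨i, by omega⟩) ?_ ?_ ?_ fun l _ _ => ?_)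
    fun j _ i _ => commute_posFactor (by omega)
  · rwa [show flipSigns (m - 2 * 0) m d = d from funext fun l => if_neg (by omega)] at h
  all_goals
    have := hd i hi
    simp only [flipSigns]
    split_ifs <;> first | omega | simp_all

lemma scalarBlocks_congr {e : ℕ → S} (h : ∀ i < m, d i = e i) :
    scalarBlocks m n d = scalarBlocks m n e := by
  rw [scalarBlocks, scalarBlocks, diagBlocks, diagBlocks]
  refine ofBlocks_congr fun i hi j _ => ?_
  rw [h i hi]

lemma IsSignSymmetric.congr {e e' : ℕ → S} {X : BlockMatrix m n S}
    (hX : IsSignSymmetric d d' X) (h : ∀ i < m, d i = e i) (h' : ∀ i < m, d' i = e' i) :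
    IsSignSymmetric e e' X := by
  rwa [IsSignSymmetric, ← scalarBlocks_congr h, ← scalarBlocks_congr h']

theorem isSignSymmetric_leadCoeff (hm : p + 2 * s' + 2 * s + 1 = m)
    (hA : ∀ j, (A j)ᵀ = (-1 : S) ^ j • A j) :
    IsSignSymmetric (evenSignCast S p (p + 2 * s')) (-evenSignCast S p (p + 2 * s'))
      (leadCoeff m A p s' s) := by
  set ε := evenSignCast S p (p + 2 * s') with hε
  have hodd : ∀ i < s', ε (p + 2 * i + 1) = ε (p + 2 * i) := fun i hi =>
    evenSignCast_succ_of ⟨by omega, ⟨i, by omega⟩, by omega⟩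
  have hOddPos : IsSignSymmetric ε (flipSigns (m - 2 * s) m ε) (oddPos m A s) :=
    isSignSymmetric_oddPos hm hA fun i hi => evenSignCast_succ_of_not (by grind)
  have hHankel : IsSignSymmetric (flipSigns (m - 2 * s) m ε)
      (flipSigns 0 (p + 1) (flipSigns (m - 2 * s) m ε)) (hankelFactor m A (p + 1)) := by
    refine isSignSymmetric_hankelFactor (by omega) hA (fun i hi => ?_) (fun i hi => ?_)
      fun i hi => if_neg (by omega)
    · rw [flipSigns, if_neg (by omega), hε, evenSignCast_of_le (by omega)]
    · rw [flipSigns, if_pos (by omega),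
        Odd.neg_one_pow (show Odd (m + 1 + (p + 1)) from ⟨p + s' + s + 1, by omega⟩), neg_one_mul]
  have hEvenNeg := isSignSymmetric_evenNeg hm hA
    (d := flipSigns 0 (p + 1) (flipSigns (m - 2 * s) m ε)) fun i hi => by
      simp only [flipSigns, show ¬ (p + 1 + 2 * i + 1 < p + 1) by omega,
        show ¬ (p + 1 + 2 * i < p + 1) by omega, show ¬ (m - 2 * s ≤ p + 1 + 2 * i + 1) by omega,
        show ¬ (m - 2 * s ≤ p + 1 + 2 * i) by omega, and_false, false_and, if_false]
      exact evenSignCast_succ_of_not (by grind)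
  have hMiddle := (hEvenNeg.mul_of_commute hHankel commute_oddNeg_hankelFactor).mul_of_commute
    hOddPos (commute_of_disjoint evenNeg_mul_hankelFactor_mem (oddPos_mem (by omega))
      (Set.Iio_disjoint_Ici
        (show p + 2 * s' + 1 ≤ m - 2 * s by omega)))
  rw [leadCoeff_eq hm]
  refine (isSignSymmetric_oddNeg hm hA hodd).sandwich
    (hMiddle.congr (fun _ _ => rfl) fun i hi => ?_)
    (isSignSymmetric_oddNeg hm hA fun i hi => congrArg Neg.neg (hodd i hi))
  simp only [flipSigns, Pi.neg_apply]
  split_ifs <;> first | rfl | omega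

theorem isSignSymmetric_constCoeff (hm : p + 2 * s' + 2 * s + 1 = m)
    (hA : ∀ j, (A j)ᵀ = (-1 : S) ^ j • A j) :
    IsSignSymmetric (evenSignCast S p (p + 2 * s')) (evenSignCast S p (p + 2 * s'))
      (constCoeff m A p s' s) := by
  set ε := evenSignCast S p (p + 2 * s') with hε
  set ε' := flipSigns (m - 2 * s) m ε with hε'
  have hLow : ∀ i < p + 2 * s' + 1, ε' i = ε i := fun i hi => if_neg (by omega)
  have hHigh : ∀ i < m, p + 2 * s' + 1 ≤ i → ε' i = -ε i := fun i hi hi' => if_pos (by omega)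
  have hOddPos : IsSignSymmetric ε ε' (oddPos m A s) :=
    isSignSymmetric_oddPos hm hA fun i hi => evenSignCast_succ_of_not (by grind)
  have hOddPos' : IsSignSymmetric ε' (flipSigns (m - 2 * s) m ε') (oddPos m A s) := by
    refine isSignSymmetric_oddPos hm hA fun i hi => ?_
    rw [hHigh _ (by omega) (by omega), hHigh _ (by omega) (by omega), hε,
      evenSignCast_succ_of_not (by grind)]
  have hOddNeg : IsSignSymmetric ε' ε' (oddNeg m A p s') := by
    refine isSignSymmetric_oddNeg hm hA fun i hi => ?_
    rw [hLow _ (by omega), hLow _ (by omega), hε,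
      evenSignCast_succ_of ⟨by omega, ⟨i, by omega⟩, by omega⟩]
  have hHankel : IsSignSymmetric ε' ε' (hankelFactor m A p) := by
    refine isSignSymmetric_hankelFactor (by omega) hA (fun i hi => ?_) (fun i _ => ?_)
      fun _ _ => rfl
    · rw [hLow i (by omega), hε, evenSignCast_of_le (by omega)]
    · rw [Even.neg_one_pow (show Even (m + 1 + p) from ⟨p + s' + s + 1, by omega⟩), one_mul]
  have hEvenPos : IsSignSymmetric ε' ε' (evenPos m A s) := by
    refine isSignSymmetric_evenPos hm hA fun i hi => ?_
    rcases eq_or_ne (i + 1) s with hs | hs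
    · rw [hHigh _ (by omega) (by omega), hLow _ (by omega), hε,
        evenSignCast_succ_of_not (by omega), neg_neg]
    · rw [hHigh _ (by omega) (by omega), hHigh _ (by omega) (by omega), hε,
        evenSignCast_succ_of ⟨by omega, ⟨s' + (s - 1 - i), by omega⟩, by omega⟩]
  have hMiddle := (hOddNeg.mul_of_commute hHankel commute_oddNeg_hankelFactor).mul_of_commute
    (hEvenPos.mul_of_commute (isSignSymmetric_diagFactor (a := m - 1) (Z := -A 0)
      (by rw [transpose_neg, transpose_of_even hA .zero]))
      (commute_evenPos_diagFactor (by omega) _))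
    (commute_of_disjoint oddNeg_mul_hankelFactor_mem (evenPos_mul_diagFactor_mem hm _)
      (Set.Iio_disjoint_Ici le_rfl))
  rw [constCoeff_eq hm]
  refine (hOddPos.sandwich hMiddle hOddPos').congr (fun _ _ => rfl) fun i _ => ?_
  simp only [hε', flipSigns]
  split_ifs <;> simp

end EvenSigns

section Uniqueness

variable {m n p s s' : ℕ} {S : Type*} [CommRing S] {A : ℕ → Matrix (Fin n) (Fin n) S}
  {d d' e e' : ℕ → S} {X Y : BlockMatrix m n S}

lemma scalarBlocks_one : scalarBlocks m n (1 : ℕ → S) = 1 := by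
  simp only [scalarBlocks, Pi.one_apply, one_smul, diagBlocks_one]

lemma IsSignSymmetric.commute (hX : IsSignSymmetric d d' X) (hX' : IsSignSymmetric e e' X)
    (hd : d * d = 1) (he : e * e = 1) (he' : e' * e' = 1) (h : e' * d' = e * d) :
    Commute (scalarBlocks m n (e * d)) X := by
  have hXd : Xᵀ = scalarBlocks m n d' * X * scalarBlocks m n d := by
    rw [← show _ = scalarBlocks m n d' * X from hX, Matrix.mul_assoc,
      scalarBlocks_mul_scalarBlocks, hd, scalarBlocks_one, Matrix.mul_one]
  have hXe : Xᵀ = scalarBlocks m n e' * X * scalarBlocks m n e := by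
    rw [← show _ = scalarBlocks m n e' * X from hX', Matrix.mul_assoc,
      scalarBlocks_mul_scalarBlocks, he, scalarBlocks_one, Matrix.mul_one]
  calc scalarBlocks m n (e * d) * X
    _ = scalarBlocks m n e' * (scalarBlocks m n d' * X * scalarBlocks m n d) *
          scalarBlocks m n d := by
        rw [← h, ← scalarBlocks_mul_scalarBlocks]
        simp only [Matrix.mul_assoc]
        rw [scalarBlocks_mul_scalarBlocks d d, hd, scalarBlocks_one, Matrix.mul_one]
    _ = X * scalarBlocks m n (e * d) := by
        rw [← hXd, hXe]
        simp only [← Matrix.mul_assoc]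
        rw [scalarBlocks_mul_scalarBlocks e' e', he', scalarBlocks_one, Matrix.one_mul,
          Matrix.mul_assoc, scalarBlocks_mul_scalarBlocks]

lemma commute_right_of_isUnit_left {M : Type*} [Monoid M] {x u y : M} (hu : IsUnit u)
    (hxu : Commute x u) (h : Commute x (u * y)) : Commute x y := by
  refine hu.mul_left_cancel ?_
  rw [← mul_assoc, ← hxu.eq, mul_assoc, h.eq, mul_assoc]

lemma commute_left_of_isUnit_right {M : Type*} [Monoid M] {x u y : M} (hu : IsUnit u)
    (hxu : Commute x u) (h : Commute x (y * u)) : Commute x y := by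
  refine hu.mul_right_cancel ?_
  rw [mul_assoc, h.eq, mul_assoc, mul_assoc, hxu.eq]

lemma commute_scalarBlocks_of_descProd {g : ℕ → BlockMatrix m n S} {T : ℕ → Set ℕ} {k : ℕ}
    (hg : ∀ i < k, g i ∈ identityOutside m n S (T i))
    (hT : ∀ j < k, ∀ i < j, Disjoint (T j) (T i))
    (h : Commute (scalarBlocks m n d) (descProd g k)) :
    ∀ i < k, Commute (scalarBlocks m n d) (g i) := by
  induction k with
  | zero => exact fun i hi => absurd hi i.not_lt_zero
  | succ k ih =>
    have hrest : descProd g k ∈ identityOutside m n S (⋃ i ∈ Set.Iio k, T i) :=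
      descProd_mem _ fun i hi =>
        identityOutside_mono (Set.subset_biUnion_of_mem hi) (hg i (by omega))
    have hdisj : Disjoint (T k) (⋃ i ∈ Set.Iio k, T i) :=
      Set.disjoint_iUnion₂_right.2 fun i hi => hT k k.lt_succ_self i hi
    rw [descProd_succ] at h
    intro i hi
    rcases Nat.lt_succ_iff_lt_or_eq.1 hi with hik | rfl
    · exact ih (fun i hi => hg i (by omega)) (fun j hj => hT j (by omega))
        (commute_scalarBlocks_right (hg k k.lt_succ_self) hrest hdisj h) i hik
    · exact commute_scalarBlocks_left (hg i hi) hrest hdisj h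

lemma smul_eq_smul_of_commute_scalarBlocks {F : ℕ → ℕ → Matrix (Fin n) (Fin n) S}
    (h : Commute (scalarBlocks m n d) (ofBlocks m F)) {i j : ℕ} (hi : i < m) (hj : j < m) :
    d i • F i j = d j • F i j := by
  rw [Commute, SemiconjBy, scalarBlocks, diagBlocks_mul_ofBlocks, ofBlocks_mul_diagBlocks] at h
  simpa using ofBlocks_inj h hi hj

lemma disjoint_oddNeg_hankelFactor : Disjoint (Set.Ico p (p + 2 * s)) (Set.Iio p) :=
  (Set.Iio_disjoint_Ici le_rfl).symm.mono_left Set.Ico_subset_Ici_self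

lemma commute_scalarBlocks_of_constCoeff (hm : p + 2 * s' + 2 * s + 1 = m)
    (h : Commute (scalarBlocks m n d) (constCoeff m A p s' s)) :
    Commute (scalarBlocks m n d) (oddNeg m A p s') ∧
      Commute (scalarBlocks m n d) (hankelFactor m A p) ∧
      Commute (scalarBlocks m n d)
        (oddPos m A s * evenPos m A s * diagFactor m (m - 1) (-A 0) * oddPos m A s) := by
  have hHigh : oddPos m A s * evenPos m A s * diagFactor m (m - 1) (-A 0) * oddPos m A s ∈
      identityOutside m n S (Set.Ici (p + 2 * s')) := by
    have hOddPos : oddPos m A s ∈ identityOutside m n S (Set.Ici (p + 2 * s')) :=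
      identityOutside_mono (Set.Ici_subset_Ici.2 (by omega)) (oddPos_mem (by omega))
    rw [mul_assoc (oddPos m A s)]
    exact mul_mem (mul_mem hOddPos (evenPos_mul_diagFactor_mem hm _)) hOddPos
  have hSplit := (Set.Iio_disjoint_Ici (le_refl (p + 2 * s'))).symm
  have hLow := commute_scalarBlocks_right hHigh oddNeg_mul_hankelFactor_mem hSplit h
  exact ⟨
    commute_scalarBlocks_left oddNeg_mem (hankelFactor_mem p) disjoint_oddNeg_hankelFactor hLow,
    commute_scalarBlocks_right oddNeg_mem (hankelFactor_mem p) disjoint_oddNeg_hankelFactor hLow,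
    commute_scalarBlocks_left hHigh oddNeg_mul_hankelFactor_mem hSplit h⟩

lemma commute_scalarBlocks_of_leadCoeff (hm : p + 2 * s' + 2 * s + 1 = m)
    (hOddNeg : Commute (scalarBlocks m n d) (oddNeg m A p s'))
    (h : Commute (scalarBlocks m n d) (leadCoeff m A p s' s)) :
    Commute (scalarBlocks m n d) (evenNeg m A p s') ∧
      Commute (scalarBlocks m n d) (hankelFactor m A (p + 1)) ∧
      Commute (scalarBlocks m n d) (oddPos m A s) := by
  have hUnit : IsUnit (oddNeg m A p s') := isUnit_oddNeg (by omega)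
  rw [leadCoeff_eq hm] at h
  have hMiddle := commute_right_of_isUnit_left hUnit hOddNeg
    (commute_left_of_isUnit_right hUnit hOddNeg h)
  have hOddPos := oddPos_mem (m := m) (A := A) (s := s) (by omega)
  have hSplit : Disjoint (Set.Iio (p + 2 * s' + 1)) (Set.Ici (m - 2 * s)) :=
    Set.Iio_disjoint_Ici (by omega)
  have hLow := commute_scalarBlocks_left evenNeg_mul_hankelFactor_mem hOddPos hSplit hMiddle
  exact ⟨commute_scalarBlocks_left evenNeg_mem (hankelFactor_mem _)
      disjoint_oddNeg_hankelFactor hLow,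
    commute_scalarBlocks_right evenNeg_mem (hankelFactor_mem _) disjoint_oddNeg_hankelFactor hLow,
    commute_scalarBlocks_right evenNeg_mul_hankelFactor_mem hOddPos hSplit hMiddle⟩

variable [IsDomain S]

lemma eq_of_smul_eq_smul {x y : S} {X : Matrix (Fin n) (Fin n) S} (hX : X ≠ 0)
    (h : x • X = y • X) : x = y := by
  obtain ⟨i, j, hij⟩ : ∃ i j, X i j ≠ 0 := by
    by_contra! h0
    exact hX (Matrix.ext h0)
  exact mul_right_cancel₀ hij (congrFun (congrFun h i) j)

lemma eq_of_commute_swapFactor [NeZero n] {a b : ℕ} (ha : a < m) (hb : b < m) (hab : a ≠ b)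
    {Z : Matrix (Fin n) (Fin n) S} (h : Commute (scalarBlocks m n d) (swapFactor m a b Z)) :
    d a = d b := by
  rw [swapFactor_eq_ofBlocks hab] at h
  refine eq_of_smul_eq_smul (one_ne_zero (α := Matrix (Fin n) (Fin n) S)) ?_
  simpa [hab.symm, hab] using smul_eq_smul_of_commute_scalarBlocks h ha hb

lemma eq_of_commute_hankelFactor (hA : A m ≠ 0) {a i j : ℕ} (ha : a ≤ m)
    (h : Commute (scalarBlocks m n d) (hankelFactor m A a)) (hij : i + j + 1 = a) :
    d i = d j := by
  rw [hankelFactor_eq_ofBlocks ha] at h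
  refine eq_of_smul_eq_smul hA ?_
  simpa [hij, show i < a by omega, show j < a by omega] using
    smul_eq_smul_of_commute_scalarBlocks (i := i) (j := j) h (by omega) (by omega)

lemma eq_of_commute_hankelFactors (hA : A m ≠ 0) (hp : p < m)
    (h : Commute (scalarBlocks m n d) (hankelFactor m A p))
    (h' : Commute (scalarBlocks m n d) (hankelFactor m A (p + 1))) {i : ℕ} (hi : i < p) :
    d (i + 1) = d i :=
  (eq_of_commute_hankelFactor hA hp h' (i := i + 1) (j := p - 1 - i) (by omega)).trans
    (eq_of_commute_hankelFactor hA hp.le h (by omega))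

variable [NeZero n]

lemma eq_of_commute_oddNeg (hp : p + 2 * s ≤ m)
    (h : Commute (scalarBlocks m n d) (oddNeg m A p s)) {i : ℕ} (hi : i < s) :
    d (p + 2 * i + 1) = d (p + 2 * i) := by
  refine eq_of_commute_swapFactor (by omega) (by omega) (by omega)
    (commute_scalarBlocks_of_descProd (fun i _ => swapFactor_mem _ _ _) (fun j _ i _ => ?_) h i hi)
  simp only [Set.disjoint_insert_left, Set.disjoint_singleton_left, Set.mem_insert_iff,
    Set.mem_singleton_iff]
  omega

lemma eq_of_commute_descProd_posFactor {c : ℕ} (hc : c + 1 < m) (hs : 2 * s ≤ c + 2)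
    (h : Commute (scalarBlocks m n d) (descProd (fun i => posFactor m A (c - 2 * i)) s)) {i : ℕ}
    (hi : i < s) : d (c - 2 * i + 1) = d (c - 2 * i) := by
  refine (eq_of_commute_swapFactor (by omega) (by omega) (by omega)
    (commute_scalarBlocks_of_descProd (fun i _ => swapFactor_mem _ _ _) (fun j _ i _ => ?_) h i
      hi)).symm
  simp only [Set.disjoint_insert_left, Set.disjoint_singleton_left, Set.mem_insert_iff,
    Set.mem_singleton_iff]
  omega

lemma succ_eq_of_commute_leadCoeff_constCoeff (hm : p + 2 * s' + 2 * s + 1 = m) (hA : A m ≠ 0)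
    (hLead : Commute (scalarBlocks m n d) (leadCoeff m A p s' s))
    (hConst : Commute (scalarBlocks m n d) (constCoeff m A p s' s)) {i : ℕ} (hi : i + 1 < m) :
    d (i + 1) = d i := by
  obtain ⟨hOddNeg, hHankel, hHigh⟩ := commute_scalarBlocks_of_constCoeff hm hConst
  obtain ⟨hEvenNeg, hHankel', hOddPos⟩ := commute_scalarBlocks_of_leadCoeff hm hOddNeg hLead
  have hUnit : IsUnit (oddPos m A s) := isUnit_oddPos (by omega)
  have hEvenPos : Commute (scalarBlocks m n d) (evenPos m A s) := by
    rw [mul_assoc (oddPos m A s)] at hHigh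
    exact commute_scalarBlocks_left (evenPos_mem (by omega)) (diagFactor_mem _ _) (by simp)
      (commute_right_of_isUnit_left hUnit hOddPos
        (commute_left_of_isUnit_right hUnit hOddPos hHigh))
  rcases lt_or_ge i p with hip | hip
  · exact eq_of_commute_hankelFactors hA (by omega) hHankel hHankel' hip
  rcases lt_or_ge i (p + 2 * s') with hiH | hiH <;> obtain ⟨t, ht | ht⟩ := (i - p).even_or_odd'
  · rw [show i = p + 2 * t by omega]
    exact eq_of_commute_oddNeg (by omega) hOddNeg (by omega)
  · rw [show i = p + 1 + 2 * t by omega]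
    exact eq_of_commute_oddNeg (p := p + 1) (by omega) hEvenNeg (by omega)
  · rw [show i = m - 3 - 2 * (s' + s - 1 - t) by omega]
    exact eq_of_commute_descProd_posFactor (by omega) (by omega) hEvenPos (by omega)
  · rw [show i = m - 2 - 2 * (s' + s - 1 - t) by omega]
    exact eq_of_commute_descProd_posFactor (by omega) (by omega) hOddPos (by omega)

theorem eq_of_commute_leadCoeff_constCoeff (hm : p + 2 * s' + 2 * s + 1 = m) (hA : A m ≠ 0)
    (hLead : Commute (scalarBlocks m n d) (leadCoeff m A p s' s))
    (hConst : Commute (scalarBlocks m n d) (constCoeff m A p s' s)) {i : ℕ} (hi : i < m) :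
    d i = d 0 := by
  induction i with
  | zero => rfl
  | succ i ih =>
    rw [succ_eq_of_commute_leadCoeff_constCoeff hm hA hLead hConst hi, ih (by omega)]

end Uniqueness

/-! ### T-even polynomial matrices -/

section TEven

variable {ι κ : Type*}

lemma isTEven_iff_coeffMat {P : Matrix ι ι ℂ[X]} :
    IsTEven P ↔ ∀ j, (coeffMat P j)ᵀ = (-1 : ℂ) ^ j • coeffMat P j := by
  have hcoeff : ∀ (f : ℂ[X]) (j : ℕ), (f.comp (-Polynomial.X)).coeff j = (-1) ^ j * f.coeff j :=
    fun f j => by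
      rw [show -Polynomial.X = Polynomial.C (-1 : ℂ) * Polynomial.X by simp,
        Polynomial.comp_C_mul_X_coeff, mul_comm]
  have hsq : ∀ (j : ℕ) (a : ℂ), (-1) ^ j * ((-1) ^ j * a) = a := fun j a => by
    rw [← mul_assoc, ← mul_pow, neg_one_mul, neg_neg, one_pow, one_mul]
  refine ⟨fun h j => ?_, fun h => ?_⟩
  · conv_rhs => rw [← h]
    ext a b
    simp only [coeffMat, transpose_apply, map_apply, Matrix.smul_apply, smul_eq_mul, hcoeff,
      hsq]
  · ext a b j
    have hab := congrFun (congrFun (h j) b) a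
    simp only [coeffMat, transpose_apply, map_apply, Matrix.smul_apply, smul_eq_mul] at hab
    simp only [transpose_apply, map_apply, hcoeff, hab]

lemma coeffMat_pencil_zero (E A : Matrix ι ι ℂ) : coeffMat (pencil E A) 0 = -A := by
  ext; simp [coeffMat, pencil]

lemma coeffMat_pencil_one (E A : Matrix ι ι ℂ) : coeffMat (pencil E A) 1 = E := by
  ext; simp [coeffMat, pencil]

lemma isTEven_pencil_iff {E A : Matrix ι ι ℂ} : IsTEven (pencil E A) ↔ Eᵀ = -E ∧ Aᵀ = A := by
  have htop : ∀ j, coeffMat (pencil E A) (j + 2) = 0 := fun j => by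
    ext; simp [coeffMat, pencil]
  rw [isTEven_iff_coeffMat]
  refine ⟨fun h => ⟨?_, ?_⟩, fun h j => ?_⟩
  · simpa only [coeffMat_pencil_one, pow_one, neg_one_smul] using h 1
  · simpa only [coeffMat_pencil_zero, pow_zero, one_smul, transpose_neg, neg_inj] using h 0
  · match j with
    | 0 => rw [coeffMat_pencil_zero, transpose_neg, h.2, pow_zero, one_smul]
    | 1 => rw [coeffMat_pencil_one, h.1, pow_one, neg_one_smul]
    | j + 2 => rw [htop, transpose_zero, smul_zero]

lemma isTEven_fromBlocks_iff {P : Matrix ι ι ℂ[X]} {C : Matrix ι κ ℂ} {B : Matrix κ ι ℂ}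
    {D : Matrix κ κ ℂ[X]} :
    IsTEven (fromBlocks P (C.map Polynomial.C) (B.map Polynomial.C) D) ↔
      IsTEven P ∧ C = Bᵀ ∧ IsTEven D := by
  have hC : ((C.map Polynomial.C).map fun f => f.comp (-Polynomial.X))ᵀ = Cᵀ.map Polynomial.C := by
    ext1; simp
  have hB : ((B.map Polynomial.C).map fun f => f.comp (-Polynomial.X))ᵀ = Bᵀ.map Polynomial.C := by
    ext1; simp
  simp only [IsTEven, fromBlocks_map, fromBlocks_transpose, fromBlocks_inj, hB, hC,
    (Matrix.map_injective Polynomial.C_injective).eq_iff]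
  refine and_congr_right' ⟨fun h => ⟨h.1.symm, h.2.2⟩, fun h => ⟨h.1.symm, ?_, h.2⟩⟩
  rw [h.1, transpose_transpose]

lemma IsTEven.neg {P : Matrix ι ι ℂ[X]} (h : IsTEven P) : IsTEven (-P) := by
  rw [isTEven_iff_coeffMat] at h ⊢
  intro j
  have hneg : coeffMat (-P) j = -coeffMat P j := by ext; simp [coeffMat]
  rw [hneg, transpose_neg, h, smul_neg]

lemma IsTEven.units_smul {P : Matrix ι ι ℂ[X]} (h : IsTEven P) (u : ℤˣ) :
    IsTEven (((u : ℤ) : ℂ[X]) • P) := by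
  rcases Int.units_eq_one_or u with rfl | rfl
  · simpa using h
  · simpa using h.neg

end TEven

section Pencils

variable {ι κ μ : Type*}

lemma map_C_mul_pencil [Fintype ι] (N : Matrix μ ι ℂ) (E A : Matrix ι κ ℂ) :
    N.map Polynomial.C * pencil E A = pencil (N * E) (N * A) := by
  simp only [pencil, Matrix.mul_sub, Matrix.mul_smul, Matrix.map_mul]

lemma pencil_mul_map_C [Fintype κ] (E A : Matrix ι κ ℂ) (N : Matrix κ μ ℂ) :
    pencil E A * N.map Polynomial.C = pencil (E * N) (A * N) := by
  simp only [pencil, Matrix.sub_mul, Matrix.smul_mul, Matrix.map_mul]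

lemma pencil_fromBlocks {ι' κ' : Type*} (a a' : Matrix ι κ ℂ) (b b' : Matrix ι κ' ℂ)
    (c c' : Matrix ι' κ ℂ) (d d' : Matrix ι' κ' ℂ) :
    pencil (fromBlocks a b c d) (fromBlocks a' b' c' d') =
      fromBlocks (pencil a a') (pencil b b') (pencil c c') (pencil d d') := by
  ext (i | i) (j | j) <;> simp [pencil]

lemma pencil_zero_neg (A : Matrix ι κ ℂ) : pencil 0 (-A) = A.map Polynomial.C := by
  ext1; simp [pencil]

lemma pencil_neg_neg (E A : Matrix ι κ ℂ) : pencil (-E) (-A) = -pencil E A := by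
  ext1; simp [pencil]; ring

end Pencils

section QuasiIdentity

variable {m n p s s' : ℕ} {A : ℕ → Matrix (Fin n) (Fin n) ℂ}

/-- The parameters of a quasi-identity matrix as complex numbers, extended by `1` beyond `m`. -/
def signSeq (δ : Fin m → ℤˣ) (i : ℕ) : ℂ := if h : i < m then ((δ ⟨i, h⟩ : ℤ) : ℂ) else 1

lemma signSeq_mul_self (δ : Fin m → ℤˣ) : signSeq δ * signSeq δ = 1 := by
  ext i
  rw [Pi.mul_apply, Pi.one_apply, signSeq]
  split_ifs with h
  · rw [← Int.cast_mul, Int.units_coe_mul_self, Int.cast_one]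
  · exact one_mul 1

lemma quasiIdentity_eq (δ : Fin m → ℤˣ) :
    quasiIdentity n δ = (scalarBlocks m n (signSeq δ)).map Polynomial.C := by
  ext1 p q
  have hpq : p = q ↔ (p.1 : ℕ) = q.1 ∧ p.2 = q.2 := by rw [Prod.ext_iff, Fin.ext_iff]
  by_cases h1 : (p.1 : ℕ) = q.1 <;> by_cases h2 : p.2 = q.2 <;>
    simp [quasiIdentity, scalarBlocks, diagBlocks, ofBlocks, signSeq, diagonal_apply, hpq, h1, h2]

lemma smul_quasiIdentity (u : ℤˣ) (δ : Fin m → ℤˣ) :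
    ((u : ℤ) : ℂ[X]) • quasiIdentity n δ = quasiIdentity n (fun i => u * δ i) := by
  ext1 p q
  simp only [quasiIdentity, Matrix.smul_apply, diagonal_apply, smul_eq_mul, mul_ite, mul_zero,
    Units.val_mul, Int.cast_mul]

lemma isTEven_quasiIdentity_mul_pencil_iff {δ : Fin m → ℤˣ} {X Y : BlockMatrix m n ℂ} :
    IsTEven (quasiIdentity n δ * pencil X Y) ↔
      IsSignSymmetric (signSeq δ) (-signSeq δ) X ∧ IsSignSymmetric (signSeq δ) (signSeq δ) Y := by
  have hneg : scalarBlocks m n (-signSeq δ) = -scalarBlocks m n (signSeq δ) := by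
    ext p q
    simp only [scalarBlocks, diagBlocks, ofBlocks, of_apply, Matrix.neg_apply, Pi.neg_apply]
    split_ifs <;> simp
  rw [quasiIdentity_eq, map_C_mul_pencil, isTEven_pencil_iff, transpose_mul, transpose_mul,
    scalarBlocks_transpose, IsSignSymmetric, IsSignSymmetric, IsAdjointPair, IsAdjointPair, hneg,
    Matrix.neg_mul]

/-- The quasi-identity matrix with parameters `ε` makes `L` T-even, and this determines `ε` up to a
common sign. -/
structure IsSignRigid (L : Matrix (Fin m × Fin n) (Fin m × Fin n) ℂ[X]) (ε : Fin m → ℤˣ) :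
    Prop where
  isTEven : IsTEven (quasiIdentity n ε * L)
  eq_mul : ∀ δ : Fin m → ℤˣ, IsTEven (quasiIdentity n δ * L) → ∃ c : ℤˣ, ∀ i, δ i = c * ε i

theorem exists_eq_mul_of_isTEven [NeZero n] (hm : p + 2 * s' + 2 * s + 1 = m) (hA : A m ≠ 0)
    {δ ε : Fin m → ℤˣ}
    (hδ : IsTEven (quasiIdentity n δ * pencil (leadCoeff m A p s' s) (constCoeff m A p s' s)))
    (hε : IsTEven (quasiIdentity n ε * pencil (leadCoeff m A p s' s) (constCoeff m A p s' s))) :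
    ∃ c : ℤˣ, ∀ i, δ i = c * ε i := by
  rw [isTEven_quasiIdentity_mul_pencil_iff] at hδ hε
  have hsq := signSeq_mul_self δ
  have hsq' := signSeq_mul_self ε
  have hLead := hδ.1.commute hε.1 hsq hsq' (by rw [neg_mul_neg, hsq']) (neg_mul_neg _ _)
  have hConst := hδ.2.commute hε.2 hsq hsq' hsq' rfl
  refine ⟨ε ⟨0, by omega⟩ * δ ⟨0, by omega⟩, fun i => ?_⟩
  have h := eq_of_commute_leadCoeff_constCoeff hm hA hLead hConst i.2
  simp only [Pi.mul_apply, signSeq, i.2, show 0 < m by omega, dif_pos, ← Int.cast_mul,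
    ← Units.val_mul] at h
  rw [← Units.ext (Int.cast_injective h), mul_right_comm, Int.units_mul_self, one_mul]

theorem isSignRigid_pencil [NeZero n] (hm : p + 2 * s' + 2 * s + 1 = m) (hA : A m ≠ 0)
    (hAT : ∀ j, (A j)ᵀ = (-1 : ℂ) ^ j • A j) :
    IsSignRigid (pencil (leadCoeff m A p s' s) (constCoeff m A p s' s))
      fun i => evenSign p (p + 2 * s') i := by
  have hsign : ∀ i < m, evenSignCast ℂ p (p + 2 * s') i =
      signSeq (fun i : Fin m => evenSign p (p + 2 * s') i) i := fun i hi => by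
    rw [signSeq, dif_pos hi, evenSignCast]
  have hEven : IsTEven (quasiIdentity n (fun i : Fin m => evenSign p (p + 2 * s') i) *
      pencil (leadCoeff m A p s' s) (constCoeff m A p s' s)) :=
    isTEven_quasiIdentity_mul_pencil_iff.2
      ⟨(isSignSymmetric_leadCoeff hm hAT).congr hsign fun i hi => congrArg Neg.neg (hsign i hi),
        (isSignSymmetric_constCoeff hm hAT).congr hsign hsign⟩
  exact ⟨hEven, fun δ hδ => exists_eq_mul_of_isTEven hm hA hδ hEven⟩

end QuasiIdentity

section BlockVectors

variable {S : Type*} [CommRing S] {m n r : ℕ}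

lemma singleBlock_mul_blockCol {a b : ℕ} (hb : b < m) (X : Matrix (Fin n) (Fin n) S)
    (C : Matrix (Fin n) (Fin r) S) :
    singleBlock m a b X * blockCol m ((b : ℤ) + 1) C = blockCol m ((a : ℤ) + 1) (X * C) := by
  ext p j
  simp only [mul_apply, singleBlock, ofBlocks, blockCol, of_apply, Fintype.sum_prod_type]
  rw [Finset.sum_eq_single ⟨b, hb⟩]
  · by_cases h : (p.1 : ℕ) = a <;> simp [h]
  · intro i _ hi
    have hib : (i : ℕ) ≠ b := fun h => hi (Fin.ext h)
    simp [hib]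
  · simp

lemma singleBlock_mul_blockCol_of_ne {a b c : ℕ} (hbc : b ≠ c) (X : Matrix (Fin n) (Fin n) S)
    (C : Matrix (Fin n) (Fin r) S) : singleBlock m a b X * blockCol m ((c : ℤ) + 1) C = 0 := by
  ext p j
  simp only [mul_apply, singleBlock, ofBlocks, blockCol, of_apply, Matrix.zero_apply]
  refine Finset.sum_eq_zero fun i _ => ?_
  rcases ne_or_eq (i.1 : ℕ) b with h | h
  · simp [h]
  · simp [h.trans_ne hbc]

lemma blockRow_eq_transpose (k : ℤ) (B : Matrix (Fin r) (Fin n) S) :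
    blockRow m k B = (blockCol m k Bᵀ)ᵀ := rfl

variable {T : Set ℕ} {N : BlockMatrix m n S}

lemma mul_blockCol_of_mem (hN : N ∈ identityOutside m n S T) {c : ℕ} (hc : c ∉ T) (hcm : c < m)
    (C : Matrix (Fin n) (Fin r) S) :
    N * blockCol m ((c : ℤ) + 1) C = blockCol m ((c : ℤ) + 1) C := by
  conv_lhs => rw [← Matrix.one_mul C, ← singleBlock_mul_blockCol hcm, ← Matrix.mul_assoc,
    (hN c hc).1, singleBlock_mul_blockCol hcm, Matrix.one_mul]

lemma blockRow_mul_of_mem (hN : N ∈ identityOutside m n S T) {c : ℕ} (hc : c ∉ T) (hcm : c < m)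
    (B : Matrix (Fin r) (Fin n) S) :
    blockRow m ((c : ℤ) + 1) B * N = blockRow m ((c : ℤ) + 1) B := by
  rw [blockRow_eq_transpose, ← transpose_transpose N, ← transpose_mul,
    mul_blockCol_of_mem (transpose_mem_identityOutside hN) hc hcm]

lemma swapFactor_mul_blockCol {a b : ℕ} (hab : a ≠ b) (hb : b < m) (X : Matrix (Fin n) (Fin n) S)
    (C : Matrix (Fin n) (Fin r) S) :
    swapFactor m a b X * blockCol m ((b : ℤ) + 1) C = blockCol m ((a : ℤ) + 1) C := by
  simp [swapFactor, Matrix.add_mul, Matrix.sub_mul, singleBlock_mul_blockCol_of_ne hab,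
    singleBlock_mul_blockCol hb]

lemma swapFactor_transpose (a b : ℕ) (X : Matrix (Fin n) (Fin n) S) :
    (swapFactor m a b X)ᵀ = swapFactor m a b Xᵀ := by
  simp only [swapFactor, transpose_add, transpose_sub, singleBlock_transpose, transpose_one]
  abel

lemma blockRow_mul_swapFactor {a b : ℕ} (hab : a ≠ b) (hb : b < m) (X : Matrix (Fin n) (Fin n) S)
    (B : Matrix (Fin r) (Fin n) S) :
    blockRow m ((b : ℤ) + 1) B * swapFactor m a b X = blockRow m ((a : ℤ) + 1) B := by
  rw [blockRow_eq_transpose, ← transpose_transpose (swapFactor m a b X), ← transpose_mul,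
    swapFactor_transpose, swapFactor_mul_blockCol hab hb, ← blockRow_eq_transpose]

variable {A : ℕ → Matrix (Fin n) (Fin n) S} {p s s' : ℕ}

lemma exists_oddPos_succ (hs : 2 * s + 2 < m) : ∃ N ∈ identityOutside m n S (Set.Iio (m - 2)),
    oddPos m A (s + 1) = N * posFactor m A (m - 2) := by
  refine ⟨descProd (fun i => posFactor m A (m - 2 - 2 * (i + 1))) s, descProd_mem _ fun i hi =>
    posFactor_mem _ (Set.mem_Iio.2 (by omega)) (Set.mem_Iio.2 (by omega)), descProd_succ' _ _⟩

lemma oddPos_mul_blockCol (hs : 2 * s < m) (C : Matrix (Fin n) (Fin r) S) :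
    oddPos m A s * blockCol m (m : ℤ) C = blockCol m ((m : ℤ) - (min s 1 : ℕ)) C := by
  rcases s with _ | s
  · simp [oddPos, descProd_zero]
  obtain ⟨N, hN, hEq⟩ := exists_oddPos_succ (A := A) (s := s) hs
  rw [hEq, Matrix.mul_assoc, show (m : ℤ) = ((m - 2 + 1 : ℕ) : ℤ) + 1 by omega, posFactor,
    swapFactor_mul_blockCol (by omega) (by omega),
    mul_blockCol_of_mem hN Set.self_notMem_Iio (by omega)]
  congr 1; omega

lemma blockRow_mul_oddPos (hs : 2 * s < m) (B : Matrix (Fin r) (Fin n) S) :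
    blockRow m (m : ℤ) B * oddPos m A s = blockRow m ((m : ℤ) - (min s 1 : ℕ)) B := by
  rcases s with _ | s
  · simp [oddPos, descProd_zero]
  obtain ⟨N, hN, hEq⟩ := exists_oddPos_succ (A := A) (s := s) hs
  rw [hEq, ← Matrix.mul_assoc, show (m : ℤ) = ((m - 2 + 1 : ℕ) : ℤ) + 1 by omega, posFactor,
    blockRow_mul_of_mem hN (by simp) (by omega), blockRow_mul_swapFactor (by omega) (by omega)]
  congr 1; omega

lemma oddPos_mul_evenPos_mul_blockCol (hs : 2 * s < m) (C : Matrix (Fin n) (Fin r) S) :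
    oddPos m A s * evenPos m A s * blockCol m (m : ℤ) C =
      blockCol m ((m : ℤ) - (min s 1 : ℕ)) C := by
  have hEven : evenPos m A s * blockCol m (m : ℤ) C = blockCol m (m : ℤ) C := by
    rw [show (m : ℤ) = ((m - 1 : ℕ) : ℤ) + 1 by omega]
    exact mul_blockCol_of_mem (evenPos_mem hs) (by simp) (by omega) C
  rw [Matrix.mul_assoc, hEven, oddPos_mul_blockCol hs]

lemma blockRow_mul_oddPos_mul_oddNeg (hm : p + 2 * s' + 2 * s + 1 = m)
    (B : Matrix (Fin r) (Fin n) S) :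
    blockRow m (m : ℤ) B * (oddPos m A s * (oddNeg m A p s' * hankelFactor m A p)) =
      blockRow m ((m : ℤ) - (min s 1 : ℕ)) B := by
  rw [← Matrix.mul_assoc, blockRow_mul_oddPos (by omega),
    show (m : ℤ) - (min s 1 : ℕ) = ((m - 1 - min s 1 : ℕ) : ℤ) + 1 by omega]
  exact blockRow_mul_of_mem oddNeg_mul_hankelFactor_mem
    (fun h => absurd (Set.mem_Iio.1 h) (by omega)) (by omega) B

lemma blockCol_map {S' : Type*} [CommRing S'] (g : S →+* S') (k : ℤ)
    (C : Matrix (Fin n) (Fin r) S) : (blockCol m k C).map g = blockCol m k (C.map g) := by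
  ext p j
  simp only [blockCol, map_apply, of_apply, apply_ite g, map_zero]

lemma blockRow_map {S' : Type*} [CommRing S'] (g : S →+* S') (k : ℤ)
    (B : Matrix (Fin r) (Fin n) S) : (blockRow m k B).map g = blockRow m k (B.map g) := by
  ext p j
  simp only [blockRow, map_apply, of_apply, apply_ite g, map_zero]

end BlockVectors

/-! ### The pencils of the polynomial part and of the system matrix -/

section SystemPencil

variable {m n r p s s' : ℕ} {w z cz : List ℤ}

/-- The embedding `M ↦ diag(M, I)` of square matrices, as a monoid homomorphism. -/
def diagOneHom (α κ S : Type*) [Fintype α] [DecidableEq α] [Fintype κ] [DecidableEq κ]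
    [CommRing S] : Matrix α α S →* Matrix (α ⊕ κ) (α ⊕ κ) S where
  toFun M := fromBlocks M 0 0 1
  map_one' := fromBlocks_one
  map_mul' M N := by simp [fromBlocks_multiply]

lemma fiedlerS_eq_diagOneHom (R : Realization (Fin n) r) {k : ℤ} (h0 : k ≠ 0) (hm : k ≠ -m) :
    fiedlerS m R k = diagOneHom _ _ _ (fiedlerP m R.P k) := by
  rw [fiedlerS, if_neg h0, if_neg hm]
  rfl

lemma prod_map_fiedlerPExt (P : Matrix (Fin n) (Fin n) ℂ[X]) (l : List ℤ) :
    (l.map (fiedlerPExt m r P)).prod = fromBlocks (l.map (fiedlerP m P)).prod 0 0 1 := by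
  change _ = diagOneHom _ _ _ (l.map (fiedlerP m P)).prod
  rw [map_list_prod, List.map_map]
  rfl

lemma prod_map_fiedlerS_admissible (R : Realization (Fin n) r) (h : p + 2 * s < m)
    (hz : IsAdmissible (p + 2 * s) p (z.map fun t => t + (m : ℤ))) :
    (z.map (fiedlerS m R)).prod = fromBlocks (z.map (fiedlerP m R.P)).prod 0 0 (-R.E) := by
  set T : Matrix ((Fin m × Fin n) ⊕ Fin r) ((Fin m × Fin n) ⊕ Fin r) ℂ :=
    fromBlocks 1 0 0 (-R.E) with hT
  have hComm : ∀ M : BlockMatrix m n ℂ, Commute T (diagOneHom _ _ _ M) := fun M => by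
    simp [hT, diagOneHom, Commute, SemiconjBy, fromBlocks_multiply]
  have hzero : fiedlerS m R (-m) = T * diagOneHom _ _ _ (fiedlerP m R.P (-m)) := by
    rw [fiedlerS, if_neg (by omega), if_pos rfl]
    simp [hT, diagOneHom, fromBlocks_multiply]
  suffices hprod : (z.map (fiedlerS m R)).prod = T * (z.map (fiedlerPExt m r R.P)).prod by
    rw [hprod, prod_map_fiedlerPExt, hT]
    simp [fromBlocks_multiply]
  have hdesc : descProd (fun i : ℕ => fiedlerS m R (p + 2 * i + 1 - m) *
      fiedlerS m R (p + 2 * i + 2 - m)) s = descProd (fun i : ℕ =>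
        diagOneHom _ _ _ (fiedlerP m R.P (p + 2 * i + 1 - m)) *
          diagOneHom _ _ _ (fiedlerP m R.P (p + 2 * i + 2 - m))) s :=
    descProd_congr fun i hi => by
      rw [fiedlerS_eq_diagOneHom R (by omega) (by omega),
        fiedlerS_eq_diagOneHom R (by omega) (by omega)]
  have hasc : ascProd (fun i : ℕ => fiedlerS m R ((i + 1 : ℕ) - m)) p =
      ascProd (fun i : ℕ => diagOneHom _ _ _ (fiedlerP m R.P ((i + 1 : ℕ) - m))) p :=
    ascProd_congr fun i hi => fiedlerS_eq_diagOneHom R (by omega) (by omega)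
  have hCommDesc := commute_descProd (k := s) fun i _ =>
    (hComm (fiedlerP m R.P (p + 2 * i + 1 - m))).mul_right
      (hComm (fiedlerP m R.P (p + 2 * i + 2 - m)))
  rw [prod_map_shift _ z m, prod_map_shift _ z m, hz.prod_map, hz.prod_map, ascProd_succ',
    ascProd_succ', hdesc, hasc, Nat.cast_zero, zero_sub, hzero, mul_assoc T, ← mul_assoc,
    ← hCommDesc.eq, mul_assoc]
  rfl

lemma prod_map_fiedlerS_admissible_zero (R : Realization (Fin n) r) (hs : 2 * s < m)
    (hw : IsAdmissible (2 * s) 0 w) :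
    (w.map (fiedlerS m R)).prod = fromBlocks (w.map (fiedlerP m R.P)).prod
      (-blockCol m ((m : ℤ) - (min s 1 : ℕ)) R.C) (-blockRow m (m : ℤ) R.B) (-R.A) := by
  have hdesc : descProd (fun i : ℕ => fiedlerS m R (2 * i + 1) * fiedlerS m R (2 * i + 2)) s =
      diagOneHom _ _ _ (oddPos m (coeffMat R.P) s * evenPos m (coeffMat R.P) s) := by
    rw [← descProd_fiedlerP_pair R.P hs, map_descProd]
    refine descProd_congr fun i _ => ?_
    rw [fiedlerS_eq_diagOneHom R (by omega) (by omega),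
      fiedlerS_eq_diagOneHom R (by omega) (by omega), map_mul]
  have hS : fiedlerS m R 0 = fromBlocks (diagFactor m (m - 1) (-coeffMat R.P 0))
      (-blockCol m (m : ℤ) R.C) (-blockRow m (m : ℤ) R.B) (-R.A) := by
    rw [fiedlerS, if_pos rfl, fiedlerP_zero R.P (by omega)]
  rw [prod_map_fiedlerP_admissible_zero R.P hs hw]
  rw [← zero_add (2 * s)] at hw
  simp only [hw.prod_map, Nat.cast_zero, zero_add, ascProd_succ, ascProd_zero, one_mul, hS, hdesc,
    diagOneHom, MonoidHom.coe_mk, OneHom.coe_mk, fromBlocks_multiply, Matrix.zero_mul, neg_zero,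
    add_zero, Matrix.one_mul, Matrix.mul_neg, oddPos_mul_evenPos_mul_blockCol hs]

lemma pencilP_eq (P : Matrix (Fin n) (Fin n) ℂ[X]) (hm : p + 2 * s' + 2 * s + 1 = m)
    (hw : IsAdmissible (2 * s) 0 w)
    (hz : IsAdmissible (p + 2 * s') p (z.map fun t => t + (m : ℤ)))
    (hcz : (cz.map fun t => t + (m : ℤ)) = symmetricComplement (p + 2 * s') p) :
    pencilP m P z w (symmetricComplement (2 * s) 0) cz =
      pencil (leadCoeff m (coeffMat P) p s' s) (constCoeff m (coeffMat P) p s' s) := by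
  rw [pencilP, pencil_mul_map_C, pencil_mul_map_C,
    prod_map_fiedlerP_admissible_zero P (by omega) hw,
    prod_map_fiedlerP_admissible P (by omega) hz,
    prod_map_fiedlerP_symmetricComplement P (by omega) hcz,
    prod_map_fiedlerP_symmetricComplement_zero P (by omega), leadCoeff, constCoeff]

lemma pencilS_eq (R : Realization (Fin n) r) (hm : p + 2 * s' + 2 * s + 1 = m)
    (hw : IsAdmissible (2 * s) 0 w)
    (hz : IsAdmissible (p + 2 * s') p (z.map fun t => t + (m : ℤ)))
    (hcz : (cz.map fun t => t + (m : ℤ)) = symmetricComplement (p + 2 * s') p) :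
    pencilS m R z w (symmetricComplement (2 * s) 0) cz =
      fromBlocks (pencilP m R.P z w (symmetricComplement (2 * s) 0) cz)
        ((blockCol m ((m : ℤ) - (min s 1 : ℕ)) R.C).map Polynomial.C)
        ((blockRow m ((m : ℤ) - (min s 1 : ℕ)) R.B).map Polynomial.C) (-pencil R.E R.A) := by
  have hrow : blockRow m (m : ℤ) R.B * ((symmetricComplement (2 * s) 0).map (fiedlerP m R.P)).prod *
      (cz.map (fiedlerP m R.P)).prod = blockRow m ((m : ℤ) - (min s 1 : ℕ)) R.B := by
    rw [prod_map_fiedlerP_symmetricComplement R.P (by omega) hcz,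
      prod_map_fiedlerP_symmetricComplement_zero R.P (by omega), Matrix.mul_assoc,
      blockRow_mul_oddPos_mul_oddNeg hm]
  rw [pencilS, pencilP, prod_map_fiedlerS_admissible R (by omega) hz,
    prod_map_fiedlerS_admissible_zero R (by omega) hw, prod_map_fiedlerPExt, prod_map_fiedlerPExt,
    pencil_mul_map_C, pencil_mul_map_C, pencil_mul_map_C, pencil_mul_map_C]
  simp only [fromBlocks_multiply, pencil_fromBlocks, Matrix.mul_zero, Matrix.zero_mul, add_zero,
    zero_add, Matrix.mul_one, Matrix.neg_mul, hrow, pencil_neg_neg, pencil_zero_neg]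

end SystemPencil

/-! ### Transfer functions -/

section Transfer

lemma eval₂_C_neg_X (f : ℂ[X]) :
    f.eval₂ (RatFunc.C : ℂ →+* RatFunc ℂ) (-RatFunc.X) =
      algebraMap ℂ[X] (RatFunc ℂ) (f.comp (-Polynomial.X)) := by
  rw [Polynomial.comp, Polynomial.hom_eval₂, map_neg, RatFunc.algebraMap_X]
  rfl

lemma eval₂_C_neg_X_ne_zero {f : ℂ[X]} (hf : f ≠ 0) :
    f.eval₂ (RatFunc.C : ℂ →+* RatFunc ℂ) (-RatFunc.X) ≠ 0 := by
  rw [eval₂_C_neg_X, map_ne_zero_iff _ (RatFunc.algebraMap_injective ℂ)]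
  exact mt Polynomial.comp_neg_X_eq_zero_iff.1 hf

/-- The substitution `x ↦ -x` in rational functions. -/
def negSubst : RatFunc ℂ →+* RatFunc ℂ where
  toFun f := f.eval RatFunc.C (-RatFunc.X)
  map_one' := RatFunc.eval_one _ _
  map_zero' := RatFunc.eval_zero _ _
  map_add' f g := RatFunc.eval_add _ _ (eval₂_C_neg_X_ne_zero f.denom_ne_zero)
    (eval₂_C_neg_X_ne_zero g.denom_ne_zero)
  map_mul' f g := RatFunc.eval_mul _ _ (eval₂_C_neg_X_ne_zero f.denom_ne_zero)
    (eval₂_C_neg_X_ne_zero g.denom_ne_zero)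

lemma isTEvenRat_iff {ι : Type*} {G : Matrix ι ι (RatFunc ℂ)} :
    IsTEvenRat G ↔ (G.map negSubst)ᵀ = G := Iff.rfl

lemma negSubst_C (a : ℂ) : negSubst (RatFunc.C a) = RatFunc.C a := RatFunc.eval_C _ _

lemma negSubst_X : negSubst RatFunc.X = -RatFunc.X := RatFunc.eval_X _ _

lemma negSubst_algebraMap (f : ℂ[X]) : negSubst (algebraMap ℂ[X] (RatFunc ℂ) f) =
    algebraMap ℂ[X] (RatFunc ℂ) (f.comp (-Polynomial.X)) := by
  rw [← eval₂_C_neg_X]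
  exact RatFunc.eval_algebraMap _ _ f

lemma map_negSubst_map_C {ι κ : Type*} (M : Matrix ι κ ℂ) :
    (M.map RatFunc.C).map negSubst = M.map RatFunc.C := by
  ext1
  simp [negSubst_C]

lemma map_nonsing_inv {K L ι : Type*} [Field K] [Field L] [Fintype ι] [DecidableEq ι] (f : K →+* L)
    (M : Matrix ι ι K) : M⁻¹.map f = (M.map f)⁻¹ := by
  rw [inv_def, inv_def, Ring.inverse_eq_inv', Ring.inverse_eq_inv', ← RingHom.mapMatrix_apply,
    ← RingHom.mapMatrix_apply, ← RingHom.map_det, ← RingHom.map_adjugate, ← map_inv₀]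
  ext i j
  simp

theorem Realization.IsTEvenRealization.transfer {ι : Type*} {r : ℕ} {R : Realization ι r}
    (h : R.IsTEvenRealization) : IsTEvenRat R.transfer := by
  obtain ⟨hC, hP, hEA⟩ := h
  obtain ⟨hE, hA⟩ := isTEven_pencil_iff.1 hEA
  set N : Matrix (Fin r) (Fin r) (RatFunc ℂ) :=
    (RatFunc.X : RatFunc ℂ) • R.E.map RatFunc.C - R.A.map RatFunc.C with hN
  have hN_even : (N.map negSubst)ᵀ = N := by
    ext i j
    have hEij : R.E j i = -R.E i j := congrFun (congrFun hE i) j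
    have hAij : R.A j i = R.A i j := congrFun (congrFun hA i) j
    simp [hN, negSubst_C, negSubst_X, hEij, hAij]
  have hP_even : ((R.P.map (algebraMap ℂ[X] (RatFunc ℂ))).map negSubst)ᵀ =
      R.P.map (algebraMap ℂ[X] (RatFunc ℂ)) := by
    ext i j
    simp only [transpose_apply, map_apply, negSubst_algebraMap]
    exact congrArg _ (congrFun (congrFun hP i) j)
  rw [isTEvenRat_iff, Realization.transfer, ← hN, Matrix.map_add _ (map_add negSubst),
    Matrix.map_mul, Matrix.map_mul, map_negSubst_map_C, map_negSubst_map_C, map_nonsing_inv,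
    transpose_add, hP_even, transpose_mul, transpose_mul, transpose_nonsing_inv, hN_even, hC,
    transpose_map, transpose_transpose, Matrix.mul_assoc]

lemma Realization.IsMinimal.B_ne_zero {ι : Type*} {r : ℕ} {R : Realization ι r} (h : R.IsMinimal)
    (hr : 0 < r) : R.B ≠ 0 := by
  intro hB
  refine (h 0 ⟨R.P, 0, 0, 0, 0, by simp⟩ ?_).not_gt hr
  simp [Realization.transfer, hB]

/-- The realization of a diagonal block of a rational matrix, with a modified polynomial part. -/
def Realization.block {ι κ : Type*} {r : ℕ} (R : Realization ι r) (f : κ → ι)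
    (Q : Matrix κ κ ℂ[X]) : Realization κ r where
  P := R.P.submatrix f f + Q
  C := R.C.submatrix f id
  E := R.E
  A := R.A
  B := R.B.submatrix id f
  isUnit_det_E := R.isUnit_det_E

lemma Realization.transfer_block {ι κ : Type*} {r : ℕ} (R : Realization ι r) (f : κ → ι)
    (Q : Matrix κ κ ℂ[X]) : (R.block f Q).transfer =
      R.transfer.submatrix f f + Q.map (algebraMap ℂ[X] (RatFunc ℂ)) := by
  ext i j
  simp only [Realization.transfer, Realization.block, Matrix.add_apply, map_apply, submatrix_apply,
    mul_apply, map_add, id]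
  ring

lemma isMinimal_liftRealization {m n r : ℕ} {R : Realization (Fin n) r} (hR : R.IsMinimal)
    (hC : R.C = R.Bᵀ) {k : ℤ} (k' : Fin m) (hk : ((k' : ℕ) : ℤ) + 1 = k)
    (L : Matrix (Fin m × Fin n) (Fin m × Fin n) ℂ[X]) :
    (liftRealization m R k L).IsMinimal := by
  intro r' R' hR'
  let f : Fin n → Fin m × Fin n := fun i => (k', i)
  refine hR r' (R'.block f (R.P - L.submatrix f f)) ?_
  rw [Realization.transfer_block, hR', Realization.transfer, Realization.transfer]
  have hCol : ∀ i j, blockCol m k R.Bᵀ (f i) j = R.C i j := fun i j => by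
    simp [blockCol, f, hk, hC]
  have hRow : ∀ i j, blockRow m k R.B i (f j) = R.B i j := fun i j => by
    simp [blockRow, f, hk]
  ext i j
  simp only [liftRealization, Matrix.add_apply, map_apply, submatrix_apply, mul_apply, map_sub,
    Matrix.sub_apply, hCol, hRow]
  ring

end Transfer

/-! ### Block elimination -/

section Elimination

variable {m n : ℕ} {S : Type*} [CommRing S]

lemma isUnit_one_add_singleBlock {a b : ℕ} (hab : a ≠ b) (Y : Matrix (Fin n) (Fin n) S) :
    IsUnit (1 + singleBlock m a b Y) :=
  IsUnit.of_mul_eq_one (1 - singleBlock m a b Y) <| by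
    simp [Matrix.mul_sub, Matrix.add_mul, singleBlock_mul_singleBlock_of_ne hab.symm]

lemma isUnit_one_sub_two_smul_add_singleBlock {a b : ℕ} (ha : a < m) (hab : a ≠ b)
    (Y : Matrix (Fin n) (Fin n) S) :
    IsUnit (1 - (2 : S) • singleBlock m a a 1 + singleBlock m b a Y) :=
  IsUnit.of_mul_eq_one (1 - (2 : S) • singleBlock m a a 1 + singleBlock m b a Y) <| by
    simp only [Matrix.mul_add, Matrix.add_mul, Matrix.mul_sub, Matrix.sub_mul, Matrix.mul_one,
      Matrix.one_mul, singleBlock_mul_singleBlock _ _ ha, singleBlock_mul_singleBlock_of_ne hab,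
      Matrix.smul_mul, Matrix.mul_smul]
    module

lemma isUnit_swapFactor {a b : ℕ} (ha : a < m) (hb : b < m) (hab : a ≠ b)
    (X : Matrix (Fin n) (Fin n) S) : IsUnit (swapFactor m a b X) :=
  IsUnit.of_mul_eq_one _ (swapFactor_mul_swapFactor ha hb hab X)

lemma eliminate_swapFactor {T : Set ℕ} {N : BlockMatrix m n S}
    (hN : N ∈ identityOutside m n S T) {a b : ℕ} (ha : a < m) (hb : b < m) (hab : a ≠ b)
    (haT : a ∉ T) {f : ℕ → Matrix (Fin n) (Fin n) S} {x : S} {X Z : Matrix (Fin n) (Fin n) S}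
    (hfa : f a = x • Z) (hfb : f b = x • 1) :
    (1 - (2 : S) • singleBlock m a a 1 + singleBlock m b a (x • 1)) *
        (diagBlocks m f - N * swapFactor m a b X) *
        (swapFactor m b a (-X) * (1 + singleBlock m a b (x • Z))) =
      diagBlocks m (Function.update (Function.update f a 2) b (x • (x • Z - X))) - N := by
  have hswap : (diagBlocks m f - N * swapFactor m a b X) * swapFactor m b a (-X) =
      diagBlocks m f * swapFactor m b a (-X) - N := by
    rw [Matrix.sub_mul, Matrix.mul_assoc N, swapFactor_mul_swapFactor ha hb hab, Matrix.mul_one]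
  have hNa := mul_singleBlock_of_mem hN haT
  have haN := fun d => singleBlock_mul_of_mem (d := d) hN haT
  have h2 : (2 : Matrix (Fin n) (Fin n) S) = (2 : S) • 1 := by
    rw [two_smul, one_add_one_eq_two]
  rw [← Matrix.mul_assoc, Matrix.mul_assoc _ _ (swapFactor m b a (-X)), hswap,
    diagBlocks_update, diagBlocks_update, Function.update_of_ne hab.symm, hfa, hfb, h2]
  simp only [swapFactor, Matrix.mul_add, Matrix.add_mul, Matrix.mul_sub, Matrix.sub_mul,
    Matrix.mul_one, Matrix.one_mul, Matrix.smul_mul, Matrix.mul_smul, diagBlocks_mul_singleBlock,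
    singleBlock_mul_diagBlocks, singleBlock_mul_singleBlock _ _ ha,
    singleBlock_mul_singleBlock_of_ne hab, singleBlock_mul_singleBlock_of_ne hab.symm, hNa, haN,
    hfa, hfb, singleBlock_smul, singleBlock_sub, singleBlock_neg, smul_sub, Matrix.neg_mul,
    Matrix.mul_neg, Matrix.zero_mul, smul_zero]
  module

/-- Invertible row and column operations carry `D - L * T * R` to `D' - T`, and in the block row
and column `t` they undo `L` and `R`. -/
def EliminatesTo (t : ℕ) (T D L R D' : BlockMatrix m n S) : Prop :=
  ∃ U V : BlockMatrix m n S, IsUnit U ∧ IsUnit V ∧ U * (D - L * T * R) * V = D' - T ∧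
    U * L * singleBlock m t t 1 = singleBlock m t t 1 ∧
    singleBlock m t t 1 * (R * V) = singleBlock m t t 1

namespace EliminatesTo

variable {t : ℕ} {T D L R D' : BlockMatrix m n S}

lemma refl : EliminatesTo t T D 1 1 D :=
  ⟨1, 1, isUnit_one, isUnit_one, by simp, by simp, by simp⟩

lemma transpose (h : EliminatesTo t T D L R D') : EliminatesTo t Tᵀ Dᵀ Rᵀ Lᵀ D'ᵀ := by
  obtain ⟨U, V, hU, hV, hD, hL, hR⟩ := h
  refine ⟨Vᵀ, Uᵀ, ?_, ?_, ?_, ?_, ?_⟩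
  · exact (isUnit_transpose V).2 hV
  · exact (isUnit_transpose U).2 hU
  · simpa only [transpose_mul, transpose_sub, Matrix.mul_assoc] using congrArg (·ᵀ) hD
  · simpa only [transpose_mul, singleBlock_transpose, transpose_one, Matrix.mul_assoc] using
      congrArg (·ᵀ) hR
  · simpa only [transpose_mul, singleBlock_transpose, transpose_one, Matrix.mul_assoc] using
      congrArg (·ᵀ) hL

lemma mul_swapFactor {K : Set ℕ} {a b : ℕ} {f : ℕ → Matrix (Fin n) (Fin n) S} {x : S}
    {X Z : Matrix (Fin n) (Fin n) S} (hT : T ∈ identityOutside m n S K)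
    (hL : L ∈ identityOutside m n S K) (hR : R ∈ identityOutside m n S K) (ht : t ∈ K)
    (haK : a ∉ K) (ha : a < m) (hb : b < m) (hab : a ≠ b) (hfa : f a = x • Z) (hfb : f b = x • 1)
    (h : EliminatesTo t T
      (diagBlocks m (Function.update (Function.update f a 2) b (x • (x • Z - X)))) L R D') :
    EliminatesTo t T (diagBlocks m f) L (R * swapFactor m a b X) D' := by
  obtain ⟨U, V, hU, hV, hD, hUL, hRV⟩ := h
  have hta : t ≠ a := fun h => haK (h ▸ ht)
  have haL : ∀ d Y, singleBlock m d a Y * (L * singleBlock m t t 1) = 0 := fun d Y => by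
    rw [← Matrix.mul_assoc, singleBlock_mul_of_mem hL haK,
      singleBlock_mul_singleBlock_of_ne hta.symm]
  refine ⟨U * (1 - (2 : S) • singleBlock m a a 1 + singleBlock m b a (x • 1)),
    swapFactor m b a (-X) * (1 + singleBlock m a b (x • Z)) * V,
    hU.mul (isUnit_one_sub_two_smul_add_singleBlock ha hab _),
    ((isUnit_swapFactor hb ha hab.symm _).mul (isUnit_one_add_singleBlock hab _)).mul hV,
    ?_, ?_, ?_⟩
  · rw [← hD, ← eliminate_swapFactor (mul_mem (mul_mem hL hT) hR) ha hb hab haK hfa hfb]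
    simp only [Matrix.mul_assoc]
  · refine Eq.trans ?_ hUL
    simp [Matrix.mul_assoc, Matrix.add_mul, Matrix.sub_mul, Matrix.mul_add, Matrix.mul_sub, haL]
  · have hcancel : R * swapFactor m a b X * (swapFactor m b a (-X) *
        (1 + singleBlock m a b (x • Z)) * V) = R * V + singleBlock m a b (x • Z) * V := by
      rw [Matrix.mul_assoc R, ← Matrix.mul_assoc (swapFactor m a b X),
        ← Matrix.mul_assoc (swapFactor m a b X), swapFactor_mul_swapFactor ha hb hab,
        Matrix.one_mul, Matrix.add_mul, Matrix.one_mul, Matrix.mul_add, ← Matrix.mul_assoc R,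
        mul_singleBlock_of_mem hR haK]
    rw [hcancel, Matrix.mul_add, hRV, ← Matrix.mul_assoc, singleBlock_mul_singleBlock_of_ne hta,
      Matrix.zero_mul, add_zero]

lemma swapFactor_mul {K : Set ℕ} {a b : ℕ} {f : ℕ → Matrix (Fin n) (Fin n) S} {x : S}
    {X Z : Matrix (Fin n) (Fin n) S} (hT : T ∈ identityOutside m n S K)
    (hL : L ∈ identityOutside m n S K) (hR : R ∈ identityOutside m n S K) (ht : t ∈ K)
    (haK : a ∉ K) (ha : a < m) (hb : b < m) (hab : a ≠ b) (hfa : f a = x • Z) (hfb : f b = x • 1)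
    (h : EliminatesTo t T
      (diagBlocks m (Function.update (Function.update f a 2) b (x • (x • Z - X)))) L R D') :
    EliminatesTo t T (diagBlocks m f) (swapFactor m a b X * L) R D' := by
  have hupd : (fun i => (Function.update (Function.update f a 2) b (x • (x • Z - X)) i)ᵀ) =
      Function.update (Function.update (fun i => (f i)ᵀ) a 2) b (x • (x • Zᵀ - Xᵀ)) := by
    funext i
    simp only [Function.update_apply]
    split_ifs <;> simp
  have h' := h.transpose
  rw [diagBlocks_transpose, hupd] at h'
  have := mul_swapFactor (transpose_mem_identityOutside hT) (transpose_mem_identityOutside hR)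
    (transpose_mem_identityOutside hL) ht haK ha hb hab (by simp [hfa]) (by simp [hfb]) h'
  simpa only [diagBlocks_transpose, transpose_mul, transpose_transpose, swapFactor_transpose]
    using this.transpose

end EliminatesTo

/-- The Horner scheme `x • (x • ⋯ (x • Z - X (j - 1)) ⋯ - X 1) - X 0`. -/
def horner (x : S) (X : ℕ → Matrix (Fin n) (Fin n) S) :
    ℕ → Matrix (Fin n) (Fin n) S → Matrix (Fin n) (Fin n) S
  | 0, Z => Z
  | j + 1, Z => horner x X j (x • Z - X j)

lemma smul_horner (x : S) (X : ℕ → Matrix (Fin n) (Fin n) S) (j : ℕ)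
    (Z : Matrix (Fin n) (Fin n) S) :
    x • horner x X j Z = x ^ (j + 1) • Z - ∑ i ∈ Finset.range j, x ^ (i + 1) • X i := by
  induction j generalizing Z with
  | zero => simp [horner]
  | succ j ih =>
    rw [horner, ih, Finset.sum_range_succ]
    module

/-- The part of the product of the swap factors along `c 0, c 1, …` that stands on the left: the
factor of `c i, c (i + 1)` occurs if `left i` holds, and later factors are further out. -/
def chainLeft (m : ℕ) (c : ℕ → ℕ) (X : ℕ → Matrix (Fin n) (Fin n) S) (left : ℕ → Bool) (j : ℕ) :
    BlockMatrix m n S :=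
  descProd (fun i => if left i then swapFactor m (c (i + 1)) (c i) (X i) else 1) j

/-- The counterpart of `chainLeft`, with the factors of the `i` at which `left i` fails. -/
def chainRight (m : ℕ) (c : ℕ → ℕ) (X : ℕ → Matrix (Fin n) (Fin n) S) (left : ℕ → Bool) (j : ℕ) :
    BlockMatrix m n S :=
  ascProd (fun i => if left i then 1 else swapFactor m (c (i + 1)) (c i) (X i)) j

variable {c : ℕ → ℕ} {X : ℕ → Matrix (Fin n) (Fin n) S} {left : ℕ → Bool}

lemma chainLeft_succ (j : ℕ) : chainLeft m c X left (j + 1) =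
    if left j then swapFactor m (c (j + 1)) (c j) (X j) * chainLeft m c X left j
    else chainLeft m c X left j := by
  rw [chainLeft, descProd_succ, ite_mul, one_mul]
  rfl

lemma chainRight_succ (j : ℕ) : chainRight m c X left (j + 1) =
    if left j then chainRight m c X left j
    else chainRight m c X left j * swapFactor m (c (j + 1)) (c j) (X j) := by
  rw [chainRight, ascProd_succ, mul_ite, mul_one]
  rfl

lemma swapFactor_mem_image (i j : ℕ) (hij : i < j) (Y : Matrix (Fin n) (Fin n) S) :
    swapFactor m (c (i + 1)) (c i) Y ∈ identityOutside m n S (c '' Set.Iic j) :=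
  identityOutside_mono (Set.insert_subset ⟨i + 1, hij, rfl⟩
    (Set.singleton_subset_iff.2 ⟨i, hij.le, rfl⟩)) (swapFactor_mem _ _ _)

lemma chainLeft_mem (j : ℕ) :
    chainLeft m c X left j ∈ identityOutside m n S (c '' Set.Iic j) :=
  descProd_mem _ fun i hi => by
    split_ifs
    exacts [swapFactor_mem_image i j hi _, one_mem _]

lemma chainRight_mem (j : ℕ) :
    chainRight m c X left j ∈ identityOutside m n S (c '' Set.Iic j) :=
  ascProd_mem _ fun i hi => by
    split_ifs
    exacts [one_mem _, swapFactor_mem_image i j hi _]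

/-- The diagonal blocks `f` at the stage of the elimination along a chain `c` where the blocks
`c 0, …, c j` are left. The finished blocks are `2`, so that subtracting `1` leaves `1`. -/
structure IsChainDiag (m : ℕ) (c : ℕ → ℕ) (x : S) (j : ℕ) (Z : Matrix (Fin n) (Fin n) S)
    (f : ℕ → Matrix (Fin n) (Fin n) S) : Prop where
  apply_of_lt : ∀ i < j, f (c i) = x • 1
  apply_last : f (c j) = x • Z
  apply_of_notMem : ∀ k < m, k ∉ c '' Set.Iic j → f k = 2

namespace IsChainDiag

variable {x : S} {j : ℕ} {Z : Matrix (Fin n) (Fin n) S} {f : ℕ → Matrix (Fin n) (Fin n) S}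

lemma diagBlocks_eq (h : IsChainDiag m c x 0 Z f) :
    diagBlocks m f = diagBlocks m (Function.update (fun _ => 2) (c 0) (x • Z)) :=
  ofBlocks_congr fun i hi k _ => by
    rcases eq_or_ne i (c 0) with rfl | hic
    · rw [h.apply_last, Function.update_self]
    · rw [h.apply_of_notMem i hi (by simpa using hic.symm), Function.update_of_ne hic]

lemma update (h : IsChainDiag m c x (j + 1) Z f) (hinj : Set.InjOn c (Set.Iic (j + 1)))
    (Y : Matrix (Fin n) (Fin n) S) :
    IsChainDiag m c x j Y
      (Function.update (Function.update f (c (j + 1)) 2) (c j) (x • Y)) where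
  apply_of_lt i hi := by
    have hij : c i ≠ c j := hinj.ne (by simp; omega) (by simp) hi.ne
    have hij' : c i ≠ c (j + 1) := hinj.ne (by simp; omega) (by simp) (by omega)
    rw [Function.update_of_ne hij, Function.update_of_ne hij', h.apply_of_lt i (by omega)]
  apply_last := Function.update_self ..
  apply_of_notMem k hk hkc := by
    rw [Function.update_of_ne fun hkj => hkc ⟨j, by simp, hkj.symm⟩]
    rcases eq_or_ne k (c (j + 1)) with rfl | hka
    · rw [Function.update_self]
    · rw [Function.update_of_ne hka, h.apply_of_notMem k hk]
      rintro ⟨i, hi, rfl⟩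
      rcases Nat.lt_or_eq_of_le hi with hi | rfl
      · exact hkc ⟨i, by simp; omega, rfl⟩
      · exact hka rfl

end IsChainDiag

theorem eliminatesTo_chain {T : BlockMatrix m n S} (hT : T ∈ identityOutside m n S {c 0}) {x : S}
    {j : ℕ} (hlt : ∀ i ≤ j, c i < m) (hinj : Set.InjOn c (Set.Iic j))
    {Z : Matrix (Fin n) (Fin n) S} {f : ℕ → Matrix (Fin n) (Fin n) S}
    (hf : IsChainDiag m c x j Z f) :
    EliminatesTo (c 0) T (diagBlocks m f) (chainLeft m c X left j) (chainRight m c X left j)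
      (diagBlocks m (Function.update (fun _ => 2) (c 0) (x • horner x X j Z))) := by
  induction j generalizing Z f with
  | zero =>
    rw [hf.diagBlocks_eq]
    exact .refl
  | succ j ih =>
    have hmem : c (j + 1) ∉ c '' Set.Iic j := by
      rintro ⟨i, hi, h⟩
      rw [Set.mem_Iic] at hi
      exact hinj.ne (by simp; omega) (by simp) (by omega) h
    have hab : c (j + 1) ≠ c j := fun h => hmem ⟨j, by simp, h.symm⟩
    have h0 : c 0 ∈ c '' Set.Iic j := ⟨0, by simp, rfl⟩
    have hT' := identityOutside_mono (Set.singleton_subset_iff.2 h0) hT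
    have h := ih (fun i hi => hlt i (by omega)) (hinj.mono (Set.Iic_subset_Iic.2 (by omega)))
      (hf.update hinj (x • Z - X j))
    have ha := hlt (j + 1) le_rfl
    have hb := hlt j (by omega)
    have hfb := hf.apply_of_lt j (by omega)
    rw [chainLeft_succ, chainRight_succ]
    split_ifs
    · exact .swapFactor_mul hT' (chainLeft_mem j) (chainRight_mem j) h0 hmem ha hb hab
        hf.apply_last hfb h
    · exact .mul_swapFactor hT' (chainLeft_mem j) (chainRight_mem j) h0 hmem ha hb hab
        hf.apply_last hfb h

end Elimination

section Reduction

variable {m n r p s s' : ℕ} {S : Type*} [CommRing S] (A : ℕ → Matrix (Fin n) (Fin n) S)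

/-- The indices `j` for which the Fiedler matrix of index `j + 1 - m` stands on the left of the
matrix of index `-m` in `chainCoeff`. -/
def leftStep (p j : ℕ) : Bool := decide (p ≤ j ∧ Even (j - p))

/-- The part of `leadCoeff` that remains once the factors common to `leadCoeff` and `constCoeff`
are split off: the Fiedler matrices of all negative indices. -/
def chainCoeff (m : ℕ) (A : ℕ → Matrix (Fin n) (Fin n) S) (p j : ℕ) : BlockMatrix m n S :=
  chainLeft m id (fun i => A (m - 1 - i)) (leftStep p) j * diagFactor m 0 (A m) *
    chainRight m id (fun i => A (m - 1 - i)) (leftStep p) j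

lemma chainCoeff_zero : chainCoeff m A p 0 = diagFactor m 0 (A m) := by
  simp [chainCoeff, chainLeft, chainRight, descProd_zero, ascProd_zero]

lemma chainCoeff_succ (j : ℕ) : chainCoeff m A p (j + 1) =
    if leftStep p j then negFactor m A j * chainCoeff m A p j
    else chainCoeff m A p j * negFactor m A j := by
  rw [chainCoeff, chainLeft_succ, chainRight_succ]
  split_ifs <;> simp only [chainCoeff, negFactor, id, Matrix.mul_assoc]

lemma chainCoeff_eq_negString {j : ℕ} (hj : j ≤ p) : chainCoeff m A p j = negString m A j := by
  induction j with
  | zero => rw [chainCoeff_zero, negString, ascProd_zero, mul_one]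
  | succ j ih =>
    rw [chainCoeff_succ, if_neg (by simp [leftStep]; omega), ih (by omega), negString, negString,
      ascProd_succ, mul_assoc]

lemma chainCoeff_eq (i : ℕ) : chainCoeff m A p (p + 2 * i) =
    oddNeg m A p i * evenNeg m A p i * negString m A p := by
  induction i with
  | zero => simp [chainCoeff_eq_negString, oddNeg, evenNeg, descProd_zero]
  | succ i ih =>
    have hodd : oddNeg m A p (i + 1) = negFactor m A (p + 2 * i) * oddNeg m A p i :=
      descProd_succ _ _
    have heven : evenNeg m A p (i + 1) = negFactor m A (p + 1 + 2 * i) * evenNeg m A p i :=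
      descProd_succ _ _
    have hcomm : Commute (negFactor m A (p + 1 + 2 * i)) (evenNeg m A p i * negString m A p) :=
      commute_of_disjoint (negFactor_mem _ (T := Set.Ici (p + 1 + 2 * i)) (by simp) (by simp))
        (mul_mem (identityOutside_mono Set.Ico_subset_Iio_self evenNeg_mem)
          (identityOutside_mono (Set.Iio_subset_Iio (by omega)) (negString_mem p)))
        (Set.Iio_disjoint_Ici le_rfl).symm
    rw [show p + 2 * (i + 1) = p + 2 * i + 1 + 1 by ring, chainCoeff_succ,
      if_neg (by simp [leftStep, show p + 2 * i + 1 - p = 2 * i + 1 by omega]), chainCoeff_succ,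
      if_pos (by simp [leftStep]), ih, hodd, heven, show p + 2 * i + 1 = p + 1 + 2 * i by ring]
    simp only [mul_assoc, ← hcomm.eq]

lemma oddPos_mul_evenPos_mul_oddNeg_mul_evenNeg (hm : p + 2 * s' + 2 * s + 1 = m) :
    oddPos m A s * evenPos m A s * (oddNeg m A p (s' + s) * evenNeg m A p (s' + s)) =
      oddNeg m A p s' * evenNeg m A p s' := by
  simp only [← descProd_posFactor_mul (show 2 * s + 1 ≤ m by omega), ← descProd_negFactor_mul]
  refine descProd_mul_descProd_eq fun i hi => ?_
  rw [show m - 3 - 2 * i = p + 2 * (s' + s - 1 - i) by omega,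
    show m - 2 - 2 * i = p + 1 + 2 * (s' + s - 1 - i) by omega, mul_assoc,
    ← mul_assoc (posFactor m A (p + 2 * _)), posFactor_mul_negFactor (by omega), one_mul,
    posFactor_mul_negFactor (by omega)]

lemma leadCoeff_eq_mul_chainCoeff_mul (hm : p + 2 * s' + 2 * s + 1 = m) :
    leadCoeff m A p s' s = oddPos m A s * evenPos m A s * chainCoeff m A p (m - 1) *
      (oddPos m A s * (oddNeg m A p s' * hankelFactor m A p)) := by
  rw [show m - 1 = p + 2 * (s' + s) by omega, chainCoeff_eq, leadCoeff,
    ← oddPos_mul_evenPos_mul_oddNeg_mul_evenNeg A hm]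
  simp only [mul_assoc]

variable {A}

lemma isUnit_oddPos_mul_oddNeg_mul_hankelFactor (hm : p + 2 * s' + 2 * s + 1 = m)
    (hA : IsUnit (A m) ∨ p = 0) :
    IsUnit (oddPos m A s * (oddNeg m A p s' * hankelFactor m A p)) := by
  refine (isUnit_oddPos (by omega)).mul ((isUnit_oddNeg (by omega)).mul ?_)
  rcases hA with hA | rfl
  · exact isUnit_hankelFactor hA (by omega)
  · exact isUnit_one

lemma chainLeft_mul_chainLeft_eq_one :
    chainLeft m (m - 1 - ·) (fun i => -A (i + 1)) (fun i => leftStep p (m - 2 - i)) (m - 1) *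
      chainLeft m id (fun i => A (m - 1 - i)) (leftStep p) (m - 1) = 1 := by
  refine descProd_mul_descProd_eq_one fun i hi => ?_
  rw [show m - 1 - 1 - i = m - 2 - i by omega]
  simp only [id]
  split_ifs
  · rw [show m - 1 - (i + 1) = m - 2 - i by omega, show m - 1 - i = m - 2 - i + 1 by omega,
      show m - 1 - (m - 2 - i) = i + 1 by omega, ← neg_neg (A (i + 1)), neg_neg (-A (i + 1))]
    exact swapFactor_mul_swapFactor (by omega) (by omega) (by omega) _
  · exact one_mul 1

lemma chainRight_mul_chainRight_eq_one :
    chainRight m id (fun i => A (m - 1 - i)) (leftStep p) (m - 1) *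
      chainRight m (m - 1 - ·) (fun i => -A (i + 1)) (fun i => leftStep p (m - 2 - i)) (m - 1) =
      1 := by
  refine ascProd_mul_ascProd_eq_one fun i hi => ?_
  rw [show m - 1 - 1 - i = m - 2 - i by omega]
  simp only [id]
  split_ifs
  · exact one_mul 1
  · rw [show m - 1 - (i + 1) = m - 2 - i by omega, show m - 1 - i = m - 2 - i + 1 by omega,
      show m - 1 - (m - 2 - i) = i + 1 by omega]
    exact swapFactor_mul_swapFactor (by omega) (by omega) (by omega) _

lemma diagBlocks_update_two_sub (a : ℕ) (Y Z : Matrix (Fin n) (Fin n) S) :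
    diagBlocks m (Function.update (fun _ => 2) a Y) - diagFactor m a Z =
      diagFactor m a (Y - Z) := by
  simp only [diagFactor_eq_diagBlocks, diagBlocks, ofBlocks_sub, Function.update_apply]
  refine ofBlocks_congr fun i _ j _ => ?_
  split_ifs
  · rfl
  · rw [← one_add_one_eq_two, add_sub_cancel_right]
  · rw [sub_zero]

lemma smul_diagFactor (x : S) (a : ℕ) (Y : Matrix (Fin n) (Fin n) S) :
    x • diagFactor m a Y = diagBlocks m (Function.update (fun _ => x • 1) a (x • Y)) := by
  ext i j
  simp only [diagFactor_eq_diagBlocks, diagBlocks, ofBlocks, Matrix.smul_apply, of_apply,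
    Function.update_apply]
  split_ifs <;> simp

theorem exists_reduction_finite (hm : 0 < m) (p : ℕ) (x : S) :
    ∃ U V : BlockMatrix m n S, IsUnit U ∧ IsUnit V ∧
      U * (x • chainCoeff m A p (m - 1) - diagFactor m (m - 1) (-A 0)) * V =
        diagFactor m (m - 1) (∑ i ∈ Finset.range (m + 1), x ^ i • A i) ∧
      U * singleBlock m (m - 1) (m - 1) 1 = singleBlock m (m - 1) (m - 1) 1 ∧
      singleBlock m (m - 1) (m - 1) 1 * V = singleBlock m (m - 1) (m - 1) 1 := by
  have hL := chainLeft_mul_chainLeft_eq_one (m := m) (p := p) (A := A)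
  have hR := chainRight_mul_chainRight_eq_one (m := m) (p := p) (A := A)
  set PL := chainLeft m (m - 1 - ·) (fun i => -A (i + 1)) (fun i => leftStep p (m - 2 - i)) (m - 1)
  set PR := chainRight m (m - 1 - ·) (fun i => -A (i + 1)) (fun i => leftStep p (m - 2 - i)) (m - 1)
  obtain ⟨U, V, hU, hV, hUV, hUL, hRV⟩ : EliminatesTo (m - 1) (diagFactor m (m - 1) (-A 0))
      (x • diagFactor m 0 (A m)) PL PR (diagBlocks m (Function.update (fun _ => 2) (m - 1)
        (x • horner x (fun i => -A (i + 1)) (m - 1) (A m)))) := by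
    rw [smul_diagFactor]
    exact eliminatesTo_chain (c := (m - 1 - ·)) (diagFactor_mem _ _) (fun i _ => by omega)
      (fun i hi j hj h => by simp at hi hj h; omega)
      ⟨fun i hi => Function.update_of_ne (by omega) _ _, by simp,
        fun k hk hkc => absurd ⟨m - 1 - k, by simp; omega⟩ hkc⟩
  have hsum : x • horner x (fun i => -A (i + 1)) (m - 1) (A m) - -A 0 =
      ∑ i ∈ Finset.range (m + 1), x ^ i • A i := by
    obtain ⟨k, rfl⟩ : ∃ k, m = k + 1 := ⟨m - 1, by omega⟩
    simp only [smul_horner, smul_neg, Finset.sum_neg_distrib, sub_neg_eq_add, Nat.add_sub_cancel]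
    rw [Finset.sum_range_succ, Finset.sum_range_succ', pow_zero, one_smul]
    abel
  refine ⟨U * PL, PR * V, hU.mul (.of_mul_eq_one _ hL),
    (IsUnit.of_mul_eq_one _ (mul_eq_one_comm.1 hR)).mul hV, ?_, hUL, hRV⟩
  rw [← hsum, ← diagBlocks_update_two_sub, ← hUV, chainCoeff]
  set NL := chainLeft m id (fun i => A (m - 1 - i)) (leftStep p) (m - 1)
  set NR := chainRight m id (fun i => A (m - 1 - i)) (leftStep p) (m - 1)
  have hcancel : PL * (NL * diagFactor m 0 (A m) * NR) * PR = diagFactor m 0 (A m) := by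
    rw [← mul_assoc, ← mul_assoc, hL, one_mul, mul_assoc, hR, mul_one]
  calc _ = U * (x • (PL * (NL * diagFactor m 0 (A m) * NR) * PR) -
        PL * diagFactor m (m - 1) (-A 0) * PR) * V := by
        simp only [mul_sub, sub_mul, mul_smul_comm, smul_mul_assoc, mul_assoc]
    _ = _ := by rw [hcancel]

end Reduction

section Reduction

variable {m n r p s s' : ℕ} {S : Type*} [CommRing S] {A : ℕ → Matrix (Fin n) (Fin n) S}

lemma swapFactor_mul_diagFactor_mul_swapFactor {a b : ℕ} (ha : a < m) (hb : b < m) (hab : a ≠ b)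
    (Y : Matrix (Fin n) (Fin n) S) :
    swapFactor m a b 0 * diagFactor m a Y * swapFactor m a b 0 = diagFactor m b Y := by
  simp only [swapFactor, diagFactor, Matrix.mul_add, Matrix.add_mul, Matrix.mul_sub,
    Matrix.sub_mul, Matrix.mul_one, Matrix.one_mul, singleBlock_mul_singleBlock _ _ ha,
    singleBlock_mul_singleBlock _ _ hb, singleBlock_mul_singleBlock_of_ne hab,
    singleBlock_mul_singleBlock_of_ne hab.symm, singleBlock_zero, Matrix.mul_zero,
    Matrix.zero_mul]
  abel

lemma exists_neg_diagFactor_eq (hm : 0 < m) (Y : Matrix (Fin n) (Fin n) S) :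
    ∃ U V : BlockMatrix m n S, IsUnit U ∧ IsUnit V ∧
      U * -diagFactor m 0 Y * V = diagFactor m (m - 1) (-Y) := by
  have hneg : -diagFactor m 0 (-1 : Matrix (Fin n) (Fin n) S) * -diagFactor m 0 Y =
      diagFactor m 0 (-Y) := by
    rw [neg_mul_neg, diagFactor_mul_diagFactor hm, neg_one_mul]
  have hunit : IsUnit (-diagFactor m 0 (-1 : Matrix (Fin n) (Fin n) S)) :=
    IsUnit.neg (isUnit_diagFactor hm (IsUnit.neg isUnit_one))
  rcases Nat.eq_zero_or_pos (m - 1) with hm1 | hm1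
  · exact ⟨_, 1, hunit, isUnit_one, by rw [mul_one, hneg, hm1]⟩
  · have hswap := isUnit_swapFactor (n := n) (S := S) hm (Nat.sub_lt hm one_pos) hm1.ne 0
    refine ⟨swapFactor m 0 (m - 1) 0 * -diagFactor m 0 (-1), swapFactor m 0 (m - 1) 0,
      hswap.mul hunit, hswap, ?_⟩
    rw [mul_assoc _ (-diagFactor m 0 (-1)), hneg,
      swapFactor_mul_diagFactor_mul_swapFactor hm (Nat.sub_lt hm one_pos) hm1.ne]

theorem exists_reduction_infinite (hm : 0 < m) (p : ℕ) (x : S) (Z : Matrix (Fin n) (Fin n) S) :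
    ∃ U V : BlockMatrix m n S, IsUnit U ∧ IsUnit V ∧
      U * (chainCoeff m A p (m - 1) - x • diagFactor m (m - 1) Z) * V =
        diagFactor m (m - 1) (∑ i ∈ Finset.range m, x ^ i • A (m - i) - x ^ m • Z) := by
  obtain ⟨U, V, hU, hV, hUV, -, -⟩ : EliminatesTo 0 (diagFactor m 0 (A m))
      (x • diagFactor m (m - 1) Z) (chainLeft m id (fun i => A (m - 1 - i)) (leftStep p) (m - 1))
      (chainRight m id (fun i => A (m - 1 - i)) (leftStep p) (m - 1))
      (diagBlocks m (Function.update (fun _ => 2) 0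
        (x • horner x (fun i => A (m - 1 - i)) (m - 1) Z))) := by
    rw [smul_diagFactor]
    exact eliminatesTo_chain (c := id) (diagFactor_mem _ _) (fun i hi => by simp; omega)
      (Set.injOn_id _) ⟨fun i hi => Function.update_of_ne (by simp; omega) _ _, by simp,
        fun k hk hkc => absurd ⟨k, by simp; omega⟩ hkc⟩
  rw [diagBlocks_update_two_sub] at hUV
  obtain ⟨U', V', hU', hV', hUV'⟩ := exists_neg_diagFactor_eq hm
    (x • horner x (fun i => A (m - 1 - i)) (m - 1) Z - A m)
  have hsum : ∑ i ∈ Finset.range m, x ^ i • A (m - i) - x ^ m • Z =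
      -(x • horner x (fun i => A (m - 1 - i)) (m - 1) Z - A m) := by
    obtain ⟨k, rfl⟩ : ∃ k, m = k + 1 := ⟨m - 1, by omega⟩
    rw [smul_horner, Finset.sum_range_succ', pow_zero, one_smul]
    simp only [Nat.add_sub_cancel, Nat.add_sub_add_right, Nat.sub_zero]
    abel
  refine ⟨U' * U, V * V', hU'.mul hU, hV.mul hV', ?_⟩
  rw [hsum, ← hUV', ← hUV, chainCoeff, ← neg_mul, ← mul_neg, neg_sub]
  simp only [mul_assoc]

lemma padIdentity_eq (M : Matrix (Fin n) (Fin n) S) : padIdentity m M = diagFactor m (m - 1) M := by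
  ext ⟨i, k⟩ ⟨j, l⟩
  have hlast : ∀ a : Fin m, (a : ℕ) + 1 = m ↔ (a : ℕ) = m - 1 := fun a => by omega
  simp only [diagFactor_eq_diagBlocks, diagBlocks, ofBlocks, padIdentity, of_apply,
    Prod.mk.injEq, Function.update_apply, hlast]
  by_cases hij : i = j
  · subst hij
    by_cases hi : (i : ℕ) = m - 1 <;> simp [hi, one_apply]
  · have hij' : (i : ℕ) ≠ j := fun h => hij (Fin.ext h)
    have hne : ¬((i : ℕ) = m - 1 ∧ (j : ℕ) = m - 1) := fun h => hij' (h.1.trans h.2.symm)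
    simp [hij, hij', hne]

lemma singleBlock_one_mul_blockCol (hm : 0 < m) (C : Matrix (Fin n) (Fin r) S) :
    singleBlock m (m - 1) (m - 1) (1 : Matrix (Fin n) (Fin n) S) * blockCol m (m : ℤ) C =
      blockCol m (m : ℤ) C := by
  rw [show (m : ℤ) = ((m - 1 : ℕ) : ℤ) + 1 by omega, singleBlock_mul_blockCol (by omega),
    Matrix.one_mul]

lemma blockRow_mul_singleBlock_one (hm : 0 < m) (B : Matrix (Fin r) (Fin n) S) :
    blockRow m (m : ℤ) B * singleBlock m (m - 1) (m - 1) (1 : Matrix (Fin n) (Fin n) S) =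
      blockRow m (m : ℤ) B := by
  rw [blockRow_eq_transpose, ← transpose_one, ← singleBlock_transpose, ← transpose_mul,
    singleBlock_one_mul_blockCol hm]

lemma blockCol_mul_mul_blockRow (hm : 0 < m) (C : Matrix (Fin n) (Fin r) S)
    (D : Matrix (Fin r) (Fin r) S) (B : Matrix (Fin r) (Fin n) S) :
    blockCol m (m : ℤ) C * D * blockRow m (m : ℤ) B =
      singleBlock m (m - 1) (m - 1) (C * D * B) := by
  ext i j
  have hlast : ∀ l : Fin m, ((l : ℕ) : ℤ) + 1 = m ↔ (l : ℕ) = m - 1 := fun l => by omega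
  simp only [mul_apply, blockCol, blockRow, singleBlock, ofBlocks, of_apply, hlast]
  by_cases h : (i.1 : ℕ) = m - 1 <;> by_cases h' : (j.1 : ℕ) = m - 1 <;> simp [h, h', mul_apply]

lemma scalarBlocks_mul_blockCol (d : ℕ → S) {k : ℕ} (hk : k < m) (C : Matrix (Fin n) (Fin r) S) :
    scalarBlocks m n d * blockCol m ((k : ℤ) + 1) C = d k • blockCol m ((k : ℤ) + 1) C := by
  have hblock : singleBlock m k k (1 : Matrix (Fin n) (Fin n) S) * blockCol m ((k : ℤ) + 1) C =
      blockCol m ((k : ℤ) + 1) C := by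
    rw [singleBlock_mul_blockCol hk, Matrix.one_mul]
  rw [← hblock, ← Matrix.mul_assoc, scalarBlocks_mul_singleBlock, singleBlock_smul,
    Matrix.smul_mul]

variable {d : ℕ → S}

lemma isUnit_scalarBlocks (hd : d * d = 1) : IsUnit (scalarBlocks m n d) :=
  IsUnit.of_mul_eq_one _ <| by
    rw [scalarBlocks_mul_scalarBlocks, hd, scalarBlocks]
    simp only [Pi.one_apply, one_smul, diagBlocks_one]

lemma exists_factorization (hm : p + 2 * s' + 2 * s + 1 = m) (hA : IsUnit (A m) ∨ p = 0)
    (hd : d * d = 1) (hdk : d (m - 1 - min s 1) = 1) (C : Matrix (Fin n) (Fin r) S)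
    (B : Matrix (Fin r) (Fin n) S) :
    ∃ W N : (BlockMatrix m n S)ˣ,
      scalarBlocks m n d * leadCoeff m A p s' s = W * chainCoeff m A p (m - 1) * N ∧
      scalarBlocks m n d * constCoeff m A p s' s = W * diagFactor m (m - 1) (-A 0) * N ∧
      blockCol m ((m : ℤ) - (min s 1 : ℕ)) C = W.val * blockCol m (m : ℤ) C ∧
      blockRow m ((m : ℤ) - (min s 1 : ℕ)) B = blockRow m (m : ℤ) B * N.val := by
  obtain ⟨W, hW⟩ := (isUnit_scalarBlocks (m := m) (n := n) hd).mul <|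
    (isUnit_oddPos (A := A) (show 2 * s + 1 ≤ m by omega)).mul
      (isUnit_evenPos (A := A) (show 2 * s + 1 ≤ m by omega))
  obtain ⟨N, hN⟩ := isUnit_oddPos_mul_oddNeg_mul_hankelFactor hm hA
  refine ⟨W, N, ?_, ?_, ?_, ?_⟩
  · rw [leadCoeff_eq_mul_chainCoeff_mul A hm, hW, hN]
    simp only [mul_assoc]
  · rw [constCoeff, hW, hN]
    simp only [mul_assoc]
  · rw [hW, Matrix.mul_assoc, oddPos_mul_evenPos_mul_blockCol (by omega),
      show (m : ℤ) - (min s 1 : ℕ) = ((m - 1 - min s 1 : ℕ) : ℤ) + 1 by omega,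
      scalarBlocks_mul_blockCol d (by omega), hdk, one_smul]
  · rw [hN, blockRow_mul_oddPos_mul_oddNeg hm]

theorem exists_reduction_pencil_finite (hm : p + 2 * s' + 2 * s + 1 = m)
    (hA : IsUnit (A m) ∨ p = 0) (hd : d * d = 1) (hdk : d (m - 1 - min s 1) = 1)
    (C : Matrix (Fin n) (Fin r) S) (B : Matrix (Fin r) (Fin n) S) (x : S) :
    ∃ U V : BlockMatrix m n S, IsUnit U ∧ IsUnit V ∧
      U * (x • (scalarBlocks m n d * leadCoeff m A p s' s) -
        scalarBlocks m n d * constCoeff m A p s' s) * V =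
        diagFactor m (m - 1) (∑ i ∈ Finset.range (m + 1), x ^ i • A i) ∧
      U * blockCol m ((m : ℤ) - (min s 1 : ℕ)) C = blockCol m (m : ℤ) C ∧
      blockRow m ((m : ℤ) - (min s 1 : ℕ)) B * V = blockRow m (m : ℤ) B := by
  have hm0 : 0 < m := by omega
  obtain ⟨U, V, hU, hV, hUV, hUE, hEV⟩ := exists_reduction_finite (A := A) hm0 p x
  obtain ⟨W, N, hlead, hconst, hcol, hrow⟩ := exists_factorization hm hA hd hdk C B
  refine ⟨U * W⁻¹.val, N⁻¹.val * V, hU.mul W⁻¹.isUnit, N⁻¹.isUnit.mul hV, ?_, ?_, ?_⟩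
  · have hpencil : x • (W.val * chainCoeff m A p (m - 1) * N.val) -
        W.val * diagFactor m (m - 1) (-A 0) * N.val =
        W.val * (x • chainCoeff m A p (m - 1) - diagFactor m (m - 1) (-A 0)) * N.val := by
      simp only [mul_sub, sub_mul, mul_smul_comm, smul_mul_assoc]
    rw [hlead, hconst, hpencil, ← hUV]
    simp only [mul_assoc, Units.inv_mul_cancel_left, Units.mul_inv_cancel_left]
  · rw [hcol, Matrix.mul_assoc, ← Matrix.mul_assoc _ W.val, W.inv_mul, Matrix.one_mul,
      ← singleBlock_one_mul_blockCol hm0, ← Matrix.mul_assoc, hUE]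
  · rw [hrow, ← Matrix.mul_assoc, Matrix.mul_assoc _ N.val, N.mul_inv, Matrix.mul_one,
      ← blockRow_mul_singleBlock_one hm0, Matrix.mul_assoc, hEV]

theorem exists_reduction_pencil_infinite (hm : p + 2 * s' + 2 * s + 1 = m)
    (hA : IsUnit (A m) ∨ p = 0) (hd : d * d = 1) (hdk : d (m - 1 - min s 1) = 1)
    (C : Matrix (Fin n) (Fin r) S) (B : Matrix (Fin r) (Fin n) S) (x : S)
    (D : Matrix (Fin r) (Fin r) S) :
    ∃ U V : BlockMatrix m n S, IsUnit U ∧ IsUnit V ∧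
      U * (scalarBlocks m n d * leadCoeff m A p s' s -
        x • (scalarBlocks m n d * constCoeff m A p s' s) +
        x • (blockCol m ((m : ℤ) - (min s 1 : ℕ)) C * D *
          blockRow m ((m : ℤ) - (min s 1 : ℕ)) B)) * V =
        diagFactor m (m - 1)
          (∑ i ∈ Finset.range (m + 1), x ^ i • A (m - i) + x ^ m • (C * D * B)) := by
  have hm0 : 0 < m := by omega
  obtain ⟨U, V, hU, hV, hUV⟩ := exists_reduction_infinite (A := A) hm0 p x (-A 0 - C * D * B)
  obtain ⟨W, N, hlead, hconst, hcol, hrow⟩ := exists_factorization hm hA hd hdk C B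
  refine ⟨U * W⁻¹.val, N⁻¹.val * V, hU.mul W⁻¹.isUnit, N⁻¹.isUnit.mul hV, ?_⟩
  have hblock : W.val * blockCol m (m : ℤ) C * D * (blockRow m (m : ℤ) B * N.val) =
      W.val * singleBlock m (m - 1) (m - 1) (C * D * B) * N.val := by
    rw [← blockCol_mul_mul_blockRow hm0]
    simp only [Matrix.mul_assoc]
  have hpencil : W.val * chainCoeff m A p (m - 1) * N.val -
      x • (W.val * diagFactor m (m - 1) (-A 0) * N.val) +
      x • (W.val * singleBlock m (m - 1) (m - 1) (C * D * B) * N.val) =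
      W.val * (chainCoeff m A p (m - 1) - x • diagFactor m (m - 1) (-A 0 - C * D * B)) *
        N.val := by
    simp only [diagFactor, singleBlock_sub, smul_sub, smul_add, mul_sub, mul_add, sub_mul, add_mul,
      mul_smul_comm, smul_mul_assoc]
    abel
  rw [hlead, hconst, hcol, hrow, hblock, hpencil, Finset.sum_range_succ, Nat.sub_self,
    show ∀ M : Matrix (Fin n) (Fin n) S, M + x ^ m • A 0 + x ^ m • (C * D * B) =
      M - x ^ m • (-A 0 - C * D * B) by intro M; module, ← hUV]
  simp only [mul_assoc, Units.inv_mul_cancel_left, Units.mul_inv_cancel_left]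

end Reduction

/-! ### Proper rational functions -/

section ProperRational

open Filter Bornology Topology

lemma eventually_denom_ne_zero (f : RatFunc ℂ) :
    ∀ᶠ z in cobounded ℂ, f.denom.eval₂ (RingHom.id ℂ) z ≠ 0 := by
  have h : {z : ℂ | f.denom.IsRoot z}.Finite := Polynomial.finite_setOfPred_isRoot f.denom_ne_zero
  filter_upwards [isBounded_def.1 h.isBounded] with z hz hz'
  exact hz hz'

lemma eventually_eval_add (f g : RatFunc ℂ) : ∀ᶠ z in cobounded ℂ,
    (f + g).eval (RingHom.id ℂ) z = f.eval (RingHom.id ℂ) z + g.eval (RingHom.id ℂ) z := by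
  filter_upwards [eventually_denom_ne_zero f, eventually_denom_ne_zero g] with z hf hg
  exact RatFunc.eval_add _ _ hf hg

lemma eventually_eval_mul (f g : RatFunc ℂ) : ∀ᶠ z in cobounded ℂ,
    (f * g).eval (RingHom.id ℂ) z = f.eval (RingHom.id ℂ) z * g.eval (RingHom.id ℂ) z := by
  filter_upwards [eventually_denom_ne_zero f, eventually_denom_ne_zero g] with z hf hg
  exact RatFunc.eval_mul _ _ hf hg

/-- `f(z) → a` as `z → ∞`. -/
def HasLimitAtInfinity (f : RatFunc ℂ) (a : ℂ) : Prop :=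
  Tendsto (fun z : ℂ => f.eval (RingHom.id ℂ) z) (cobounded ℂ) (𝓝 a)

lemma HasLimitAtInfinity.add {f g : RatFunc ℂ} {a b : ℂ} (hf : HasLimitAtInfinity f a)
    (hg : HasLimitAtInfinity g b) : HasLimitAtInfinity (f + g) (a + b) :=
  (Tendsto.add hf hg).congr' ((eventually_eval_add f g).mono fun _ h => h.symm)

lemma HasLimitAtInfinity.mul {f g : RatFunc ℂ} {a b : ℂ} (hf : HasLimitAtInfinity f a)
    (hg : HasLimitAtInfinity g b) : HasLimitAtInfinity (f * g) (a * b) :=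
  (Tendsto.mul hf hg).congr' ((eventually_eval_mul f g).mono fun _ h => h.symm)

lemma hasLimitAtInfinity_C (a : ℂ) : HasLimitAtInfinity (RatFunc.C a) a := by
  simp only [HasLimitAtInfinity, RatFunc.eval_C, RingHom.id_apply, tendsto_const_nhds]

lemma eventually_eval_inv {f : RatFunc ℂ} (hf : f ≠ 0) : ∀ᶠ z in cobounded ℂ,
    (f⁻¹).eval (RingHom.id ℂ) z = (f.eval (RingHom.id ℂ) z)⁻¹ := by
  filter_upwards [eventually_eval_mul f f⁻¹] with z hz
  rw [mul_inv_cancel₀ hf, RatFunc.eval_one] at hz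
  exact eq_inv_of_mul_eq_one_right hz.symm

lemma HasLimitAtInfinity.inv {f : RatFunc ℂ} {a : ℂ} (hf : HasLimitAtInfinity f a) (ha : a ≠ 0) :
    HasLimitAtInfinity f⁻¹ a⁻¹ := by
  have h0 : f ≠ 0 := by
    rintro rfl
    have h := hasLimitAtInfinity_C 0
    rw [map_zero] at h
    exact ha (tendsto_nhds_unique hf h)
  exact (Tendsto.inv₀ hf ha).congr' ((eventually_eval_inv h0).mono fun _ h => h.symm)

lemma hasLimitAtInfinity_X_inv : HasLimitAtInfinity RatFunc.X⁻¹ 0 := by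
  refine tendsto_inv₀_cobounded.congr' ((eventually_eval_inv RatFunc.X_ne_zero).mono fun z h => ?_)
  simp only [h, RatFunc.eval_X]

/-- The ring of proper rational functions. -/
def properRing : Subring (RatFunc ℂ) where
  carrier := {f | ∃ a, HasLimitAtInfinity f a}
  mul_mem' := fun ⟨a, ha⟩ ⟨b, hb⟩ => ⟨a * b, ha.mul hb⟩
  one_mem' := ⟨1, by simpa using hasLimitAtInfinity_C 1⟩
  add_mem' := fun ⟨a, ha⟩ ⟨b, hb⟩ => ⟨a + b, ha.add hb⟩
  zero_mem' := ⟨0, by simpa using hasLimitAtInfinity_C 0⟩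
  neg_mem' := fun {f} ⟨a, ha⟩ => ⟨-1 * a, by
    simpa only [map_neg, map_one, neg_one_mul] using (hasLimitAtInfinity_C (-1)).mul ha⟩

/-- The value of a proper rational function at infinity. -/
def valueAtInfinity (f : properRing) : ℂ := f.2.choose

lemma hasLimitAtInfinity_value (f : properRing) : HasLimitAtInfinity f (valueAtInfinity f) :=
  f.2.choose_spec

lemma valueAtInfinity_eq {f : properRing} {a : ℂ} (h : HasLimitAtInfinity f a) :
    valueAtInfinity f = a := tendsto_nhds_unique (hasLimitAtInfinity_value f) h

/-- The value at infinity as a ring homomorphism. -/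
def evalAtInfinity : properRing →+* ℂ where
  toFun := valueAtInfinity
  map_one' := valueAtInfinity_eq (by simpa using hasLimitAtInfinity_C 1)
  map_mul' f g := valueAtInfinity_eq
    ((hasLimitAtInfinity_value f).mul (hasLimitAtInfinity_value g))
  map_zero' := valueAtInfinity_eq (by simpa using hasLimitAtInfinity_C 0)
  map_add' f g := valueAtInfinity_eq
    ((hasLimitAtInfinity_value f).add (hasLimitAtInfinity_value g))

/-- The constants as proper rational functions. -/
def properC : ℂ →+* properRing where
  toFun a := ⟨RatFunc.C a, a, hasLimitAtInfinity_C a⟩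
  map_one' := Subtype.ext (map_one _)
  map_mul' a b := Subtype.ext (map_mul _ a b)
  map_zero' := Subtype.ext (map_zero _)
  map_add' a b := Subtype.ext (map_add _ a b)

/-- The proper rational function `1 / x`. -/
def properXInv : properRing := ⟨RatFunc.X⁻¹, 0, hasLimitAtInfinity_X_inv⟩

lemma evalAtInfinity_properC (a : ℂ) : evalAtInfinity (properC a) = a :=
  valueAtInfinity_eq (hasLimitAtInfinity_C a)

lemma evalAtInfinity_properXInv : evalAtInfinity properXInv = 0 :=
  valueAtInfinity_eq hasLimitAtInfinity_X_inv

lemma isUnit_of_evalAtInfinity_ne_zero {f : properRing} (h : evalAtInfinity f ≠ 0) :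
    IsUnit f := by
  have hf := hasLimitAtInfinity_value f
  refine IsUnit.of_mul_eq_one ⟨(f : RatFunc ℂ)⁻¹, _, hf.inv h⟩ (Subtype.ext ?_)
  refine mul_inv_cancel₀ fun h0 => h ?_
  have : f = 0 := Subtype.ext h0
  rw [this, map_zero]

lemma isBiproper_of_isUnit {ι : Type*} [Fintype ι] [DecidableEq ι] {U : Matrix ι ι properRing}
    (hU : IsUnit U) : IsBiproper (U.map properRing.subtype) := by
  refine ⟨U.map evalAtInfinity, ?_, fun i j => hasLimitAtInfinity_value (U i j)⟩
  rw [← RingHom.mapMatrix_apply, ← RingHom.map_det]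
  exact ((isUnit_iff_isUnit_det U).1 hU).map evalAtInfinity

lemma isUnimodular_of_isUnit {ι : Type*} [Fintype ι] [DecidableEq ι] {U : Matrix ι ι ℂ[X]}
    (hU : IsUnit U) : IsUnimodular U := by
  obtain ⟨c, hc, h⟩ := Polynomial.isUnit_iff.1 ((isUnit_iff_isUnit_det U).1 hU)
  exact ⟨c, hc.ne_zero, h.symm⟩

lemma exists_resolvent {r : ℕ} {E : Matrix (Fin r) (Fin r) ℂ} (hE : IsUnit E.det)
    (A : Matrix (Fin r) (Fin r) ℂ) : ∃ W : Matrix (Fin r) (Fin r) properRing,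
      ((RatFunc.X : RatFunc ℂ) • E.map RatFunc.C - A.map RatFunc.C)⁻¹ =
        W.map properRing.subtype := by
  have hX : (RatFunc.X : RatFunc ℂ) * RatFunc.X⁻¹ = 1 := mul_inv_cancel₀ RatFunc.X_ne_zero
  set M : Matrix (Fin r) (Fin r) properRing := E.map properC - properXInv • A.map properC with hM
  have hdet : IsUnit M := by
    rw [isUnit_iff_isUnit_det]
    refine isUnit_of_evalAtInfinity_ne_zero ?_
    have : M.map evalAtInfinity = E := by
      ext i j
      simp [hM, evalAtInfinity_properC, evalAtInfinity_properXInv]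
    rw [RingHom.map_det, RingHom.mapMatrix_apply, this]
    exact hE.ne_zero
  obtain ⟨u, hu⟩ := hdet
  refine ⟨properXInv • (u⁻¹).val, Matrix.inv_eq_right_inv ?_⟩
  have h1 : (RatFunc.X : RatFunc ℂ) • E.map RatFunc.C - A.map RatFunc.C =
      (RatFunc.X : RatFunc ℂ) • M.map properRing.subtype := by
    ext i j
    simp only [hM, Matrix.sub_apply, Matrix.smul_apply, map_apply, smul_eq_mul, map_sub, map_mul]
    change _ = RatFunc.X * (RatFunc.C (E i j) - RatFunc.X⁻¹ * RatFunc.C (A i j))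
    rw [mul_sub, ← mul_assoc, hX, one_mul]
  have h2 : (properXInv • (u⁻¹).val).map properRing.subtype =
      (RatFunc.X : RatFunc ℂ)⁻¹ • (u⁻¹).val.map properRing.subtype := by
    ext i j
    rfl
  rw [h1, h2, Matrix.smul_mul, Matrix.mul_smul, smul_smul, hX, one_smul, ← Matrix.map_mul, ← hu,
    u.mul_inv, Matrix.map_one _ (map_zero _) (map_one _)]

end ProperRational

/-! ### Linearization -/

section Reversal

variable {ι : Type*} {m r : ℕ}

lemma sum_X_pow_smul_coeffMat {P : Matrix ι ι ℂ[X]} (hP : ∀ i j, (P i j).natDegree ≤ m) :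
    ∑ t ∈ Finset.range (m + 1), (Polynomial.X : ℂ[X]) ^ t • (coeffMat P t).map Polynomial.C =
      P := by
  ext1 i j
  rw [Matrix.sum_apply]
  conv_rhs => rw [(P i j).as_sum_range' (m + 1) (Nat.lt_succ_of_le (hP i j))]
  refine Finset.sum_congr rfl fun t _ => ?_
  rw [Matrix.smul_apply, map_apply, coeffMat, map_apply, smul_eq_mul, mul_comm,
    Polynomial.C_mul_X_pow_eq_monomial]

lemma map_properXInv_pow_smul {κ : Type*} (t : ℕ) (M : Matrix ι κ properRing) :
    (properXInv ^ t • M).map properRing.subtype =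
      ((RatFunc.X : RatFunc ℂ) ^ t)⁻¹ • M.map properRing.subtype := by
  ext1 i j
  rw [map_apply, Matrix.smul_apply, smul_eq_mul, map_mul, map_pow, ← inv_pow]
  rfl

lemma inv_X_pow_smul_map {P : Matrix ι ι ℂ[X]} (hP : ∀ i j, (P i j).natDegree ≤ m) :
    ((RatFunc.X : RatFunc ℂ) ^ m)⁻¹ • P.map (algebraMap ℂ[X] (RatFunc ℂ)) =
      (∑ t ∈ Finset.range (m + 1), properXInv ^ t • (coeffMat P (m - t)).map properC).map
        properRing.subtype := by
  have hX : (RatFunc.X : RatFunc ℂ) ≠ 0 := RatFunc.X_ne_zero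
  conv_lhs => rw [← sum_X_pow_smul_coeffMat hP, ← Finset.sum_range_reflect]
  ext1 i j
  simp only [Matrix.smul_apply, map_apply, Matrix.sum_apply, map_sum, smul_eq_mul, Finset.mul_sum]
  refine Finset.sum_congr rfl fun t ht => ?_
  have ht' : m + 1 - 1 - t + t = m := by have := Finset.mem_range.1 ht; omega
  have hpow : ((RatFunc.X : RatFunc ℂ) ^ m)⁻¹ * RatFunc.X ^ (m + 1 - 1 - t) = RatFunc.X⁻¹ ^ t := by
    rw [inv_pow, inv_mul_eq_iff_eq_mul₀ (pow_ne_zero _ hX),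
      eq_mul_inv_iff_mul_eq₀ (pow_ne_zero _ hX), ← pow_add, ht']
  rw [map_mul, map_pow, RatFunc.algebraMap_X, RatFunc.algebraMap_C, ← mul_assoc, hpow]
  rfl

lemma Realization.inv_X_pow_smul_transfer (R : Realization ι r)
    (hP : ∀ i j, (R.P i j).natDegree ≤ m) {W : Matrix (Fin r) (Fin r) properRing}
    (hW : ((RatFunc.X : RatFunc ℂ) • R.E.map RatFunc.C - R.A.map RatFunc.C)⁻¹ =
      W.map properRing.subtype) :
    ((RatFunc.X : RatFunc ℂ) ^ m)⁻¹ • R.transfer =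
      (∑ t ∈ Finset.range (m + 1), properXInv ^ t • (coeffMat R.P (m - t)).map properC +
        properXInv ^ m • (R.C.map properC * W * R.B.map properC)).map properRing.subtype := by
  rw [Matrix.map_add _ (map_add _), map_properXInv_pow_smul, ← inv_X_pow_smul_map hP,
    Matrix.map_mul, Matrix.map_mul, ← hW, ← smul_add]
  rfl

lemma natDegree_pencil_le (E A : Matrix ι ι ℂ) (i j : ι) : (pencil E A i j).natDegree ≤ 1 := by
  simp only [pencil, Matrix.sub_apply, Matrix.smul_apply, map_apply, smul_eq_mul]
  compute_degree

end Reversal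

section Linearization

variable {m n r p s s' : ℕ} {R : Realization (Fin n) r} {d : ℕ → ℂ}

lemma scalarBlocks_map {S S' : Type*} [CommRing S] [CommRing S'] (g : S →+* S') (d : ℕ → S) :
    (scalarBlocks m n d).map g = scalarBlocks m n (fun i => g (d i)) := by
  ext p q
  by_cases h : (p.1 : ℕ) = q.1 <;>
    simp [scalarBlocks, diagBlocks, ofBlocks, h, one_apply, apply_ite g]

lemma map_mul_self {S : Type*} [CommRing S] (g : ℂ →+* S) (hd : d * d = 1) :
    (fun i => g (d i)) * (fun i => g (d i)) = 1 := by
  ext i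
  have hi : d i * d i = 1 := congrFun hd i
  rw [Pi.mul_apply, ← map_mul, hi, map_one, Pi.one_apply]

/-- The pencil of the polynomial part, multiplied by `diag(d₁ I, …, d_m I)`. -/
def signedPencil (m : ℕ) {n : ℕ} (d : ℕ → ℂ) (P : Matrix (Fin n) (Fin n) ℂ[X]) (p s' s : ℕ) :
    Matrix (Fin m × Fin n) (Fin m × Fin n) ℂ[X] :=
  pencil (scalarBlocks m n d * leadCoeff m (coeffMat P) p s' s)
    (scalarBlocks m n d * constCoeff m (coeffMat P) p s' s)

lemma exists_isUnimodular_mul_systemMatrix (hdeg : ∀ i j, (R.P i j).natDegree ≤ m)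
    (hC : R.C = R.Bᵀ) (hm : p + 2 * s' + 2 * s + 1 = m)
    (hA : IsUnit (coeffMat R.P m) ∨ p = 0) (hd : d * d = 1) (hdk : d (m - 1 - min s 1) = 1) :
    ∃ U V : Matrix (Fin m × Fin n) (Fin m × Fin n) ℂ[X], IsUnimodular U ∧ IsUnimodular V ∧
      fromBlocks U 0 0 1 * (liftRealization m R ((m : ℤ) - (min s 1 : ℕ))
        (signedPencil m d R.P p s' s)).systemMatrix * fromBlocks V 0 0 1 = padSystem m R := by
  obtain ⟨U, V, hU, hV, hUV, hCol, hRow⟩ := exists_reduction_pencil_finite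
    (A := fun i => (coeffMat R.P i).map Polynomial.C) hm
    (hA.imp_left fun h => h.map Polynomial.C.mapMatrix) (map_mul_self Polynomial.C hd)
    ((congrArg Polynomial.C hdk).trans Polynomial.C_1) (R.C.map Polynomial.C)
    (R.B.map Polynomial.C) Polynomial.X
  refine ⟨U, V, isUnimodular_of_isUnit hU, isUnimodular_of_isUnit hV, ?_⟩
  have hPencil : signedPencil m d R.P p s' s = (Polynomial.X : ℂ[X]) •
      (scalarBlocks m n (fun i => Polynomial.C (d i)) *
        leadCoeff m (fun i => (coeffMat R.P i).map Polynomial.C) p s' s) -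
      scalarBlocks m n (fun i => Polynomial.C (d i)) *
        constCoeff m (fun i => (coeffMat R.P i).map Polynomial.C) p s' s := by
    simp only [signedPencil, pencil, Matrix.map_mul, scalarBlocks_map, leadCoeff_map,
      constCoeff_map]
  rw [← hPencil, sum_X_pow_smul_coeffMat hdeg] at hUV
  rw [padSystem, padIdentity_eq, ← hUV, ← hCol, ← hRow]
  simp only [Realization.systemMatrix, liftRealization, fromBlocks_multiply, ← hC, blockCol_map,
    blockRow_map, Matrix.mul_zero, Matrix.zero_mul, add_zero, zero_add, Matrix.mul_one,
    Matrix.one_mul]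

lemma exists_isBiproper_mul_transfer (hdeg : ∀ i j, (R.P i j).natDegree ≤ m)
    (hC : R.C = R.Bᵀ) (hm : p + 2 * s' + 2 * s + 1 = m)
    (hA : IsUnit (coeffMat R.P m) ∨ p = 0) (hd : d * d = 1) (hdk : d (m - 1 - min s 1) = 1) :
    ∃ U V : Matrix (Fin m × Fin n) (Fin m × Fin n) (RatFunc ℂ), IsBiproper U ∧ IsBiproper V ∧
      U * ((RatFunc.X : RatFunc ℂ)⁻¹ • (liftRealization m R ((m : ℤ) - (min s 1 : ℕ))
        (signedPencil m d R.P p s' s)).transfer) * V =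
        padIdentity m (((RatFunc.X : RatFunc ℂ) ^ m)⁻¹ • R.transfer) := by
  obtain ⟨W, hW⟩ := exists_resolvent R.isUnit_det_E R.A
  obtain ⟨U, V, hU, hV, hUV⟩ := exists_reduction_pencil_infinite
    (A := fun i => (coeffMat R.P i).map properC) hm
    (hA.imp_left fun h => h.map properC.mapMatrix) (map_mul_self properC hd)
    ((congrArg properC hdk).trans (map_one properC)) (R.C.map properC) (R.B.map properC)
    properXInv W
  refine ⟨_, _, isBiproper_of_isUnit hU, isBiproper_of_isUnit hV, ?_⟩
  have hLift := (liftRealization m R ((m : ℤ) - (min s 1 : ℕ))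
    (signedPencil m d R.P p s' s)).inv_X_pow_smul_transfer (m := 1) (natDegree_pencil_le _ _) hW
  rw [pow_one] at hLift
  rw [hLift, R.inv_X_pow_smul_transfer hdeg hW, padIdentity_eq, ← diagFactor_map, ← hUV,
    Matrix.map_mul, Matrix.map_mul]
  congr 3
  simp only [Finset.sum_range_succ, Finset.sum_range_zero, liftRealization, signedPencil,
    coeffMat_pencil_zero, coeffMat_pencil_one, ← hC, pow_zero, pow_one, one_smul, zero_add,
    Nat.sub_zero, Nat.sub_self, Matrix.map_neg _ (map_neg properC), Matrix.map_mul,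
    scalarBlocks_map, leadCoeff_map, constCoeff_map, blockCol_map, blockRow_map, smul_neg,
    sub_eq_add_neg]

theorem isRosenbrockStrongLinearization_liftRealization (hdeg : ∀ i j, (R.P i j).natDegree ≤ m)
    (hmin : R.IsMinimal) (hC : R.C = R.Bᵀ) (hm : p + 2 * s' + 2 * s + 1 = m)
    (hA : IsUnit (coeffMat R.P m) ∨ p = 0) (hd : d * d = 1) (hdk : d (m - 1 - min s 1) = 1) :
    IsRosenbrockStrongLinearization m R (liftRealization m R ((m : ℤ) - (min s 1 : ℕ))
      (signedPencil m d R.P p s' s)).systemMatrix := by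
  obtain ⟨U, V, hU, hV, hUV⟩ := exists_isUnimodular_mul_systemMatrix hdeg hC hm hA hd hdk
  refine ⟨_, rfl, ⟨-_, -_, ((congrArg Neg.neg (pencil_neg_neg _ _)).trans (neg_neg _)).symm⟩,
    isMinimal_liftRealization hmin hC ⟨m - 1 - min s 1, by omega⟩ (by push_cast; omega) _,
    ⟨U, V, 1, 1, hU, hV, by simp, by simp, ?_⟩,
    exists_isBiproper_mul_transfer hdeg hC hm hA hd hdk⟩
  rwa [Matrix.map_one _ Polynomial.C_0 Polynomial.C_1]

end Linearization

/-! ### Consecutive inversions of a simple admissible tuple -/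

section Inversions

variable {s : ℕ} {w l : List ℤ}

lemma IsAdmissible.eq_singleton_zero (hw : IsAdmissible 0 0 w) : w = [0] := by
  simpa [stringZero] using hw.2.2

lemma IsAdmissible.exists_eq_append (hw : IsAdmissible (2 * (s + 1)) 0 w) :
    ∃ l : List ℤ, w = l ++ [1, 2, 0] ∧ ∀ t ∈ l, 2 < t := by
  refine ⟨(List.range s).reverse.flatMap fun i : ℕ => [2 * (i : ℤ) + 3, 2 * (i : ℤ) + 4], ?_, ?_⟩
  · rw [hw.2.2, Nat.sub_zero, Nat.mul_div_cancel_left _ two_pos, bind_pure_natCast,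
      List.flatMap_map, List.range_succ_eq_map, List.reverse_cons, List.flatMap_append,
      ← List.map_reverse, List.flatMap_map, List.append_assoc]
    congr 1
    exact List.flatMap_congr fun i _ => by push_cast; ring_nf
  · intro t ht
    simp only [List.mem_flatMap, List.mem_cons, List.not_mem_nil, or_false] at ht
    obtain ⟨i, -, rfl | rfl⟩ := ht <;> omega

lemma not_sublist_append (hl : ∀ t ∈ l, 2 < t) : ¬List.Sublist [2, 1, 0] (l ++ [1, 2, 0]) := by
  intro h
  have hnil : l.filter (fun t => decide (t ≤ 2)) = [] :=
    List.filter_eq_nil_iff.2 fun t ht => by simpa using hl t ht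
  have hFilter := h.filter fun t => decide (t ≤ 2)
  rw [List.filter_append, hnil] at hFilter
  revert hFilter
  decide

lemma inversionsAt_zero_append (hl : ∀ t ∈ l, 2 < t) : inversionsAt 0 (l ++ [1, 2, 0]) = 1 := by
  rw [inversionsAt, if_pos (by simp), Nat.cast_eq_one, Nat.findGreatest_eq_iff]
  refine ⟨by simp, fun _ => ?_, fun k hk _ h => not_sublist_append hl (.trans ?_ h)⟩
  · refine .trans ?_ (List.sublist_append_right _ _)
    rw [bind_pure_natCast]
    decide
  · rw [bind_pure_natCast]
    exact ((List.range_sublist.2 (show 3 ≤ k + 1 by omega)).reverse.map fun i : ℕ => (i : ℤ)).map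
      fun i => 0 + i

lemma inversionsAt_zero_of_isAdmissible (hw : IsAdmissible (2 * s) 0 w) :
    inversionsAt 0 w = (min s 1 : ℕ) := by
  rcases s with _ | s
  · rw [hw.eq_singleton_zero]
    decide
  · obtain ⟨l, rfl, hl⟩ := hw.exists_eq_append
    rw [inversionsAt_zero_append hl, min_eq_right (by omega), Nat.cast_one]

end Inversions

/-! ### Sign changes of the system matrix -/

section SignChange

variable {m n r : ℕ} {R : Realization (Fin n) r} {k : Fin m} {j : ℤ} {ε δ : Fin m → ℤˣ}
  {L : Matrix (Fin m × Fin n) (Fin m × Fin n) ℂ[X]}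

lemma quasiIdentity_mul_blockCol (hk : ((k : ℕ) : ℤ) + 1 = j) (δ : Fin m → ℤˣ)
    (C : Matrix (Fin n) (Fin r) ℂ) :
    quasiIdentity n δ * (blockCol m j C).map Polynomial.C =
      (((δ k : ℤ) : ℂ) • blockCol m j C).map Polynomial.C := by
  rw [quasiIdentity_eq, ← Matrix.map_mul, ← hk, scalarBlocks_mul_blockCol _ k.2, signSeq,
    dif_pos k.2]

lemma quasiIdentityExt_mul_systemMatrix (hk : ((k : ℕ) : ℤ) + 1 = j) (δ : Fin m → ℤˣ) :
    quasiIdentityExt r (quasiIdentity n δ) * (liftRealization m R j L).systemMatrix =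
      fromBlocks (quasiIdentity n δ * L)
        ((((δ k : ℤ) : ℂ) • blockCol m j R.Bᵀ).map Polynomial.C)
        ((blockRow m j R.B).map Polynomial.C) (-pencil R.E R.A) := by
  simp only [quasiIdentityExt, Realization.systemMatrix, liftRealization, fromBlocks_multiply,
    quasiIdentity_mul_blockCol hk, Matrix.zero_mul, add_zero, zero_add, Matrix.one_mul]

lemma isTEven_quasiIdentityExt_mul_systemMatrix_iff (hk : ((k : ℕ) : ℤ) + 1 = j)
    (hEA : IsTEven (pencil R.E R.A)) :
    IsTEven (quasiIdentityExt r (quasiIdentity n δ) * (liftRealization m R j L).systemMatrix) ↔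
      IsTEven (quasiIdentity n δ * L) ∧
        ((δ k : ℤ) : ℂ) • blockCol m j R.Bᵀ = blockCol m j R.Bᵀ := by
  rw [quasiIdentityExt_mul_systemMatrix hk, isTEven_fromBlocks_iff, blockRow_eq_transpose,
    transpose_transpose, and_iff_left hEA.neg]

lemma eq_one_of_smul_blockCol_eq (hk : ((k : ℕ) : ℤ) + 1 = j) {C : Matrix (Fin n) (Fin r) ℂ}
    (hC : C ≠ 0) {u : ℤˣ} (h : ((u : ℤ) : ℂ) • blockCol m j C = blockCol m j C) : u = 1 := by
  refine (Int.units_eq_one_or u).resolve_right fun hu => hC ?_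
  ext a b
  have hab := congrFun (congrFun h (k, a)) b
  simp only [hu, Units.val_neg, Units.val_one, Int.cast_neg, Int.cast_one, neg_one_smul,
    Matrix.neg_apply, blockCol, of_apply, hk, if_true] at hab
  exact neg_eq_self.1 hab

lemma smul_quasiIdentityExt_mul_systemMatrix (hk : ((k : ℕ) : ℤ) + 1 = j) (δ : Fin m → ℤˣ) :
    quasiIdentityExt r (((δ k : ℤ) : ℂ[X]) • quasiIdentity n δ) *
        (liftRealization m R j L).systemMatrix =
      (liftRealization m R j (((δ k : ℤ) : ℂ[X]) • quasiIdentity n δ * L)).systemMatrix := by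
  rw [smul_quasiIdentity, quasiIdentityExt_mul_systemMatrix hk, Int.units_mul_self, Units.val_one,
    Int.cast_one, one_smul]
  rfl

namespace IsSignRigid

lemma eq_or_eq_neg (hL : IsSignRigid L ε) (hδ : IsTEven (quasiIdentity n δ * L)) :
    quasiIdentity n δ = quasiIdentity n ε ∨ quasiIdentity n δ = -quasiIdentity n ε := by
  obtain ⟨c, hc⟩ := hL.eq_mul δ hδ
  rw [funext hc, ← smul_quasiIdentity]
  rcases Int.units_eq_one_or c with rfl | rfl
  · exact .inl (by simp)
  · exact .inr (by simp)

lemma smul_quasiIdentity_eq (hL : IsSignRigid L ε) (hδ : IsTEven (quasiIdentity n δ * L))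
    (k : Fin m) : ((δ k : ℤ) : ℂ[X]) • quasiIdentity n δ =
      ((ε k : ℤ) : ℂ[X]) • quasiIdentity n ε := by
  obtain ⟨c, hc⟩ := hL.eq_mul δ hδ
  rw [smul_quasiIdentity, smul_quasiIdentity]
  congr 1
  ext1 i
  rw [hc, hc, mul_mul_mul_comm, Int.units_mul_self, one_mul]

lemma isTEven_smul_mul (hL : IsSignRigid L ε) (k : Fin m) :
    IsTEven (((ε k : ℤ) : ℂ[X]) • quasiIdentity n ε * L) := by
  rw [Matrix.smul_mul]
  exact hL.isTEven.units_smul _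

lemma isTEven_systemMatrix (hL : IsSignRigid L ε) (hEA : IsTEven (pencil R.E R.A)) (k : Fin m)
    (j : ℤ) : IsTEven
      (liftRealization m R j (((ε k : ℤ) : ℂ[X]) • quasiIdentity n ε * L)).systemMatrix :=
  isTEven_fromBlocks_iff.2 ⟨hL.isTEven_smul_mul k, rfl, hEA.neg⟩

lemma quasiIdentityExt_smul_eq (hL : IsSignRigid L ε) (hEA : IsTEven (pencil R.E R.A))
    (hk : ((k : ℕ) : ℤ) + 1 = j)
    (hδ : IsTEven (quasiIdentityExt r (((δ k : ℤ) : ℂ[X]) • quasiIdentity n δ) *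
      (liftRealization m R j L).systemMatrix)) :
    quasiIdentityExt r (((δ k : ℤ) : ℂ[X]) • quasiIdentity n δ) =
      quasiIdentityExt r (((ε k : ℤ) : ℂ[X]) • quasiIdentity n ε) := by
  rw [smul_quasiIdentity, isTEven_quasiIdentityExt_mul_systemMatrix_iff hk hEA] at hδ
  rw [← hL.smul_quasiIdentity_eq hδ.1 k, Int.units_mul_self, Units.val_one, Int.cast_one, one_smul,
    smul_quasiIdentity]

lemma quasiIdentityExt_eq (hL : IsSignRigid L ε) (hEA : IsTEven (pencil R.E R.A)) (hB : R.B ≠ 0)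
    (hk : ((k : ℕ) : ℤ) + 1 = j)
    (hδ : IsTEven (quasiIdentityExt r (quasiIdentity n δ) *
      (liftRealization m R j L).systemMatrix)) :
    quasiIdentityExt r (quasiIdentity n δ) =
      quasiIdentityExt r (((ε k : ℤ) : ℂ[X]) • quasiIdentity n ε) := by
  rw [isTEven_quasiIdentityExt_mul_systemMatrix_iff hk hEA] at hδ
  have hδk : δ k = 1 := eq_one_of_smul_blockCol_eq hk (mt transpose_eq_zero.1 hB) hδ.2
  rw [← hL.smul_quasiIdentity_eq hδ.1 k, hδk, Units.val_one, Int.cast_one, one_smul]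

end IsSignRigid

end SignChange

section Parameters

variable {m n r h p q s s' : ℕ} {w z cz : List ℤ} {R : Realization (Fin n) r}

lemma exists_admissible_parameters (hh : Even h) (hhm : h < m) (hw : IsAdmissible h q w)
    (hq : q = 0 ∨ q = 1) (hz : IsAdmissible (m - h - 1) p z) :
    ∃ s s', h = 2 * s ∧ q = 0 ∧ m - h - 1 = p + 2 * s' ∧ p + 2 * s' + 2 * s + 1 = m := by
  obtain ⟨s, hs⟩ := hh
  obtain ⟨s', hs'⟩ := hz.2.1
  obtain ⟨t, ht⟩ := hw.2.1
  have hqh := hw.1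
  have hph := hz.1
  exact ⟨s, s', by omega, by omega, by omega, by omega⟩

lemma pencilS_eq_systemMatrix (hC : R.C = R.Bᵀ) (hm : p + 2 * s' + 2 * s + 1 = m)
    (hw : IsAdmissible (2 * s) 0 w)
    (hz : IsAdmissible (p + 2 * s') p (z.map fun t => t + (m : ℤ)))
    (hcz : (cz.map fun t => t + (m : ℤ)) = symmetricComplement (p + 2 * s') p) :
    pencilS m R z w (symmetricComplement (2 * s) 0) cz =
      (liftRealization m R ((m : ℤ) - (min s 1 : ℕ))
        (pencilP m R.P z w (symmetricComplement (2 * s) 0) cz)).systemMatrix := by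
  rw [pencilS_eq R hm hw hz hcz, hC]
  rfl

lemma smul_quasiIdentity_mul_pencilP (P : Matrix (Fin n) (Fin n) ℂ[X])
    (hm : p + 2 * s' + 2 * s + 1 = m) (hw : IsAdmissible (2 * s) 0 w)
    (hz : IsAdmissible (p + 2 * s') p (z.map fun t => t + (m : ℤ)))
    (hcz : (cz.map fun t => t + (m : ℤ)) = symmetricComplement (p + 2 * s') p)
    (u : ℤˣ) (ε : Fin m → ℤˣ) :
    ((u : ℤ) : ℂ[X]) • quasiIdentity n ε *
        pencilP m P z w (symmetricComplement (2 * s) 0) cz =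
      signedPencil m (signSeq fun i => u * ε i) P p s' s := by
  rw [smul_quasiIdentity, quasiIdentity_eq, pencilP_eq P hm hw hz hcz, map_C_mul_pencil]
  rfl

lemma isRosenbrockStrongLinearization_smul (hRdeg : ∀ i j, (R.P i j).natDegree ≤ m)
    (hRmin : R.IsMinimal) (hC : R.C = R.Bᵀ) (hm : p + 2 * s' + 2 * s + 1 = m)
    (hw : IsAdmissible (2 * s) 0 w)
    (hz : IsAdmissible (p + 2 * s') p (z.map fun t => t + (m : ℤ)))
    (hcz : (cz.map fun t => t + (m : ℤ)) = symmetricComplement (p + 2 * s') p)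
    (hA : ¬IsUnit (coeffMat R.P m).det → p = 0) {k : Fin m}
    (hk : ((k : ℕ) : ℤ) + 1 = (m : ℤ) - (min s 1 : ℕ)) (ε : Fin m → ℤˣ) :
    IsRosenbrockStrongLinearization m R (liftRealization m R ((m : ℤ) - (min s 1 : ℕ))
      (((ε k : ℤ) : ℂ[X]) • quasiIdentity n ε *
        pencilP m R.P z w (symmetricComplement (2 * s) 0) cz)).systemMatrix := by
  rw [smul_quasiIdentity_mul_pencilP R.P hm hw hz hcz]
  refine isRosenbrockStrongLinearization_liftRealization hRdeg hRmin hC hm ?_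
    (signSeq_mul_self _) ?_
  · rw [isUnit_iff_isUnit_det]
    exact or_iff_not_imp_left.2 hA
  · rw [show m - 1 - min s 1 = k by omega, signSeq, dif_pos k.2, Int.units_mul_self, Units.val_one,
      Int.cast_one]

end Parameters

end

theorem theorem4p14 (n m r h : ℕ) (hh : Even h) (hhm : h < m)
    (G : Matrix (Fin n) (Fin n) (RatFunc ℂ)) (hG : IsTEvenRat G)
    (R : Realization (Fin n) r) (hRG : R.transfer = G)
    (hRdeg : HasDegree R.P m) (hRmin : R.IsMinimal) (hReven : R.IsTEvenRealization)
    (w z cw cz : List ℤ) (q p : ℕ)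
    (hw : IsAdmissible h q w) (hsimple : q = 0 ∨ q = 1)
    (hz : IsAdmissible (m - h - 1) p (z.map fun t => t + (m : ℤ)))
    (hcw : cw = symmetricComplement h q)
    (hcz : (cz.map fun t => t + (m : ℤ)) = symmetricComplement (m - h - 1) p) :
    ∃ k : Fin m, ((k : ℕ) : ℤ) + 1 = (m : ℤ) - inversionsAt 0 w ∧
    ∃ ε : Fin m → ℤˣ,
      let L := pencilP m R.P z w cw cz
      let LL := pencilS m R z w cw cz
      -- `s Q`, where `Q` has the parameters `δ` and `s` is its parameter number `m - i₀(w)`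
      let sQ := fun δ : Fin m → ℤˣ => ((δ k : ℤ) : ℂ[X]) • quasiIdentity n δ
      let QQ := quasiIdentityExt r (sQ ε)
      let R' := liftRealization m R ((m : ℤ) - inversionsAt 0 w) (sQ ε * L)
      -- `Q L` is T-even, and `Q` is unique with this property up to multiplication by `-1`
      (IsTEven (quasiIdentity n ε * L) ∧
        ∀ δ : Fin m → ℤˣ, IsTEven (quasiIdentity n δ * L) →
          quasiIdentity n δ = quasiIdentity n ε ∨ quasiIdentity n δ = -quasiIdentity n ε) ∧
      -- `diag(s Q, I_r)` makes the pencil T-even, with the displayed block form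
      (QQ * LL = R'.systemMatrix ∧ IsTEven (QQ * LL)) ∧
      -- it is the only matrix of this form that does
      (∀ δ : Fin m → ℤˣ,
        IsTEven (quasiIdentityExt r (sQ δ) * LL) → quasiIdentityExt r (sQ δ) = QQ) ∧
      (0 < r → ∀ δ : Fin m → ℤˣ,
        IsTEven (quasiIdentityExt r (quasiIdentity n δ) * LL) →
          quasiIdentityExt r (quasiIdentity n δ) = QQ) ∧
      ((¬ IsUnit (coeffMat R.P m).det → p = 0) → IsRosenbrockStrongLinearization m R (QQ * LL)) ∧
      IsTEvenRat R'.transfer := by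
  obtain ⟨s, s', rfl, rfl, hH, hm⟩ := exists_admissible_parameters hh hhm hw hsimple hz
  rw [hH] at hz hcz
  subst hcw
  have : NeZero n := ⟨by rintro rfl; exact hRdeg.2 (Subsingleton.elim _ _)⟩
  obtain ⟨hC, hP, hEA⟩ := hReven
  obtain ⟨k, hk⟩ : ∃ k : Fin m, ((k : ℕ) : ℤ) + 1 = (m : ℤ) - (min s 1 : ℕ) :=
    ⟨⟨m - 1 - min s 1, by omega⟩, by push_cast; omega⟩
  obtain ⟨ε, hL⟩ : ∃ ε, IsSignRigid (pencilP m R.P z w (symmetricComplement (2 * s) 0) cz) ε := by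
    rw [pencilP_eq R.P hm hw hz hcz]
    exact ⟨_, isSignRigid_pencil hm hRdeg.2 (isTEven_iff_coeffMat.1 hP)⟩
  rw [inversionsAt_zero_of_isAdmissible hw, pencilS_eq_systemMatrix hC hm hw hz hcz]
  refine ⟨k, hk, ε, ⟨hL.isTEven, fun δ => hL.eq_or_eq_neg⟩, ?_,
    fun δ => hL.quasiIdentityExt_smul_eq hEA hk,
    fun hr δ => hL.quasiIdentityExt_eq hEA (hRmin.B_ne_zero hr) hk, fun hA => ?_,
    Realization.IsTEvenRealization.transfer ⟨rfl, hL.isTEven_smul_mul k, hEA⟩⟩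
  · rw [smul_quasiIdentityExt_mul_systemMatrix hk]
    exact ⟨rfl, hL.isTEven_systemMatrix hEA k _⟩
  · rw [smul_quasiIdentityExt_mul_systemMatrix hk]
    exact isRosenbrockStrongLinearization_smul hRdeg.1 hRmin hC hm hw hz hcz hA hk _
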